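/- **Theorem 1.4.** Let $c\ge 2$ be a real number. The following four statements are equivalent: 1. $(1+\varepsilon)$-Approximate Directed APSP can be solved in strongly polynomial time $\tilde O(n^c/\mathrm{poly}(\varepsilon))$; 2. $(1+\varepsilon)$-Approximate Min-Plus Product can be solved in strongly polynomial time $\tilde O(n^c/\mathrm{poly}(\varepsilon))$; 3. exact Min-Max Product can be solved in strongly polynomial time $\tilde O(n^c)$; 4. exact All-Pairs Bottleneck Path can be solved in strongly polynomial time $\tilde O(n^c)$. Here all input weights lie in $[1,\infty)\cup\{\infty\}$, and the problems are: * *Approximate Directed APSP*: given a directed graph on $n$ nodes by its matrix of edge weights ($\infty$ where there is no edge), compute numbers $\tilde d(u,v)$ with $d(u,v)\le\tilde d(u,v)\le(1+\varepsilon)\,d(u,v)$ for all nodes $u,v$, where $d(u,v)$ is the minimal total weight of a path from $u$ to $v$ ($d(u,u)=0$, and $d(u,v)=\infty$ if there is no path). * *Approximate Min-Plus Product*: given $n\times n$ matrices $A,B$, compute $\tilde C$ with $C[i,j]\le\tilde C[i,j]\le(1+\varepsilon)\,C[i,j]$ for all $i,j$, where $C[i,j]=\min_k(A[i,k]+B[k,j])$.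 * *Min-Max Product*: given $n\times n$ matrices $A,B$, compute $C[i,j]=\min_k\max\{A[i,k],B[k,j]\}$ for all $i,j$. * *All-Pairs Bottleneck Path*: given a directed graph on $n$ nodes by its matrix of edge capacities ($0$ where there is no edge), compute for all nodes $u,v$ the maximum over all paths from $u$ to $v$ of the minimum capacity of an edge of the path ($0$ if there is no path, $\infty$ if $u=v$). The machine is a deterministic RAM with $w$-bit words. Each of the following costs one step: reading or writing a memory cell; arithmetic modulo $2^w$, division with remainder, bitwise operations, shifts and comparisons of words; and addition, subtraction, multiplication, division (rounded down to the mantissa length) and comparison of floating-point numbers. A floating-point number is a pair of words, an exponent $e\in\mathbb Z$ and a mantissa $f\in\{0,\dots,2^\gamma-1\}$ of $\gamma$ bits, and represents $2^e(1+f/2^\gamma)$. The values $\infty$ and $0$ are encoded by tags. *The approximate problems* have their weights in floating-point format with $\gamma$-bit mantissas and exponents in $\{0,\dots,2^\kappa-1\}$. Solvability in strongly polynomial time $\tilde O(n^c/\mathrm{poly}(\varepsilon))$ means: there are one program and one constant $K\in\mathbb N$ such that for all $n\ge1$, all rational $\varepsilon=p/q\in(0,\tfrac1{10})$ given by two words $p,q$,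 all $\gamma\ge K\log_2(n/\varepsilon)$, all $\kappa\ge 0$, all $w\ge K(\gamma+\kappa)$ and all inputs, the program, given $n,\gamma,p,q$ and the input, computes a correct output, again with $\gamma$-bit mantissas, in at most $K\,n^c\,\varepsilon^{-K}\,(\ln(n/\varepsilon))^K$ steps. *The exact problems* have as weights positive integers in bit representation, each in one word, or $\infty$. Solvability in strongly polynomial time $\tilde O(n^c)$ means: there are one program and one constant $K\in\mathbb N$ such that for all $n\ge1$, all $w\ge K\log_2(n+1)$ and all inputs, the program, given $n$ and the input, computes the correct output in at most $K\,n^c\,(\ln(n+2))^K$ steps. In particular the time bounds do not depend on the size of the weights. Nothing is assumed about the initial contents of registers and memory outside the input. -/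

import Mathlib

open scoped ENNReal

/-! ## The machine: a Word RAM with `w`-bit words and unit-cost floating-point arithmetic -/

namespace WordRAM

/-- The real number represented by a floating-point pair with exponent `e` and a mantissa
of `γ` bits, read as the integer `f`: `2 ^ e * (1 + f / 2 ^ γ)`. -/
noncomputable def fval (γ : ℕ) (e : ℤ) (f : ℕ) : ℝ :=
  (2 : ℝ) ^ e * (1 + (f : ℝ) / 2 ^ γ)

/-- Exponent `⌊log₂ z⌋` of the floating-point rounding of a positive real `z`. -/
noncomputable def fexp (z : ℝ) : ℤ :=
  if 0 < z then Int.log 2 z else 0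

/-- The `γ`-bit mantissa (as an integer) of the floating-point rounding of a positive real `z`;
rounding is downwards, so it is exact whenever `z` is representable. -/
noncomputable def fman (γ : ℕ) (z : ℝ) : ℤ :=
  if 0 < z then ⌊(z / (2 : ℝ) ^ fexp z - 1) * 2 ^ γ⌋ else 0

/-- Word operations: arithmetic modulo `2 ^ w`, (unsigned) division with remainder, bitwise
operations and shifts. -/
inductive WordOp
  | add | sub | mul | div | mod | and | or | xor | shl | shr

/-- Meaning of the word operations. -/
def WordOp.eval {w : ℕ} : WordOp → BitVec w → BitVec w → BitVec w
  | .add, a, b => a + b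
  | .sub, a, b => a - b
  | .mul, a, b => a * b
  | .div, a, b => a / b
  | .mod, a, b => a % b
  | .and, a, b => a &&& b
  | .or, a, b => a ||| b
  | .xor, a, b => a ^^^ b
  | .shl, a, b => a <<< b
  | .shr, a, b => a >>> b

/-- Floating-point operations. -/
inductive FloatOp
  | add | sub | mul | div

/-- Exact result of a floating-point operation, before rounding. -/
noncomputable def FloatOp.eval : FloatOp → ℝ → ℝ → ℝ
  | .add, x, y => x + y
  | .sub, x, y => x - y
  | .mul, x, y => x * y
  | .div, x, y => x / y

/-- Branching conditions; the numbers are names of registers. `flt e₁ f₁ e₂ f₂ g` compares two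
floating-point numbers with exponents `e₁`, `e₂` and mantissas `f₁`, `f₂` of bit length `g`. -/
inductive Test
  | eq (a b : ℕ)
  | lt (a b : ℕ)
  | flt (e₁ f₁ e₂ f₂ g : ℕ)

/-- Programs, in structured form. The machine has word-sized registers and random access memory,
which a program addresses in finitely many named segments, each an array indexed by words.
Registers and segments are named by the numbers in the program text. -/
inductive Prog
  | skip
  /-- `r := k` -/
  | const (r k : ℕ)
  /-- `r := a o b` -/
  | op (o : WordOp) (r a b : ℕ)
  /-- `(e, f) := (e₁, f₁) o (e₂, f₂)` in floating-point arithmetic with mantissas of bit length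
  given by the contents of register `g` -/
  | fop (o : FloatOp) (e f e₁ f₁ e₂ f₂ g : ℕ)
  /-- `r := s[a]` -/
  | load (r s a : ℕ)
  /-- `s[a] := r` -/
  | store (s a r : ℕ)
  | seq (P Q : Prog)
  | ite (b : Test) (P Q : Prog)
  | loop (b : Test) (P : Prog)

/-- Contents of the registers and of the memory segments. -/
structure State (w : ℕ) where
  reg : ℕ → BitVec w
  mem : ℕ → BitVec w → BitVec w

/-- The word `a` is written into register `r`. -/
def State.setReg {w : ℕ} (σ : State w) (r : ℕ) (a : BitVec w) : State w :=
  { σ with reg := Function.update σ.reg r a }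

/-- The word `a` is written into cell `x` of segment `s`. -/
def State.setMem {w : ℕ} (σ : State w) (s : ℕ) (x a : BitVec w) : State w :=
  { σ with mem := Function.update σ.mem s (Function.update (σ.mem s) x a) }

/-- The floating-point number held by registers `e` (exponent, a signed word) and `f` (mantissa),
the mantissa length being held by register `g`. -/
noncomputable def State.freg {w : ℕ} (σ : State w) (g e f : ℕ) : ℝ :=
  fval (σ.reg g).toNat (σ.reg e).toInt (σ.reg f).toNat

/-- Truth of a branching condition. -/
def Test.holds {w : ℕ} (σ : State w) : Test → Prop
  | .eq a b => σ.reg a = σ.reg b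
  | .lt a b => (σ.reg a).toNat < (σ.reg b).toNat
  | .flt e₁ f₁ e₂ f₂ g => σ.freg g e₁ f₁ < σ.freg g e₂ f₂

/-- `Exec P σ t σ₁`: program `P` started in state `σ` terminates in state `σ₁` after exactly `t`
steps. Each instruction and each evaluation of a branching condition is one step. -/
inductive Exec {w : ℕ} : Prog → State w → ℕ → State w → Prop
  | skip (σ : State w) : Exec .skip σ 1 σ
  | const (r k : ℕ) (σ : State w) : Exec (.const r k) σ 1 (σ.setReg r (BitVec.ofNat w k))
  | op (o : WordOp) (r a b : ℕ) (σ : State w) :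
      Exec (.op o r a b) σ 1 (σ.setReg r (o.eval (σ.reg a) (σ.reg b)))
  | fop (o : FloatOp) (e f e₁ f₁ e₂ f₂ g : ℕ) (σ : State w) (z : ℝ)
      (hz : z = o.eval (σ.freg g e₁ f₁) (σ.freg g e₂ f₂)) :
      Exec (.fop o e f e₁ f₁ e₂ f₂ g) σ 1
        ((σ.setReg e (BitVec.ofInt w (fexp z))).setReg f
          (BitVec.ofInt w (fman (σ.reg g).toNat z)))
  | load (r s a : ℕ) (σ : State w) :
      Exec (.load r s a) σ 1 (σ.setReg r (σ.mem s (σ.reg a)))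
  | store (s a r : ℕ) (σ : State w) :
      Exec (.store s a r) σ 1 (σ.setMem s (σ.reg a) (σ.reg r))
  | seq {P Q : Prog} {σ σ₁ σ₂ : State w} {t₁ t₂ : ℕ} :
      Exec P σ t₁ σ₁ → Exec Q σ₁ t₂ σ₂ → Exec (.seq P Q) σ (t₁ + t₂) σ₂
  | ite_true {b : Test} {P Q : Prog} {σ σ₁ : State w} {t : ℕ} :
      b.holds σ → Exec P σ t σ₁ → Exec (.ite b P Q) σ (1 + t) σ₁
  | ite_false {b : Test} {P Q : Prog} {σ σ₁ : State w} {t : ℕ} :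
      ¬ b.holds σ → Exec Q σ t σ₁ → Exec (.ite b P Q) σ (1 + t) σ₁
  | loop_true {b : Test} {P : Prog} {σ σ₁ σ₂ : State w} {t₁ t₂ : ℕ} :
      b.holds σ → Exec P σ t₁ σ₁ → Exec (.loop b P) σ₁ t₂ σ₂ →
        Exec (.loop b P) σ (1 + t₁ + t₂) σ₂
  | loop_false {b : Test} {P : Prog} {σ : State w} :
      ¬ b.holds σ → Exec (.loop b P) σ 1 σ

/-! ## Input and output formats -/

/-- Cell `i * n + j` of segment `s`: entry `(i, j)` of an `n × n` array stored row by row. -/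
def State.cell {w : ℕ} (σ : State w) (s n : ℕ) (i j : Fin n) : BitVec w :=
  σ.mem s (BitVec.ofNat w (i.val * n + j.val))

/-- The `n × n` matrix of floating-point numbers stored in the segments `s` (tags), `s + 1`
(exponents) and `s + 2` (mantissas). Tag `0` stands for zero, tag `1` for the positive number given
by exponent and mantissa, and any other tag for `∞`. -/
noncomputable def State.floatMat {w : ℕ} (σ : State w) (γ s n : ℕ) (i j : Fin n) : ℝ≥0∞ :=
  if (σ.cell s n i j).toNat = 0 then 0
  else if (σ.cell s n i j).toNat = 1 then
    ENNReal.ofReal (fval γ (σ.cell (s + 1) n i j).toInt (σ.cell (s + 2) n i j).toNat)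
  else ⊤

/-- The segments `s`, `s + 1`, `s + 2` hold an `n × n` matrix of floating-point numbers with
`γ`-bit mantissas and `κ`-bit exponents all of whose entries lie in `[1, ∞]`. -/
def State.FloatInput {w : ℕ} (σ : State w) (γ κ s n : ℕ) : Prop :=
  ∀ i j : Fin n,
    ((σ.cell s n i j).toNat = 1 ∧
      0 ≤ (σ.cell (s + 1) n i j).toInt ∧ (σ.cell (s + 1) n i j).toInt < 2 ^ κ ∧
      (σ.cell (s + 2) n i j).toNat < 2 ^ γ) ∨
    (σ.cell s n i j).toNat = 2

/-- The mantissas of the floating-point matrix stored in the segments `s`, `s + 1`, `s + 2` have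
`γ` bits. -/
def State.FloatOutput {w : ℕ} (σ : State w) (γ s n : ℕ) : Prop :=
  ∀ i j : Fin n, (σ.cell s n i j).toNat = 1 → (σ.cell (s + 2) n i j).toNat < 2 ^ γ

/-- The `n × n` matrix of integers in bit representation stored in the segments `s` (tags) and
`s + 1` (values). Tag `0` stands for zero, tag `1` for the integer held by the value cell, and any
other tag for `∞`. -/
def State.intMat {w : ℕ} (σ : State w) (s n : ℕ) (i j : Fin n) : ℕ∞ :=
  if (σ.cell s n i j).toNat = 0 then 0
  else if (σ.cell s n i j).toNat = 1 then ((σ.cell (s + 1) n i j).toNat : ℕ∞)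
  else ⊤

/-- The segments `s`, `s + 1` hold an `n × n` matrix of positive integers and `∞`s. -/
def State.IntInput {w : ℕ} (σ : State w) (s n : ℕ) : Prop :=
  ∀ i j : Fin n,
    ((σ.cell s n i j).toNat = 1 ∧ 1 ≤ (σ.cell (s + 1) n i j).toNat) ∨
    (σ.cell s n i j).toNat = 2

/-- The segments `s`, `s + 1` hold the capacities of a directed graph on `n` nodes: each pair of
nodes carries tag `0` if it is not an edge, and else a positive integer or `∞`. -/
def State.CapacityInput {w : ℕ} (σ : State w) (s n : ℕ) : Prop :=
  ∀ i j : Fin n,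
    (σ.cell s n i j).toNat = 0 ∨
    ((σ.cell s n i j).toNat = 1 ∧ 1 ≤ (σ.cell (s + 1) n i j).toNat) ∨
    (σ.cell s n i j).toNat = 2

end WordRAM

/-! ## The mathematical problems -/

/-- Min-Plus Product. -/
noncomputable def minPlus {n : ℕ} (A B : Fin n → Fin n → ℝ≥0∞) (i j : Fin n) : ℝ≥0∞ :=
  ⨅ k, (A i k + B k j)

/-- Min-Max Product. -/
noncomputable def minMax {n : ℕ} (A B : Fin n → Fin n → ℕ∞) (i j : Fin n) : ℕ∞ :=
  ⨅ k, max (A i k) (B k j)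

/-- Total weight of the path that starts in `u` and then visits the nodes of the list in order. -/
noncomputable def pathWeight {n : ℕ} (W : Fin n → Fin n → ℝ≥0∞) : Fin n → List (Fin n) → ℝ≥0∞
  | _, [] => 0
  | u, x :: l => W u x + pathWeight W x l

/-- Distance from `u` to `v` in the directed graph with edge weights `W`, where `W x y = ∞` if
`(x, y)` is not an edge: the minimal total weight of a path from `u` to `v`. The infimum is over all
walks, which gives the same value as simple paths. -/
noncomputable def graphDist {n : ℕ} (W : Fin n → Fin n → ℝ≥0∞) (u v : Fin n) : ℝ≥0∞ :=
  ⨅ l ∈ {l : List (Fin n) | (u :: l).getLast (List.cons_ne_nil u l) = v}, pathWeight W u l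

/-- Minimum capacity along the path that starts in `u` and then visits the nodes of the list in
order (`∞` for a path without edges). -/
noncomputable def pathCapacity {n : ℕ} (W : Fin n → Fin n → ℕ∞) : Fin n → List (Fin n) → ℕ∞
  | _, [] => ⊤
  | u, x :: l => min (W u x) (pathCapacity W x l)

/-- Maximum over all paths from `u` to `v` of the minimum capacity along the path, in the directed
graph with capacities `W`, where `W x y = 0` if `(x, y)` is not an edge. The value is `0` if there
is no path, and again walks give the same value as simple paths. -/
noncomputable def bottleneck {n : ℕ} (W : Fin n → Fin n → ℕ∞) (u v : Fin n) : ℕ∞ :=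
  ⨆ l ∈ {l : List (Fin n) | (u :: l).getLast (List.cons_ne_nil u l) = v}, pathCapacity W u l

/-! ## Solvability within a time bound -/

open WordRAM

/-- A problem with a precision parameter `ε < 1 / 10` has an approximation scheme running in strongly
polynomial time `Õ(n ^ c / poly(ε))`. `Pre γ κ n σ` says that `σ` holds an instance of size `n` with
`γ`-bit mantissas and `κ`-bit exponents, and `Post γ n ε σ σ₁` that `σ₁` holds a solution for it.

One program with one constant `C` has to work for all `n`, all rational `ε = p / q`, all mantissa
lengths `γ ≥ C * log₂ (n / ε)`, all exponent lengths `κ`, and all word sizes `w ≥ C * (γ + κ)`.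
The registers `0, 1, 2, 3` hold `n, γ, p, q`. Nothing is known about cells outside the input.
The time bound does not depend on the magnitude of the weights, nor on `γ`, `κ`, `w`. -/
def ApproxSolvable (c : ℝ)
    (Pre : ∀ {w : ℕ}, ℕ → ℕ → ℕ → State w → Prop)
    (Post : ∀ {w : ℕ}, ℕ → ℕ → ℝ≥0∞ → State w → State w → Prop) : Prop :=
  ∃ (P : Prog) (C : ℕ), ∀ n p q γ κ w : ℕ,
    1 ≤ n → 0 < p → 10 * p < q → q < 2 ^ w →
    ((n : ℝ) / ((p : ℝ) / q)) ^ C ≤ 2 ^ γ → C * (γ + κ) ≤ w →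
    ∀ σ : State w,
      σ.reg 0 = BitVec.ofNat w n → σ.reg 1 = BitVec.ofNat w γ →
      σ.reg 2 = BitVec.ofNat w p → σ.reg 3 = BitVec.ofNat w q →
      Pre γ κ n σ →
      ∃ (t : ℕ) (σ₁ : State w), Exec P σ t σ₁ ∧
        (t : ℝ) ≤ C * (n : ℝ) ^ c / ((p : ℝ) / q) ^ C * Real.log (n / ((p : ℝ) / q)) ^ C ∧
        Post γ n ((p : ℝ≥0∞) / q) σ σ₁

/-- A problem on integers is solvable in strongly polynomial time `Õ(n ^ c)`: one program with one
constant `C` has to work for all `n` and all word sizes `w ≥ C * log₂ (n + 1)`. Register `0` holds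
`n`. Nothing is known about cells outside the input. The time bound does not depend on the
magnitude of the input integers, nor on `w`. -/
def ExactSolvable (c : ℝ)
    (Pre : ∀ {w : ℕ}, ℕ → State w → Prop)
    (Post : ∀ {w : ℕ}, ℕ → State w → State w → Prop) : Prop :=
  ∃ (P : Prog) (C : ℕ), ∀ n w : ℕ,
    1 ≤ n → (n + 1) ^ C ≤ 2 ^ w →
    ∀ σ : State w,
      σ.reg 0 = BitVec.ofNat w n → Pre n σ →
      ∃ (t : ℕ) (σ₁ : State w), Exec P σ t σ₁ ∧
        (t : ℝ) ≤ C * (n : ℝ) ^ c * Real.log (n + 2) ^ C ∧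
        Post n σ σ₁

/-- `(1 + ε)`-Approximate Directed APSP is solvable in strongly polynomial time
`Õ(n ^ c / poly(ε))`. The edge weights are stored in the segments `0, 1, 2`, the result in
`6, 7, 8`. -/
def ApproxDirectedAPSPSolvable (c : ℝ) : Prop :=
  ApproxSolvable c
    (fun γ κ n σ => σ.FloatInput γ κ 0 n)
    (fun γ n ε σ σ₁ => σ₁.FloatOutput γ 6 n ∧ ∀ u v : Fin n,
      graphDist (σ.floatMat γ 0 n) u v ≤ σ₁.floatMat γ 6 n u v ∧
      σ₁.floatMat γ 6 n u v ≤ (1 + ε) * graphDist (σ.floatMat γ 0 n) u v)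

/-- `(1 + ε)`-Approximate Min-Plus Product is solvable in strongly polynomial time
`Õ(n ^ c / poly(ε))`. The matrices are stored in the segments `0, 1, 2` and `3, 4, 5`, the result in
`6, 7, 8`. -/
def ApproxMinPlusSolvable (c : ℝ) : Prop :=
  ApproxSolvable c
    (fun γ κ n σ => σ.FloatInput γ κ 0 n ∧ σ.FloatInput γ κ 3 n)
    (fun γ n ε σ σ₁ => σ₁.FloatOutput γ 6 n ∧ ∀ i j : Fin n,
      minPlus (σ.floatMat γ 0 n) (σ.floatMat γ 3 n) i j ≤ σ₁.floatMat γ 6 n i j ∧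
      σ₁.floatMat γ 6 n i j ≤ (1 + ε) * minPlus (σ.floatMat γ 0 n) (σ.floatMat γ 3 n) i j)

/-- Exact Min-Max Product is solvable in strongly polynomial time `Õ(n ^ c)`. The matrices are
stored in the segments `0, 1` and `2, 3`, the result in `4, 5`. -/
def MinMaxSolvable (c : ℝ) : Prop :=
  ExactSolvable c
    (fun n σ => σ.IntInput 0 n ∧ σ.IntInput 2 n)
    (fun n σ σ₁ => ∀ i j : Fin n,
      σ₁.intMat 4 n i j = minMax (σ.intMat 0 n) (σ.intMat 2 n) i j)

/-- Exact All-Pairs Bottleneck Path is solvable in strongly polynomial time `Õ(n ^ c)`. The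
capacities are stored in the segments `0, 1`, the result in `4, 5`. -/
def BottleneckSolvable (c : ℝ) : Prop :=
  ExactSolvable c
    (fun n σ => σ.CapacityInput 0 n)
    (fun n σ σ₁ => ∀ u v : Fin n,
      σ₁.intMat 4 n u v = bottleneck (σ.intMat 0 n) u v)

/-!
The four problems are reduced to one another in a cycle. Each reduction is a program that calls a
program for the other problem on numbers and matrices it has prepared; the called program is renamed
by `Prog.shift` to registers and segments from `100` on, so that the two do not interfere
(`Runs.shift`). Correctness and running time are proved together, with the total-correctness
predicate `Runs`.

*Bottleneck paths from approximate distances*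
(`bottleneckSolvable_of_approxDirectedAPSPSolvable`). Sort the capacities, and give an edge of the
`r`-th largest capacity the weight `2 ^ (2 * n * r)`. A simple path has fewer than `n` edges, so its
weight lies between that of its heaviest edge and `n` times that, and consecutive weights are a factor
`2 ^ (2 * n)` apart. Hence even a distance known only up to a factor `2` determines the rank of the
heaviest edge of a shortest path, and that rank is the rank of the bottleneck
(`RankWeights.bottleneck_eq`). Only exponents carry information, so the weights are floating-point
numbers with mantissa `0` and with `O(log n)`-bit exponents, and the precision can be the constant
`1 / 11`. The sorting is done by a bottom-up merge sort in `O(n ^ 2 log n)` steps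
(`sortAddresses_runs`).

*Min-Max Product from bottleneck paths* (`minMaxSolvable_of_bottleneckSolvable`). In a graph with
three layers of `n` nodes, the bottleneck from the first to the third layer is a max-min product
(`bottleneck_layered`). Reversing the order of the words by `v ↦ 2 ^ w - v` turns it into a min-max
product (`reversed_decode`).

*Approximate Min-Plus Product from Min-Max Product* (`approxMinPlusSolvable_of_minMaxSolvable`).
For positive `x`, `y` and `ρ`, the sum `x + y` is at most `max (x * (1 + ρ)) (y * (1 + 1 / ρ))`, with
equality for `ρ = y / x`. Minimizing over the `m ^ 2` ratios `ρ = k / m` only, with `m` of the order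
of `1 / ε`, costs a factor `1 + O(1 / m)` (`add_le_max_scaled`, `exists_max_scaled_le`). For a fixed
`ρ` the minimum over the middle index is a Min-Max Product of two scaled matrices. As floating-point
numbers are ordered lexicographically, the product can be computed on the integer codes
`e * 2 ^ γ + f + 1` (`fval_le_fval_iff`, `Codes.minMax`). All operations round down, so the result is
finally multiplied by `1 + 1 / m`, which outweighs the rounding errors and gives a bound from above
(`minPlus_of_scaled`).

*Approximate directed APSP from Approximate Min-Plus Product*
(`approxDirectedAPSPSolvable_of_approxMinPlusSolvable`). Repeated squaring: `l = ⌈log₂ n⌉` rounds, each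
with precision of the order of `ε / l`, give the error `(1 + ε / (2 * l)) ^ l ≤ 1 + ε`
(`squaring_error`). The inputs are at least `1`, so a matrix with zeros on its diagonal cannot be
passed on; the entrywise minimum of a matrix and its square serves the same purpose
(`ApproxWalks.square`).
-/

namespace WordRAM

/-! ### Total correctness with time bounds -/

@[simp] theorem State.setReg_reg {w : ℕ} (σ : State w) (r r' : ℕ) (a : BitVec w) :
    (σ.setReg r a).reg r' = if r' = r then a else σ.reg r' := by
  simp [State.setReg, Function.update_apply]

@[simp] theorem State.setReg_mem {w : ℕ} (σ : State w) (r : ℕ) (a : BitVec w) :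
    (σ.setReg r a).mem = σ.mem := rfl

@[simp] theorem State.setMem_reg {w : ℕ} (σ : State w) (s : ℕ) (x a : BitVec w) :
    (σ.setMem s x a).reg = σ.reg := rfl

@[simp] theorem State.setMem_mem {w : ℕ} (σ : State w) (s s' : ℕ) (x a y : BitVec w) :
    (σ.setMem s x a).mem s' y = if s' = s ∧ y = x then a else σ.mem s' y := by
  by_cases h : s' = s
  · subst h; simp [State.setMem, Function.update_apply]
  · simp [State.setMem, h]

/-- Sequential composition. -/
infixr:60 " ;; " => Prog.seq

/-- Total correctness with a time bound: `P` started in `σ` stops within `T` steps in a state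
satisfying `Q`. -/
def Runs {w : ℕ} (P : Prog) (T : ℕ) (σ : State w) (Q : State w → Prop) : Prop :=
  ∃ (t : ℕ) (σ₁ : State w), Exec P σ t σ₁ ∧ t ≤ T ∧ Q σ₁

theorem Runs.seq {w : ℕ} {P P' : Prog} {T T' : ℕ} {σ : State w} {Q R : State w → Prop}
    (h : Runs P T σ Q) (h' : ∀ σ₁, Q σ₁ → Runs P' T' σ₁ R) : Runs (P ;; P') (T + T') σ R := by
  obtain ⟨t, σ₁, e, ht, hQ⟩ := h
  obtain ⟨t', σ₂, e', ht', hR⟩ := h' σ₁ hQ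
  exact ⟨t + t', σ₂, .seq e e', by omega, hR⟩

theorem Runs.mono {w : ℕ} {P : Prog} {T T' : ℕ} {σ : State w} {Q R : State w → Prop}
    (h : Runs P T σ Q) (hT : T ≤ T') (hQ : ∀ σ₁, Q σ₁ → R σ₁) : Runs P T' σ R := by
  obtain ⟨t, σ₁, e, ht, hq⟩ := h
  exact ⟨t, σ₁, e, ht.trans hT, hQ _ hq⟩

/-- A loop whose guard can hold at most `B` times, by an invariant that counts the rounds. -/
theorem Runs.loop {w : ℕ} {b : Test} {P : Prog} {T B : ℕ} (Inv : ℕ → State w → Prop)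
    (step : ∀ k σ, Inv k σ → b.holds σ → k < B ∧ Runs P T σ (Inv (k + 1)))
    {σ : State w} (h0 : Inv 0 σ) :
    Runs (.loop b P) (B * (T + 1) + 1) σ (fun σ₁ => ∃ k ≤ B, Inv k σ₁ ∧ ¬ b.holds σ₁) := by
  suffices H : ∀ d k, k + d = B → ∀ σ, Inv k σ →
      Runs (.loop b P) (d * (T + 1) + 1) σ (fun σ₁ => ∃ k ≤ B, Inv k σ₁ ∧ ¬ b.holds σ₁) from
    H B 0 (by omega) σ h0
  intro d
  induction d with
  | zero =>
    intro k hk σ hI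
    by_cases hb : b.holds σ
    · exact absurd (step k σ hI hb).1 (by omega)
    · exact ⟨1, σ, .loop_false hb, by omega, k, by omega, hI, hb⟩
  | succ d ih =>
    intro k hk σ hI
    by_cases hb : b.holds σ
    · obtain ⟨t, σ₁, e, ht, hI'⟩ := (step k σ hI hb).2
      obtain ⟨t', σ₂, e', ht', hQ⟩ := ih (k + 1) (by omega) σ₁ hI'
      exact ⟨1 + t + t', σ₂, .loop_true hb e e', by rw [Nat.succ_mul]; omega, hQ⟩
    · exact ⟨1, σ, .loop_false hb, by omega, k, by omega, hI, hb⟩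

/-! ### Loop-free code -/

/-- Programs without loops. -/
def Prog.LoopFree : Prog → Prop
  | .seq P Q => P.LoopFree ∧ Q.LoopFree
  | .ite _ P Q => P.LoopFree ∧ Q.LoopFree
  | .loop _ _ => False
  | _ => True

/-- An upper bound for the running time of a loop-free program. -/
def Prog.size : Prog → ℕ
  | .seq P Q => P.size + Q.size
  | .ite _ P Q => 1 + P.size + Q.size
  | _ => 1

open Classical in
/-- The state transformation computed by a loop-free program. Loops are treated as `skip`. -/
noncomputable def Prog.eval {w : ℕ} : Prog → State w → State w
  | .skip, σ => σ
  | .const r k, σ => σ.setReg r (BitVec.ofNat w k)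
  | .op o r a b, σ => σ.setReg r (o.eval (σ.reg a) (σ.reg b))
  | .fop o e f e₁ f₁ e₂ f₂ g, σ =>
    (σ.setReg e (BitVec.ofInt w (fexp (o.eval (σ.freg g e₁ f₁) (σ.freg g e₂ f₂))))).setReg f
      (BitVec.ofInt w (fman (σ.reg g).toNat (o.eval (σ.freg g e₁ f₁) (σ.freg g e₂ f₂))))
  | .load r s a, σ => σ.setReg r (σ.mem s (σ.reg a))
  | .store s a r, σ => σ.setMem s (σ.reg a) (σ.reg r)
  | .seq P Q, σ => Q.eval (P.eval σ)
  | .ite b P Q, σ => if b.holds σ then P.eval σ else Q.eval σ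
  | .loop _ _, σ => σ

/-- Loop-free code behaves as `Prog.eval` says, within `Prog.size` steps. -/
theorem exec_eval {w : ℕ} {P : Prog} (h : P.LoopFree) (σ : State w) :
    ∃ t ≤ P.size, Exec P σ t (P.eval σ) := by
  induction P generalizing σ with
  | skip => exact ⟨1, le_rfl, .skip σ⟩
  | const r k => exact ⟨1, le_rfl, .const r k σ⟩
  | op o r a b => exact ⟨1, le_rfl, .op o r a b σ⟩
  | fop o e f e₁ f₁ e₂ f₂ g => exact ⟨1, le_rfl, .fop o e f e₁ f₁ e₂ f₂ g σ _ rfl⟩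
  | load r s a => exact ⟨1, le_rfl, .load r s a σ⟩
  | store s a r => exact ⟨1, le_rfl, .store s a r σ⟩
  | seq P Q ihP ihQ =>
    obtain ⟨t, ht, e⟩ := ihP h.1 σ
    obtain ⟨t', ht', e'⟩ := ihQ h.2 (P.eval σ)
    exact ⟨t + t', add_le_add ht ht', .seq e e'⟩
  | ite b P Q ihP ihQ =>
    by_cases hb : b.holds σ
    · obtain ⟨t, ht, e⟩ := ihP h.1 σ
      refine ⟨1 + t, ?_, ?_⟩
      · simp only [Prog.size]; omega
      · simpa [Prog.eval, hb] using Exec.ite_true (Q := Q) hb e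
    · obtain ⟨t, ht, e⟩ := ihQ h.2 σ
      refine ⟨1 + t, ?_, ?_⟩
      · simp only [Prog.size]; omega
      · simpa [Prog.eval, hb] using Exec.ite_false (P := P) hb e
  | loop b P => exact h.elim

theorem Runs.eval {w : ℕ} {P : Prog} (h : P.LoopFree) {σ : State w} {Q : State w → Prop}
    (hQ : Q (P.eval σ)) : Runs P P.size σ Q :=
  let ⟨t, ht, e⟩ := exec_eval h σ
  ⟨t, _, e, ht, hQ⟩

/-! ### Renaming of registers and segments -/

/-- Renaming of the registers of a test. -/
def Test.shift (d : ℕ) : Test → Test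
  | .eq a b => .eq (a + d) (b + d)
  | .lt a b => .lt (a + d) (b + d)
  | .flt e₁ f₁ e₂ f₂ g => .flt (e₁ + d) (f₁ + d) (e₂ + d) (f₂ + d) (g + d)

/-- The program `P` with `d` added to the names of all registers and segments. It leaves the
registers and segments below `d` to the surrounding program. -/
def Prog.shift (d : ℕ) : Prog → Prog
  | .skip => .skip
  | .const r k => .const (r + d) k
  | .op o r a b => .op o (r + d) (a + d) (b + d)
  | .fop o e f e₁ f₁ e₂ f₂ g => .fop o (e + d) (f + d) (e₁ + d) (f₁ + d) (e₂ + d) (f₂ + d) (g + d)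
  | .load r s a => .load (r + d) (s + d) (a + d)
  | .store s a r => .store (s + d) (a + d) (r + d)
  | .seq P Q => .seq (P.shift d) (Q.shift d)
  | .ite b P Q => .ite (b.shift d) (P.shift d) (Q.shift d)
  | .loop b P => .loop (b.shift d) (P.shift d)

/-- The part of a state that a program shifted by `d` works on. -/
def State.view {w : ℕ} (d : ℕ) (σ : State w) : State w :=
  ⟨fun r => σ.reg (r + d), fun s => σ.mem (s + d)⟩

theorem State.view_setReg {w : ℕ} (d r : ℕ) (σ : State w) (a : BitVec w) :
    (σ.setReg (r + d) a).view d = (σ.view d).setReg r a := by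
  simp only [State.view, State.setReg, State.mk.injEq, and_true]
  funext x
  simp [Function.update_apply]

theorem State.view_setMem {w : ℕ} (d s : ℕ) (σ : State w) (x a : BitVec w) :
    (σ.setMem (s + d) x a).view d = (σ.view d).setMem s x a := by
  simp only [State.view, State.setMem, State.mk.injEq, true_and]
  funext y
  simp [Function.update_apply]

theorem Test.shift_holds {w : ℕ} (d : ℕ) (b : Test) (σ : State w) :
    (b.shift d).holds σ ↔ b.holds (σ.view d) := by
  cases b <;> rfl

/-- An execution of a program lifts to an execution of the renamed program from every state whose view
is the given one; nothing below the offset is touched. -/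
theorem exec_shift {w : ℕ} (d : ℕ) {P : Prog} {τ τ' : State w} {t : ℕ} (h : Exec P τ t τ') :
    ∀ σ : State w, σ.view d = τ → ∃ σ', Exec (P.shift d) σ t σ' ∧ σ'.view d = τ' ∧
      (∀ r < d, σ'.reg r = σ.reg r) ∧ ∀ s < d, σ'.mem s = σ.mem s := by
  induction h with
  | skip τ => exact fun σ hσ => ⟨σ, .skip σ, hσ, fun _ _ => rfl, fun _ _ => rfl⟩
  | const r k τ =>
    rintro σ rfl
    refine ⟨_, .const _ _ σ, State.view_setReg .., fun r' hr => ?_, fun _ _ => rfl⟩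
    rw [State.setReg_reg, if_neg (by omega)]
  | op o r a b τ =>
    rintro σ rfl
    refine ⟨_, .op o _ _ _ σ, State.view_setReg .., fun r' hr => ?_, fun _ _ => rfl⟩
    rw [State.setReg_reg, if_neg (by omega)]
  | fop o e f e₁ f₁ e₂ f₂ g τ z hz =>
    rintro σ rfl
    refine ⟨_, .fop o _ _ _ _ _ _ _ σ z hz, ?_, fun r' hr => ?_, fun _ _ => rfl⟩
    · rw [State.view_setReg, State.view_setReg]; rfl
    · rw [State.setReg_reg, if_neg (by omega), State.setReg_reg, if_neg (by omega)]
  | load r s a τ =>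
    rintro σ rfl
    refine ⟨_, .load _ _ _ σ, State.view_setReg .., fun r' hr => ?_, fun _ _ => rfl⟩
    rw [State.setReg_reg, if_neg (by omega)]
  | store s a r τ =>
    rintro σ rfl
    refine ⟨_, .store _ _ _ σ, State.view_setMem .., fun _ _ => rfl, fun s' hs => ?_⟩
    funext y
    rw [State.setMem_mem, if_neg (by omega)]
  | seq _ _ ih₁ ih₂ =>
    intro σ hσ
    obtain ⟨σ₁, e₁, v₁, r₁, m₁⟩ := ih₁ σ hσ
    obtain ⟨σ₂, e₂, v₂, r₂, m₂⟩ := ih₂ σ₁ v₁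
    exact ⟨σ₂, .seq e₁ e₂, v₂, fun r hr => (r₂ r hr).trans (r₁ r hr),
      fun s hs => (m₂ s hs).trans (m₁ s hs)⟩
  | ite_true hb _ ih =>
    rintro σ rfl
    obtain ⟨σ₁, e₁, H⟩ := ih σ rfl
    exact ⟨σ₁, .ite_true ((Test.shift_holds d _ σ).2 hb) e₁, H⟩
  | ite_false hb _ ih =>
    rintro σ rfl
    obtain ⟨σ₁, e₁, H⟩ := ih σ rfl
    exact ⟨σ₁, .ite_false (mt (Test.shift_holds d _ σ).1 hb) e₁, H⟩
  | loop_true hb _ _ ih₁ ih₂ =>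
    rintro σ rfl
    obtain ⟨σ₁, e₁, v₁, r₁, m₁⟩ := ih₁ σ rfl
    obtain ⟨σ₂, e₂, v₂, r₂, m₂⟩ := ih₂ σ₁ v₁
    exact ⟨σ₂, .loop_true ((Test.shift_holds d _ σ).2 hb) e₁ e₂, v₂,
      fun r hr => (r₂ r hr).trans (r₁ r hr), fun s hs => (m₂ s hs).trans (m₁ s hs)⟩
  | loop_false hb =>
    rintro σ rfl
    exact ⟨σ, .loop_false (mt (Test.shift_holds d _ σ).1 hb), rfl, fun _ _ => rfl, fun _ _ => rfl⟩

/-- The specification of a program carries over to the renamed program, which moreover preserves all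
registers and segments below the offset. -/
theorem Runs.shift {w : ℕ} {d : ℕ} {P : Prog} {T : ℕ} {σ : State w} {Q : State w → Prop}
    (h : Runs P T (σ.view d) Q) :
    Runs (P.shift d) T σ (fun σ' => Q (σ'.view d) ∧
      (∀ r < d, σ'.reg r = σ.reg r) ∧ ∀ s < d, σ'.mem s = σ.mem s) := by
  obtain ⟨t, τ, e, ht, hQ⟩ := h
  obtain ⟨σ', e', rfl, H⟩ := exec_shift d e σ rfl
  exact ⟨t, σ', e', ht, hQ, H⟩

end WordRAM

namespace WordRAM

/-! ### Counting loops -/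

theorem ofNat_inj_of_lt {w a b : ℕ} (ha : a < 2 ^ w) (hb : b < 2 ^ w)
    (h : BitVec.ofNat w a = BitVec.ofNat w b) : a = b := by
  have := congrArg BitVec.toNat h
  rwa [BitVec.toNat_ofNat, BitVec.toNat_ofNat, Nat.mod_eq_of_lt ha, Nat.mod_eq_of_lt hb] at this

theorem toNat_ofNat_of_lt {w a : ℕ} (ha : a < 2 ^ w) : (BitVec.ofNat w a).toNat = a := by
  rw [BitVec.toNat_ofNat, Nat.mod_eq_of_lt ha]

/-- Sequential composition, the second part taking what is left of the time `B`. -/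
theorem Runs.andThen {w : ℕ} {P P' : Prog} {T B : ℕ} {σ : State w} {Q R : State w → Prop}
    (h : Runs P T σ Q) (hT : T ≤ B) (h' : ∀ σ₁, Q σ₁ → Runs P' (B - T) σ₁ R) :
    Runs (P ;; P') B σ R :=
  (h.seq h').mono (by omega) fun _ => id

/-- `for i in [0, lim) do body`, where `i` and `lim` name registers; register `41` is scratch. -/
def forUp (i lim : ℕ) (body : Prog) : Prog :=
  .const i 0 ;; .loop (.lt i lim) (body ;; .const 41 1 ;; .op .add i i 41)

/-- The invariant is indexed by the number of completed rounds. -/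
theorem Runs.forUp {w i lim N T : ℕ} {body : Prog} (hi : i ≠ 41) (hN : N < 2 ^ w)
    (Inv : ℕ → State w → Prop)
    (hreg : ∀ k σ, Inv k σ → σ.reg i = BitVec.ofNat w k ∧ σ.reg lim = BitVec.ofNat w N)
    (step : ∀ k < N, ∀ σ, Inv k σ → Runs body T σ (fun σ' =>
      Inv (k + 1) ((σ'.setReg 41 (BitVec.ofNat w 1)).setReg i (σ'.reg i + BitVec.ofNat w 1))))
    {σ : State w} (h0 : Inv 0 (σ.setReg i (BitVec.ofNat w 0))) :
    Runs (forUp i lim body) (N * (T + 3) + 2) σ (Inv N) := by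
  have key := Runs.loop (b := .lt i lim) (P := body ;; .const 41 1 ;; .op .add i i 41)
    (T := T + 2) (B := N) (fun k σ => k ≤ N ∧ Inv k σ) (σ := σ.setReg i (BitVec.ofNat w 0)) ?_
    ⟨Nat.zero_le _, h0⟩
  · refine Runs.mono (Runs.seq (Runs.eval (P := .const i 0) trivial (Q := fun σ' =>
      σ' = σ.setReg i (BitVec.ofNat w 0)) rfl) (fun σ₁ h => h ▸ key)) ?_ ?_
    · change 1 + (N * (T + 3) + 1) ≤ _; omega
    · rintro σ₁ ⟨k, -, ⟨hk, hI⟩, hb⟩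
      obtain ⟨h1, h2⟩ := hreg k σ₁ hI
      simp only [Test.holds, h1, h2, toNat_ofNat_of_lt hN,
        toNat_ofNat_of_lt (hk.trans_lt hN)] at hb
      obtain rfl : k = N := by omega
      exact hI
  · rintro k σ ⟨hk, hI⟩ hb
    obtain ⟨h1, h2⟩ := hreg k σ hI
    simp only [Test.holds, h1, h2, toNat_ofNat_of_lt hN, toNat_ofNat_of_lt (hk.trans_lt hN)] at hb
    refine ⟨hb, Runs.seq (step k hb σ hI) fun σ₁ h => Runs.eval
      (P := .const 41 1 ;; .op .add i i 41) ⟨trivial, trivial⟩ ⟨hb, ?_⟩⟩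
    simpa [Prog.eval, WordOp.eval, hi] using h

/-- `σ'` agrees with `σ` on the registers below `40`, which hold the variables of a program that
live across its loops, and on all segments outside the list `S`. -/
structure State.Same {w : ℕ} (S : List ℕ) (σ σ' : State w) : Prop where
  reg : ∀ r < 40, σ'.reg r = σ.reg r
  mem : ∀ s, s ∉ S → σ'.mem s = σ.mem s

theorem State.Same.refl {w : ℕ} (S : List ℕ) (σ : State w) : σ.Same S σ :=
  ⟨fun _ _ => rfl, fun _ _ => rfl⟩

theorem State.Same.trans {w : ℕ} {S S' S'' : List ℕ} {σ₁ σ₂ σ₃ : State w}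
    (h : σ₁.Same S σ₂) (h' : σ₂.Same S' σ₃) (hS : S ⊆ S'') (hS' : S' ⊆ S'') : σ₁.Same S'' σ₃ :=
  ⟨fun r hr => (h'.reg r hr).trans (h.reg r hr),
   fun s hs => (h'.mem s (fun h => hs (hS' h))).trans (h.mem s (fun h => hs (hS h)))⟩

/-- Loop-free code that writes only scratch registers `41, …, 99` and, in the segments `S`, the cells
whose address is in register `40`. -/
def Prog.isLocal (S : List ℕ) : Prog → Bool
  | .skip => true
  | .const r _ => 40 < r && r < 100
  | .op _ r _ _ => 40 < r && r < 100
  | .fop _ e f _ _ _ _ _ => 40 < e && e < 100 && 40 < f && f < 100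
  | .load r _ _ => 40 < r && r < 100
  | .store s a _ => S.contains s && a == 40
  | .seq P Q => P.isLocal S && Q.isLocal S
  | .ite _ P Q => P.isLocal S && Q.isLocal S
  | .loop _ _ => false

theorem Prog.isLocal.loopFree {S : List ℕ} {P : Prog} (h : P.isLocal S = true) : P.LoopFree := by
  induction P with
  | seq P Q ihP ihQ =>
    simp only [Prog.isLocal, Bool.and_eq_true] at h
    exact ⟨ihP h.1, ihQ h.2⟩
  | ite b P Q ihP ihQ =>
    simp only [Prog.isLocal, Bool.and_eq_true] at h
    exact ⟨ihP h.1, ihQ h.2⟩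
  | loop b P => exact absurd h (by simp [Prog.isLocal])
  | _ => exact trivial

/-- A local program changes only the registers from `40` on and the segments in `S`, the latter only at
the address in register `40`. -/
theorem Prog.isLocal.eval {w : ℕ} {S : List ℕ} {P : Prog} (h : P.isLocal S = true) (σ : State w) :
    σ.Same S (P.eval σ) ∧ (P.eval σ).reg 40 = σ.reg 40 ∧
      ∀ s a, a ≠ σ.reg 40 → (P.eval σ).mem s a = σ.mem s a := by
  induction P generalizing σ with
  | skip => exact ⟨.refl _ _, rfl, fun _ _ _ => rfl⟩
  | seq P Q ihP ihQ =>
    simp only [Prog.isLocal, Bool.and_eq_true] at h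
    obtain ⟨a, b, c⟩ := ihP h.1 σ
    obtain ⟨a', b', c'⟩ := ihQ h.2 (P.eval σ)
    exact ⟨a.trans a' (fun _ => id) (fun _ => id), b'.trans b,
      fun s x hx => (c' s x (b ▸ hx)).trans (c s x hx)⟩
  | ite b P Q ihP ihQ =>
    simp only [Prog.isLocal, Bool.and_eq_true] at h
    by_cases hb : b.holds σ
    · simpa only [Prog.eval, hb, if_true] using ihP h.1 σ
    · simpa only [Prog.eval, hb, if_false] using ihQ h.2 σ
  | loop b P => exact absurd h (by simp [Prog.isLocal])
  | store s a r =>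
    simp only [Prog.isLocal, Bool.and_eq_true, List.contains_iff_mem, beq_iff_eq] at h
    obtain ⟨hs, rfl⟩ := h
    refine ⟨⟨fun _ _ => rfl, fun s' hs' => ?_⟩, rfl, fun s' x hx => ?_⟩
    · funext x
      simp only [Prog.eval, State.setMem_mem]
      rw [if_neg]; rintro ⟨rfl, -⟩; exact hs' hs
    · simp only [Prog.eval, State.setMem_mem]
      rw [if_neg]; rintro ⟨-, h⟩; exact hx h
  | fop o e f e₁ f₁ e₂ f₂ g =>
    simp only [Prog.isLocal, Bool.and_eq_true, decide_eq_true_eq] at h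
    refine ⟨⟨fun r hr => ?_, fun _ _ => rfl⟩, ?_, fun _ _ _ => rfl⟩ <;>
    · simp only [Prog.eval, State.setReg_reg]
      rw [if_neg (by omega), if_neg (by omega)]
  | _ =>
    simp only [Prog.isLocal, Bool.and_eq_true, decide_eq_true_eq] at h
    refine ⟨⟨fun r hr => ?_, fun _ _ => rfl⟩, ?_, fun _ _ _ => rfl⟩ <;>
    · simp only [Prog.eval, State.setReg_reg]
      rw [if_neg (by omega)]

/-- Local code applied to the addresses `0, …, N - 1` in turn: the round for address `k` finds the
cells with that address as they were in the beginning, and nothing later changes what it leaves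
there. -/
theorem Runs.forEach {w lim N : ℕ} {S : List ℕ} {body : Prog} {σ : State w}
    (hb : body.isLocal S = true) (hlim : lim < 40)
    (hN : N < 2 ^ w) (hσ : σ.reg lim = BitVec.ofNat w N) (R : ℕ → (ℕ → BitVec w) → Prop)
    (step : ∀ k < N, ∀ σ', σ.Same S σ' → σ'.reg 40 = BitVec.ofNat w k →
      (∀ s, σ'.mem s (BitVec.ofNat w k) = σ.mem s (BitVec.ofNat w k)) →
      R k (fun s => (body.eval σ').mem s (BitVec.ofNat w k))) :
    Runs (WordRAM.forUp 40 lim body) (N * (body.size + 3) + 2) σ (fun σ' => σ.Same S σ' ∧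
      ∀ k < N, R k (fun s => σ'.mem s (BitVec.ofNat w k))) := by
  refine Runs.mono (Runs.forUp (N := N) (i := 40) (lim := lim) (by decide) hN (fun k σ' => k ≤ N ∧
    σ.Same S σ' ∧ σ'.reg 40 = BitVec.ofNat w k ∧
    (∀ y < N, k ≤ y → ∀ s, σ'.mem s (BitVec.ofNat w y) = σ.mem s (BitVec.ofNat w y)) ∧
    ∀ y < k, R y (fun s => σ'.mem s (BitVec.ofNat w y)))
    (fun k σ' h => ⟨h.2.2.1, (h.2.1.reg _ hlim).trans hσ⟩) ?_ ?_) le_rfl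
    (fun σ' h => ⟨h.2.1, h.2.2.2.2⟩)
  · rintro k hk σ' ⟨-, hsame, hr, hun, hdone⟩
    refine Runs.eval (Prog.isLocal.loopFree hb) ?_
    obtain ⟨a, b, c⟩ := Prog.isLocal.eval hb σ'
    have e := hsame.trans a (fun _ => id) (fun _ => id)
    refine ⟨hk, ⟨fun r h => ?_, e.mem⟩, ?_, fun y hy hky s => ?_, fun y hy => ?_⟩
    · simp only [State.setReg_reg]
      rw [if_neg (by omega), if_neg (by omega)]
      exact e.reg r h
    · simp only [State.setReg_reg, if_true, b, hr]
      exact (BitVec.ofNat_add k 1).symm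
    · refine (c s _ ?_).trans (hun y hy (by omega) s)
      rw [hr]; intro h
      have := ofNat_inj_of_lt (by omega) (by omega) h
      omega
    · rcases Nat.lt_succ_iff_lt_or_eq.1 hy with hy | rfl
      · have : (fun s => (Prog.eval body σ').mem s (BitVec.ofNat w y)) =
            fun s => σ'.mem s (BitVec.ofNat w y) := by
          funext s
          refine c s _ ?_
          rw [hr]; intro h
          have := ofNat_inj_of_lt (by omega) (by omega) h
          omega
        simp only [State.setReg_mem]
        rw [this]
        exact hdone y hy
      · exact step y hk σ' hsame hr (hun y hk le_rfl)
  · refine ⟨Nat.zero_le _, ⟨fun r hr => ?_, fun _ _ => rfl⟩, by simp, fun _ _ _ _ => rfl,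
      fun y hy => absurd hy (by omega)⟩
    simp only [State.setReg_reg]
    rw [if_neg (by omega)]

end WordRAM

namespace WordRAM

/-! ### Word arithmetic -/

theorem ofNat_div {w a b : ℕ} (ha : a < 2 ^ w) (hb : b < 2 ^ w) :
    BitVec.ofNat w a / BitVec.ofNat w b = BitVec.ofNat w (a / b) := by
  apply BitVec.eq_of_toNat_eq
  rw [BitVec.toNat_udiv, toNat_ofNat_of_lt ha, toNat_ofNat_of_lt hb,
    toNat_ofNat_of_lt ((Nat.div_le_self a b).trans_lt ha)]

theorem ofNat_mod {w a b : ℕ} (ha : a < 2 ^ w) (hb : b < 2 ^ w) :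
    BitVec.ofNat w a % BitVec.ofNat w b = BitVec.ofNat w (a % b) := by
  apply BitVec.eq_of_toNat_eq
  rw [BitVec.toNat_umod, toNat_ofNat_of_lt ha, toNat_ofNat_of_lt hb,
    toNat_ofNat_of_lt ((Nat.mod_le a b).trans_lt ha)]

theorem ofNat_eq_iff {w a b : ℕ} (ha : a < 2 ^ w) (hb : b < 2 ^ w) :
    BitVec.ofNat w a = BitVec.ofNat w b ↔ a = b :=
  ⟨ofNat_inj_of_lt ha hb, fun h => h ▸ rfl⟩

theorem eq_ofNat_iff {w a : ℕ} (x : BitVec w) (ha : a < 2 ^ w) :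
    x = BitVec.ofNat w a ↔ x.toNat = a := by
  rw [← BitVec.toNat_inj, toNat_ofNat_of_lt ha]

theorem ofNat_sub {w a b : ℕ} (hb : b ≤ a) :
    BitVec.ofNat w a - BitVec.ofNat w b = BitVec.ofNat w (a - b) := by
  have := BitVec.ofNat_add (n := w) (a - b) b
  rw [Nat.sub_add_cancel hb] at this
  rw [this, BitVec.add_sub_cancel]

end WordRAM

/-! ### Min-Max Product from bottleneck paths -/

/-- Since the minimum is attained, a Min-Max Product is determined by its comparisons with all numbers. -/
theorem minMax_eq_iff {n : ℕ} (hn : 1 ≤ n) (A B : Fin n → Fin n → ℕ∞) (i j : Fin n) (c : ℕ∞) :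
    c = minMax A B i j ↔
      (∃ k, c = max (A i k) (B k j)) ∧ ∀ k, c ≤ max (A i k) (B k j) := by
  have : Nonempty (Fin n) := ⟨⟨0, hn⟩⟩
  constructor
  · rintro rfl
    obtain ⟨k, hk⟩ := exists_eq_ciInf_of_finite (f := fun k => max (A i k) (B k j))
    exact ⟨⟨k, hk.symm⟩, fun k => iInf_le _ k⟩
  · rintro ⟨⟨k, hk⟩, h⟩
    exact le_antisymm (le_iInf h) (hk ▸ iInf_le _ k)

/-- In a graph with three layers and edges only between consecutive layers, the bottleneck from the
first to the last layer is a max-min product. -/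
theorem bottleneck_layered {n : ℕ} (W : Fin (3 * n) → Fin (3 * n) → ℕ∞)
    (h0 : ∀ x y, W x y ≠ 0 → (x.val / n = 0 ∧ y.val / n = 1) ∨ (x.val / n = 1 ∧ y.val / n = 2))
    (hn : 1 ≤ n) (x z : Fin (3 * n)) (hx : x.val / n = 0) (hz : z.val / n = 2) :
    (∃ y : Fin (3 * n), y.val / n = 1 ∧ bottleneck W x z = min (W x y) (W y z)) ∧
      ∀ y : Fin (3 * n), min (W x y) (W y z) ≤ bottleneck W x z := by
  have hle : ∀ y : Fin (3 * n), min (W x y) (W y z) ≤ bottleneck W x z := fun y => by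
    have h : min (W x y) (W y z) = pathCapacity W x [y, z] := by
      simp only [pathCapacity, min_top_right]
    exact h ▸ le_iSup₂ (f := fun l (_ : l ∈ {l : List (Fin (3 * n)) |
      (x :: l).getLast (List.cons_ne_nil x l) = z}) => pathCapacity W x l) [y, z] (by simp)
  refine ⟨?_, hle⟩
  have : Nonempty (Fin n) := ⟨⟨0, hn⟩⟩
  have hlt : ∀ k : Fin n, n + k.val < 3 * n := fun k => by have := k.isLt; omega
  obtain ⟨k, hk⟩ := exists_eq_ciSup_of_finite
    (f := fun k : Fin n => min (W x ⟨n + k, hlt k⟩) (W ⟨n + k, hlt k⟩ z))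
  have hdiv : ∀ k : Fin n, (n + k.val) / n = 1 := fun k => by
    rw [Nat.add_div_left _ hn, Nat.div_eq_of_lt k.isLt]
  refine ⟨⟨n + k, hlt k⟩, hdiv k, le_antisymm ?_ (hle _)⟩
  rw [hk]
  refine iSup₂_le fun l hl => ?_
  by_contra hcon
  have hne : pathCapacity W x l ≠ 0 := fun h => hcon (h ▸ zero_le)
  match l, hl with
  | [], hl => simp at hl; subst hl; omega
  | [y], hl =>
    simp at hl; subst hl
    simp only [pathCapacity, min_top_right] at hne
    have := h0 _ _ hne; omega
  | [y, z'], hl =>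
    simp at hl; subst hl
    simp only [pathCapacity, min_top_right] at hne hcon
    have h1 := h0 x y (fun h => hne (by simp [h]))
    have hy : y.val / n = 1 := by omega
    have hyn : y.val = n + y.val % n := by
      have := Nat.div_add_mod y.val n
      rw [hy, mul_one] at this; exact this.symm
    refine hcon (le_trans ?_ (le_iSup _ ⟨y.val % n, Nat.mod_lt _ hn⟩))
    have : (⟨n + y.val % n, by omega⟩ : Fin (3 * n)) = y := Fin.ext hyn.symm
    simp only [this, le_refl]
  | y :: z' :: u :: l, _ =>
    simp only [pathCapacity] at hne
    have h1 := h0 x y (fun h => hne (by simp [h]))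
    have h2 := h0 y z' (fun h => hne (by simp [h]))
    have h3 := h0 z' u (fun h => hne (by simp [h]))
    omega

namespace WordRAM

/-- `b` is the image of `a` under the order-reversing bijection `v ↦ M - v`, `∞ ↦ 0` from
`{1, …, M - 1, ∞}` to `{0, …, M - 1}`. -/
def Reversed (M : ℕ) (a b : ℕ∞) : Prop :=
  (∃ v : ℕ, 1 ≤ v ∧ v < M ∧ a = v ∧ b = (M - v : ℕ)) ∨ (a = ⊤ ∧ b = 0)

theorem Reversed.le_iff {M : ℕ} {a b a' b' : ℕ∞} (h : Reversed M a b) (h' : Reversed M a' b') :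
    a ≤ a' ↔ b' ≤ b := by
  rcases h with ⟨v, h1, h2, rfl, rfl⟩ | ⟨rfl, rfl⟩ <;>
  rcases h' with ⟨v', h1', h2', rfl, rfl⟩ | ⟨rfl, rfl⟩
  · rw [Nat.cast_le, Nat.cast_le]; omega
  · simp
  · simp only [top_le_iff, ENat.natCast_ne_top, false_iff, nonpos_iff_eq_zero, Nat.cast_eq_zero]
    omega
  · simp

theorem Reversed.max {M : ℕ} {a b a' b' : ℕ∞} (h : Reversed M a b) (h' : Reversed M a' b') :
    Reversed M (max a a') (min b b') := by
  rcases le_total a a' with hl | hl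
  · rw [max_eq_right hl, min_eq_right ((h.le_iff h').1 hl)]; exact h'
  · rw [max_eq_left hl, min_eq_left ((h'.le_iff h).1 hl)]; exact h

/-- The integer held by a pair of words, a tag and a value. -/
def intCell {w : ℕ} (t v : BitVec w) : ℕ∞ :=
  if t.toNat = 0 then 0 else if t.toNat = 1 then (v.toNat : ℕ∞) else ⊤

theorem State.intMat_eq {w : ℕ} (σ : State w) (s n : ℕ) (i j : Fin n) :
    σ.intMat s n i j = intCell (σ.cell s n i j) (σ.cell (s + 1) n i j) := rfl

/-- `(t', v')` results from `(t, v)` by the order reversal `Reversed`. -/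
def RevCell {w : ℕ} (t v t' v' : BitVec w) : Prop :=
  (t = BitVec.ofNat w 1 → t' = BitVec.ofNat w 1 ∧ v' = BitVec.ofNat w 0 - v) ∧
  (t ≠ BitVec.ofNat w 1 → t' = BitVec.ofNat w 0)

theorem toNat_zero_sub {w : ℕ} (v : BitVec w) (hv : 1 ≤ v.toNat) :
    (BitVec.ofNat w 0 - v).toNat = 2 ^ w - v.toNat := by
  have := v.isLt
  rw [BitVec.toNat_sub, BitVec.toNat_ofNat, Nat.zero_mod, add_zero, Nat.mod_eq_of_lt (by omega)]

theorem RevCell.reversed {w : ℕ} {t v t' v' : BitVec w} (hw : 2 < 2 ^ w) (h : RevCell t v t' v')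
    (ht : (t.toNat = 1 ∧ 1 ≤ v.toNat) ∨ t.toNat = 2) :
    Reversed (2 ^ w) (intCell t v) (intCell t' v') := by
  rcases ht with ⟨ht, hv⟩ | ht
  · obtain ⟨rfl, rfl⟩ := h.1 ((eq_ofNat_iff _ (by omega)).2 ht)
    left
    refine ⟨v.toNat, hv, v.isLt, by simp [intCell, ht], ?_⟩
    simp only [intCell, toNat_ofNat_of_lt (show 1 < 2 ^ w by omega), one_ne_zero, if_false,
      if_true, toNat_zero_sub v hv]
  · have := h.2 (fun h => by rw [eq_ofNat_iff _ (by omega)] at h; omega)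
    subst this
    right
    simp [intCell, ht]

theorem RevCell.capacity {w : ℕ} {t v t' v' : BitVec w} (hw : 2 < 2 ^ w) (h : RevCell t v t' v')
    (ht : (t.toNat = 1 ∧ 1 ≤ v.toNat) ∨ t.toNat = 2) :
    t'.toNat = 0 ∨ (t'.toNat = 1 ∧ 1 ≤ v'.toNat) := by
  rcases ht with ⟨ht, hv⟩ | ht
  · obtain ⟨rfl, rfl⟩ := h.1 ((eq_ofNat_iff _ (by omega)).2 ht)
    right
    have := v.isLt
    rw [toNat_zero_sub v hv, toNat_ofNat_of_lt (by omega)]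
    omega
  · rw [h.2 (fun h => by rw [eq_ofNat_iff _ (by omega)] at h; omega)]
    left; simp

/-- Decoding of a word pair by the reversed order. The number zero may be encoded in two ways, by its
tag or as a value. -/
theorem reversed_decode {w : ℕ} {t v t' v' : BitVec w} {a : ℕ∞} (hw : 2 < 2 ^ w)
    (h : t = BitVec.ofNat w 0 ∨ v = BitVec.ofNat w 0 → t' = BitVec.ofNat w 2)
    (h' : t ≠ BitVec.ofNat w 0 → v ≠ BitVec.ofNat w 0 →
      t' = BitVec.ofNat w 1 ∧ v' = BitVec.ofNat w 0 - v)
    (ha : Reversed (2 ^ w) a (intCell t v)) : intCell t' v' = a := by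
  by_cases hz : t = BitVec.ofNat w 0 ∨ v = BitVec.ofNat w 0
  · rw [h hz]
    have hb : intCell t v = 0 ∨ intCell t v = ⊤ := by
      simp only [eq_ofNat_iff _ (show 0 < 2 ^ w by omega)] at hz
      unfold intCell
      split_ifs with h1 h2
      · exact Or.inl rfl
      · rw [hz.resolve_left h1]; exact Or.inl rfl
      · exact Or.inr rfl
    rcases ha with ⟨u, h1, h2, rfl, hu⟩ | ⟨rfl, -⟩
    · exfalso
      rw [hu] at hb
      simp only [Nat.cast_eq_zero, ENat.natCast_ne_top, or_false] at hb
      omega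
    · simp [intCell, toNat_ofNat_of_lt hw]
  · push Not at hz
    obtain ⟨rfl, rfl⟩ := h' hz.1 hz.2
    have hz' := hz
    rw [Ne, Ne, eq_ofNat_iff _ (show 0 < 2 ^ w by omega),
      eq_ofNat_iff _ (show 0 < 2 ^ w by omega)] at hz'
    have hv := v.isLt
    simp only [intCell, toNat_ofNat_of_lt (show 1 < 2 ^ w by omega), one_ne_zero, if_false,
      if_true, toNat_zero_sub v (by omega), hz'.1] at ha ⊢
    rcases ha with ⟨u, h1, h2, rfl, hu⟩ | ⟨rfl, hu⟩
    · split_ifs at hu with h3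
      · rw [Nat.cast_inj] at hu ⊢; omega
      · exact absurd hu.symm (ENat.natCast_ne_top _)
    · split_ifs at hu with h3
      · rw [Nat.cast_eq_zero] at hu; omega
      · exact absurd hu.symm (by simp)

/-- Reduction of Min-Max Product to bottleneck paths by the program `P`: write the capacities of the
layered graph, call `P`, and read off the paths from the first to the last layer. The address of a
capacity is divided by `3 n` to obtain its row and column, and these by `n` to obtain their layers. -/
def minMaxByBottleneck (P : Prog) : Prog :=
  (.const 5 3 ;; .op .mul 6 0 5 ;; .op .mul 7 0 0 ;; .op .mul 8 6 6 ;; .op .add 9 0 0 ;;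
    .const 10 0 ;; .const 11 2 ;; .const 12 1) ;;
  forUp 40 8
    (.op .div 42 40 6 ;; .op .mod 43 40 6 ;; .op .div 44 42 0 ;; .op .div 45 43 0 ;;
      .op .mod 42 42 0 ;; .op .mod 43 43 0 ;; .op .mul 42 42 0 ;; .op .add 42 42 43 ;;
      .const 46 0 ;;
      .ite (.eq 44 10) (.ite (.eq 45 12) (.load 46 0 42 ;; .load 47 1 42) .skip)
        (.ite (.eq 44 12) (.ite (.eq 45 11) (.load 46 2 42 ;; .load 47 3 42) .skip) .skip) ;;
      .ite (.eq 46 12) (.op .sub 47 10 47 ;; .store 100 40 12 ;; .store 101 40 47)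
        (.store 100 40 10)) ;;
  (.op .or 100 6 6) ;;
  P.shift 100 ;;
  forUp 40 7
    (.op .div 42 40 0 ;; .op .mod 43 40 0 ;; .op .mul 42 42 6 ;; .op .add 42 42 9 ;;
      .op .add 42 42 43 ;; .load 46 104 42 ;; .load 47 105 42 ;;
      .ite (.eq 46 10) (.store 4 40 11)
        (.ite (.eq 47 10) (.store 4 40 11)
          (.op .sub 47 10 47 ;; .store 4 40 12 ;; .store 5 40 47)))

/-- Correctness of the reduction. The bound on `n` makes room for the `9 n ^ 2` addresses of the layered
graph. -/
theorem minMaxByBottleneck_runs (P : Prog) : ∃ K : ℕ, ∀ {w n T : ℕ} (σ : State w), 1 ≤ n →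
    (n + 1) ^ 6 ≤ 2 ^ w → σ.reg 0 = BitVec.ofNat w n → σ.IntInput 0 n → σ.IntInput 2 n →
    (∀ τ : State w, τ.reg 0 = BitVec.ofNat w (3 * n) → τ.CapacityInput 0 (3 * n) →
      Runs P T τ (fun τ' => ∀ u v : Fin (3 * n),
        τ'.intMat 4 (3 * n) u v = bottleneck (τ.intMat 0 (3 * n)) u v)) →
    Runs (minMaxByBottleneck P) (K * n ^ 2 + T) σ (fun σ₁ => ∀ i j : Fin n,
      σ₁.intMat 4 n i j = minMax (σ.intMat 0 n) (σ.intMat 2 n) i j) := by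
  refine ⟨1000, ?_⟩
  intro w n T σ hn hw h0 hA hB hP
  have hn9 : 9 * (n * n) < 2 ^ w := by
    refine lt_of_lt_of_le ?_ hw
    have : 16 ≤ (n + 1) ^ 4 := Nat.pow_le_pow_left (show 2 ≤ n + 1 by omega) 4
    nlinarith [Nat.mul_le_mul this (le_refl ((n + 1) ^ 2))]
  have hnn : n ≤ n * n := Nat.le_mul_of_pos_left n hn
  have hw2 : 2 < 2 ^ w := by omega
  have hn1 : n < 2 ^ w := by omega
  have h3n : 3 * n < 2 ^ w := by omega
  rw [pow_two]
  refine Runs.andThen (Runs.eval (Q := fun σ₁ => σ₁.reg 0 = BitVec.ofNat w n ∧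
    σ₁.reg 6 = BitVec.ofNat w (3 * n) ∧ σ₁.reg 7 = BitVec.ofNat w (n * n) ∧
    σ₁.reg 8 = BitVec.ofNat w (9 * (n * n)) ∧ σ₁.reg 9 = BitVec.ofNat w (2 * n) ∧
    σ₁.reg 10 = BitVec.ofNat w 0 ∧ σ₁.reg 11 = BitVec.ofNat w 2 ∧ σ₁.reg 12 = BitVec.ofNat w 1 ∧
    σ₁.mem = σ.mem) (by simp [Prog.LoopFree]) ?_) ?_ ?_
  · simp [Prog.eval, WordOp.eval, h0, ← BitVec.ofNat_mul, ← BitVec.ofNat_add]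
    refine ⟨?_, ?_, ?_⟩ <;> congr 1 <;> ring
  · simp [Prog.size]; omega
  rintro σ₁ ⟨r0, r6, r7, r8, r9, r10, r11, r12, m1⟩
  refine Runs.andThen (Runs.forEach (S := [100, 101]) rfl (by decide) hn9 r8
    (fun a col =>
      (a / (3 * n) / n = 0 ∧ a % (3 * n) / n = 1 →
        RevCell (σ.mem 0 (.ofNat w (a / (3 * n) % n * n + a % (3 * n) % n)))
          (σ.mem 1 (.ofNat w (a / (3 * n) % n * n + a % (3 * n) % n))) (col 100) (col 101)) ∧
      (a / (3 * n) / n = 1 ∧ a % (3 * n) / n = 2 →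
        RevCell (σ.mem 2 (.ofNat w (a / (3 * n) % n * n + a % (3 * n) % n)))
          (σ.mem 3 (.ofNat w (a / (3 * n) % n * n + a % (3 * n) % n))) (col 100) (col 101)) ∧
      (¬ (a / (3 * n) / n = 0 ∧ a % (3 * n) / n = 1) →
        ¬ (a / (3 * n) / n = 1 ∧ a % (3 * n) / n = 2) → col 100 = .ofNat w 0)) ?_) ?_ ?_
  · intro a ha σ₂ hs h40 hcol
    have r0' := (hs.reg 0 (by decide)).trans r0
    have r6' := (hs.reg 6 (by decide)).trans r6
    have r10' := (hs.reg 10 (by decide)).trans r10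
    have r11' := (hs.reg 11 (by decide)).trans r11
    have r12' := (hs.reg 12 (by decide)).trans r12
    have m0 := (hs.mem 0 (by decide)).trans (congrFun m1 0)
    have m1' := (hs.mem 1 (by decide)).trans (congrFun m1 1)
    have m2 := (hs.mem 2 (by decide)).trans (congrFun m1 2)
    have m3 := (hs.mem 3 (by decide)).trans (congrFun m1 3)
    have ha' := ha.trans hn9
    have d1 := ofNat_div ha' h3n
    have d2 := ofNat_mod ha' h3n
    have d3 := ofNat_div ((Nat.div_le_self a (3 * n)).trans_lt ha') hn1
    have d4 := ofNat_div ((Nat.mod_le a (3 * n)).trans_lt ha') hn1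
    have d5 := ofNat_mod ((Nat.div_le_self a (3 * n)).trans_lt ha') hn1
    have d6 := ofNat_mod ((Nat.mod_le a (3 * n)).trans_lt ha') hn1
    have b1 := ((Nat.div_le_self _ n).trans (Nat.div_le_self a (3 * n))).trans_lt ha'
    have b2 := ((Nat.div_le_self _ n).trans (Nat.mod_le a (3 * n))).trans_lt ha'
    have e01 : ¬ BitVec.ofNat w 0 = BitVec.ofNat w 1 := by
      rw [ofNat_eq_iff (by omega) (by omega)]; omega
    have q1 := ofNat_eq_iff b1 (show 0 < 2 ^ w by omega)
    have q2 := ofNat_eq_iff b2 (show 1 < 2 ^ w by omega)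
    have q3 := ofNat_eq_iff b1 (show 1 < 2 ^ w by omega)
    have q4 := ofNat_eq_iff b2 (show 2 < 2 ^ w by omega)
    generalize a / (3 * n) = X at *
    generalize a % (3 * n) = Y at *
    refine ⟨?_, ?_, ?_⟩
    · rintro ⟨c1, c2⟩
      constructor <;> intro ht <;>
      simp [Prog.eval, WordOp.eval, Test.holds, r0', r6', r10', r12', h40, m0, m1', d1, d2, d3, d4,
        d5, d6, ← BitVec.ofNat_mul, ← BitVec.ofNat_add, c1, c2, ht]
    · rintro ⟨c1, c2⟩
      constructor <;> intro ht <;>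
      simp [Prog.eval, WordOp.eval, Test.holds, r0', r6', r10', r11', r12', h40, m2, m3, d1, d2, d3,
        d4, d5, d6, ← BitVec.ofNat_mul, ← BitVec.ofNat_add, c1, c2, ht, Ne.symm e01]
    · intro c1 c2
      by_cases x0 : X / n = 0
      · have y0 : ¬ Y / n = 1 := fun h => c1 ⟨x0, h⟩
        simp [Prog.eval, WordOp.eval, Test.holds, r0', r6', r10', r12', h40, d1, d2, d3,
          d4, d5, d6, ← BitVec.ofNat_mul, ← BitVec.ofNat_add, x0, q2, y0, e01]
      · by_cases x1 : X / n = 1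
        · have y1 : ¬ Y / n = 2 := fun h => c2 ⟨x1, h⟩
          simp [Prog.eval, WordOp.eval, Test.holds, r0', r6', r10', r11', r12', h40, d1, d2, d3,
            d4, d5, d6, ← BitVec.ofNat_mul, ← BitVec.ofNat_add, x1, q4, y1, e01, Ne.symm e01]
        · simp [Prog.eval, WordOp.eval, Test.holds, r0', r6', r10', r12', h40, d1, d2, d3,
            d4, d5, d6, ← BitVec.ofNat_mul, ← BitVec.ofNat_add, q1, x0, q3, x1, e01]
  · simp [Prog.size]; omega
  rintro σ₂ ⟨hs, hR⟩
  refine Runs.andThen (Runs.eval (Q := fun σ₃ => σ₃ = σ₂.setReg 100 (BitVec.ofNat w (3 * n)))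
    (by simp [Prog.LoopFree]) ?_) ?_ ?_
  · simp [Prog.eval, WordOp.eval, hs.reg 6, r6]
  · simp [Prog.size]; omega
  rintro _ rfl
  -- the capacities of the layered graph
  have hcell : ∀ x y : Fin (3 * n), x.val * (3 * n) + y.val < 9 * (n * n) ∧
      (x.val * (3 * n) + y.val) / (3 * n) = x ∧ (x.val * (3 * n) + y.val) % (3 * n) = y := by
    intro x y
    have hx := x.isLt
    have hy := y.isLt
    refine ⟨by nlinarith, ?_, ?_⟩
    · rw [mul_comm, Nat.mul_add_div (by omega), Nat.div_eq_of_lt hy, add_zero]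
    · rw [mul_comm, Nat.mul_add_mod, Nat.mod_eq_of_lt hy]
  set τ : State w := (σ₂.setReg 100 (BitVec.ofNat w (3 * n))).view 100 with hτ
  have hR' : ∀ x y : Fin (3 * n),
      (∀ h : x.val / n = 0 ∧ y.val / n = 1, Reversed (2 ^ w)
        (σ.intMat 0 n ⟨x % n, Nat.mod_lt _ hn⟩ ⟨y % n, Nat.mod_lt _ hn⟩)
        (τ.intMat 0 (3 * n) x y)) ∧
      (∀ h : x.val / n = 1 ∧ y.val / n = 2, Reversed (2 ^ w)
        (σ.intMat 2 n ⟨x % n, Nat.mod_lt _ hn⟩ ⟨y % n, Nat.mod_lt _ hn⟩)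
        (τ.intMat 0 (3 * n) x y)) ∧
      (τ.intMat 0 (3 * n) x y ≠ 0 → (x.val / n = 0 ∧ y.val / n = 1) ∨
        (x.val / n = 1 ∧ y.val / n = 2)) := by
    intro x y
    obtain ⟨h1, h2, h3⟩ := hcell x y
    have H := hR _ h1
    simp only [h2, h3] at H
    refine ⟨fun h => ?_, fun h => ?_, fun h => ?_⟩
    · exact (H.1 h).reversed hw2 (hA _ _)
    · exact (H.2.1 h).reversed hw2 (hB _ _)
    · by_contra hc
      push Not at hc
      have := H.2.2 (fun h => hc.1 h.1 h.2) (fun h => hc.2 h.1 h.2)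
      refine h ?_
      simp only [State.intMat_eq, intCell, State.cell, hτ, State.view, State.setReg_mem, zero_add]
      simp [this]
  refine Runs.andThen (Runs.shift (hP τ ?_ ?_)) ?_ ?_
  · simp [hτ, State.view]
  · intro x y
    obtain ⟨h1, h2, h3⟩ := hcell x y
    have H := hR _ h1
    simp only [h2, h3] at H
    by_cases c1 : x.val / n = 0 ∧ y.val / n = 1
    · exact ((H.1 c1).capacity hw2
        (hA ⟨x % n, Nat.mod_lt _ hn⟩ ⟨y % n, Nat.mod_lt _ hn⟩)).imp id Or.inl
    · by_cases c2 : x.val / n = 1 ∧ y.val / n = 2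
      · exact ((H.2.1 c2).capacity hw2
          (hB ⟨x % n, Nat.mod_lt _ hn⟩ ⟨y % n, Nat.mod_lt _ hn⟩)).imp id Or.inl
      · left
        have := H.2.2 c1 c2
        simp only [State.cell, hτ, State.view, State.setReg_mem, zero_add]
        simp [this]
  · simp [Prog.size]; omega
  rintro σ₃ ⟨hpost, hreg, hmem⟩
  have s0 : σ₃.reg 0 = BitVec.ofNat w n := by rw [hreg 0 (by decide)]; simp [hs.reg 0, r0]
  have s6 : σ₃.reg 6 = BitVec.ofNat w (3 * n) := by rw [hreg 6 (by decide)]; simp [hs.reg 6, r6]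
  have s7 : σ₃.reg 7 = BitVec.ofNat w (n * n) := by rw [hreg 7 (by decide)]; simp [hs.reg 7, r7]
  have s9 : σ₃.reg 9 = BitVec.ofNat w (2 * n) := by rw [hreg 9 (by decide)]; simp [hs.reg 9, r9]
  have s10 : σ₃.reg 10 = BitVec.ofNat w 0 := by rw [hreg 10 (by decide)]; simp [hs.reg 10, r10]
  have s11 : σ₃.reg 11 = BitVec.ofNat w 2 := by rw [hreg 11 (by decide)]; simp [hs.reg 11, r11]
  have s12 : σ₃.reg 12 = BitVec.ofNat w 1 := by rw [hreg 12 (by decide)]; simp [hs.reg 12, r12]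
  refine Runs.mono (Runs.forEach (S := [4, 5]) rfl (by decide) (N := n * n) (by omega) s7
    (fun x col =>
      (σ₃.mem 104 (.ofNat w (x / n * (3 * n) + (2 * n + x % n))) = .ofNat w 0 ∨
        σ₃.mem 105 (.ofNat w (x / n * (3 * n) + (2 * n + x % n))) = .ofNat w 0 →
        col 4 = .ofNat w 2) ∧
      (σ₃.mem 104 (.ofNat w (x / n * (3 * n) + (2 * n + x % n))) ≠ .ofNat w 0 →
        σ₃.mem 105 (.ofNat w (x / n * (3 * n) + (2 * n + x % n))) ≠ .ofNat w 0 →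
        col 4 = .ofNat w 1 ∧ col 5 = .ofNat w 0 -
          σ₃.mem 105 (.ofNat w (x / n * (3 * n) + (2 * n + x % n))))) ?_) ?_ ?_
  · intro x hx σ₄ hs' h40 hcol
    have r0' := (hs'.reg 0 (by decide)).trans s0
    have r6' := (hs'.reg 6 (by decide)).trans s6
    have r9' := (hs'.reg 9 (by decide)).trans s9
    have r10' := (hs'.reg 10 (by decide)).trans s10
    have r11' := (hs'.reg 11 (by decide)).trans s11
    have r12' := (hs'.reg 12 (by decide)).trans s12
    have m104 := hs'.mem 104 (by decide)
    have m105 := hs'.mem 105 (by decide)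
    have d1 := ofNat_div (w := w) (show x < 2 ^ w by omega) hn1
    have d2 := ofNat_mod (w := w) (show x < 2 ^ w by omega) hn1
    refine ⟨fun h => ?_, fun h h' => ?_⟩
    · by_cases ht : σ₃.mem 104 (.ofNat w (x / n * (3 * n) + (2 * n + x % n))) = .ofNat w 0
      · simp [Prog.eval, WordOp.eval, Test.holds, r0', r6', r9', r10', r11', h40, d1, d2,
          ← BitVec.ofNat_mul, ← BitVec.ofNat_add, add_assoc, m104, m105, ht]
      · simp [Prog.eval, WordOp.eval, Test.holds, r0', r6', r9', r10', r11', h40, d1, d2,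
          ← BitVec.ofNat_mul, ← BitVec.ofNat_add, add_assoc, m104, m105, ht, h.resolve_left ht]
    · simp [Prog.eval, WordOp.eval, Test.holds, r0', r6', r9', r10', r12', h40, d1, d2,
        ← BitVec.ofNat_mul, ← BitVec.ofNat_add, add_assoc, m104, m105, h, h']
  · simp [Prog.size]; omega
  rintro σ₄ ⟨-, hR₄⟩ i j
  have hi := i.isLt
  have hj := j.isLt
  have H := hR₄ (i * n + j) (by nlinarith)
  have e1 : (i.val * n + j.val) / n = i := by
    rw [mul_comm, Nat.mul_add_div (by omega), Nat.div_eq_of_lt hj, add_zero]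
  have e2 : (i.val * n + j.val) % n = j := by
    rw [mul_comm, Nat.mul_add_mod, Nat.mod_eq_of_lt hj]
  rw [e1, e2] at H
  have u1 : i.val / n = 0 := Nat.div_eq_of_lt hi
  have u2 : (2 * n + j.val) / n = 2 := by
    rw [mul_comm, Nat.mul_add_div (by omega), Nat.div_eq_of_lt hj]
  obtain ⟨⟨y, hy, hb⟩, hle⟩ := bottleneck_layered (τ.intMat 0 (3 * n))
    (fun x y => (hR' x y).2.2) hn ⟨i, by omega⟩ ⟨2 * n + j, by omega⟩ u1 u2
  -- every middle node gives a pair of entries of `A` and `B`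
  have hrev : ∀ k : Fin n, ∀ y : Fin (3 * n), y.val / n = 1 → y.val % n = k →
      Reversed (2 ^ w) (max (σ.intMat 0 n i k) (σ.intMat 2 n k j))
        (min (τ.intMat 0 (3 * n) ⟨i, by omega⟩ y)
          (τ.intMat 0 (3 * n) y ⟨2 * n + j, by omega⟩)) := by
    intro k y hy hk
    have h1 := (hR' ⟨i, by omega⟩ y).1 ⟨u1, hy⟩
    have h2 := (hR' y ⟨2 * n + j, by omega⟩).2.1 ⟨hy, u2⟩
    have e3 : (⟨i.val % n, Nat.mod_lt _ hn⟩ : Fin n) = i := Fin.ext (Nat.mod_eq_of_lt hi)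
    have e4 : (⟨(2 * n + j.val) % n, Nat.mod_lt _ hn⟩ : Fin n) = j :=
      Fin.ext (by simp [Nat.add_mod, Nat.mod_eq_of_lt hj])
    have e5 : (⟨y.val % n, Nat.mod_lt _ hn⟩ : Fin n) = k := Fin.ext hk
    simp only [e3, e4, e5] at h1 h2
    exact h1.max h2
  have hrev' := hrev ⟨y % n, Nat.mod_lt _ hn⟩ y hy rfl
  rw [← hb, ← hpost] at hrev'
  have hout : σ₄.intMat 4 n i j = max (σ.intMat 0 n i ⟨y % n, Nat.mod_lt _ hn⟩)
      (σ.intMat 2 n ⟨y % n, Nat.mod_lt _ hn⟩ j) := reversed_decode hw2 H.1 H.2 hrev'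
  rw [minMax_eq_iff hn]
  refine ⟨⟨_, hout⟩, fun k => ?_⟩
  have hy' : n + k.val < 3 * n := by have := k.isLt; omega
  have hr := hrev k ⟨n + k, hy'⟩
    (by simp only; rw [Nat.add_div_left _ hn, Nat.div_eq_of_lt k.isLt])
    (by simp [Nat.mod_eq_of_lt k.isLt])
  rw [hout, hrev'.le_iff hr, hpost]
  exact hle _

end WordRAM

theorem one_le_log_add_two {n : ℕ} (hn : 1 ≤ n) : 1 ≤ Real.log (n + 2) := by
  rw [Real.le_log_iff_exp_le (by positivity)]
  have h : (1 : ℝ) ≤ n := by exact_mod_cast hn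
  linarith [Real.exp_one_lt_d9]

theorem sq_le_rpow {n : ℕ} (hn : 1 ≤ n) {c : ℝ} (hc : 2 ≤ c) : ((n ^ 2 : ℕ) : ℝ) ≤ (n : ℝ) ^ c := by
  have h : (1 : ℝ) ≤ n := by exact_mod_cast hn
  calc ((n ^ 2 : ℕ) : ℝ) = (n : ℝ) ^ (2 : ℝ) := by rw [Real.rpow_two]; push_cast; rfl
    _ ≤ (n : ℝ) ^ c := Real.rpow_le_rpow_of_exponent_le h hc

theorem exact_time_le {n t C a : ℕ} {K c : ℝ} (hn : 1 ≤ n)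
    (ht : (t : ℝ) ≤ K * (n : ℝ) ^ c * Real.log (n + 2) ^ a) (hK : K ≤ C) (ha : a ≤ C) :
    (t : ℝ) ≤ C * (n : ℝ) ^ c * Real.log (n + 2) ^ C := by
  have h1 := one_le_log_add_two hn
  have h2 : Real.log (n + 2) ^ a ≤ Real.log (n + 2) ^ C := pow_le_pow_right₀ h1 ha
  have h3 : (0 : ℝ) ≤ (n : ℝ) ^ c := by positivity
  refine ht.trans ?_
  gcongr

/-- The constant absorbs the cost of the reduction and the requirements of the called program for `3 n`
nodes, using `3 n + 1 ≤ (n + 1) ^ 2` and `log (3 n + 2) ≤ 2 log (n + 2)`. -/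
theorem minMaxSolvable_of_bottleneckSolvable {c : ℝ} (hc : 2 ≤ c) (h : BottleneckSolvable c) :
    MinMaxSolvable c := by
  obtain ⟨P, C, hP⟩ := h
  obtain ⟨K, hK⟩ := minMaxByBottleneck_runs P
  refine ⟨minMaxByBottleneck P, 6 + 2 * C + K + ⌈C * (3 : ℝ) ^ c * 2 ^ C⌉₊, ?_⟩
  intro n w hn hw σ h0 hin
  have hpow : ∀ a ≤ 6 + 2 * C + K + ⌈C * (3 : ℝ) ^ c * 2 ^ C⌉₊, (n + 1) ^ a ≤ 2 ^ w := fun a ha =>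
    (Nat.pow_le_pow_right (by omega) ha).trans hw
  have hw3 : (3 * n + 1) ^ C ≤ 2 ^ w :=
    calc (3 * n + 1) ^ C ≤ ((n + 1) ^ 2) ^ C := Nat.pow_le_pow_left (by nlinarith) C
      _ = (n + 1) ^ (2 * C) := (pow_mul _ _ _).symm
      _ ≤ 2 ^ w := hpow _ (by omega)
  have hlog := one_le_log_add_two hn
  have hlog3 : 0 ≤ Real.log ((3 * n : ℕ) + 2) := by
    linarith [one_le_log_add_two (n := 3 * n) (by omega)]
  obtain ⟨t, σ₁, he, ht, hpost⟩ := hK (T := ⌊C * ((3 * n : ℕ) : ℝ) ^ c *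
    Real.log ((3 * n : ℕ) + 2) ^ C⌋₊) σ hn (hpow 6 (by omega)) h0 hin.1 hin.2 (fun τ hτ hcap => by
      obtain ⟨t, τ', he, ht, hpost⟩ := hP (3 * n) w (by omega) hw3 τ hτ hcap
      exact ⟨t, τ', he, Nat.le_floor ht, hpost⟩)
  refine ⟨t, σ₁, he, exact_time_le (K := K + C * (3 : ℝ) ^ c * 2 ^ C) (a := C) hn ?_ ?_ (by omega),
    hpost⟩
  · have hb : 0 ≤ C * ((3 * n : ℕ) : ℝ) ^ c * Real.log ((3 * n : ℕ) + 2) ^ C := by positivity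
    have hl : Real.log ((3 * n : ℕ) + 2) ≤ 2 * Real.log (n + 2) := by
      rw [← Real.log_rpow (by positivity)]
      refine Real.log_le_log (by positivity) ?_
      rw [Real.rpow_two]; push_cast
      nlinarith [Nat.cast_nonneg (α := ℝ) n]
    have hsq := sq_le_rpow hn hc
    calc (t : ℝ) ≤ (K * n ^ 2 + ⌊C * ((3 * n : ℕ) : ℝ) ^ c * Real.log ((3 * n : ℕ) + 2) ^ C⌋₊ : ℕ) :=
        by exact_mod_cast ht
      _ ≤ K * ((n ^ 2 : ℕ) : ℝ) + C * ((3 * n : ℕ) : ℝ) ^ c * Real.log ((3 * n : ℕ) + 2) ^ C := by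
        push_cast
        have := Nat.floor_le hb
        push_cast at this
        gcongr
      _ ≤ K * (n : ℝ) ^ c * Real.log (n + 2) ^ C +
          C * (3 ^ c * (n : ℝ) ^ c) * (2 * Real.log (n + 2)) ^ C := by
        have h3 : ((3 * n : ℕ) : ℝ) ^ c = 3 ^ c * (n : ℝ) ^ c := by
          push_cast; exact Real.mul_rpow (by norm_num) (by positivity)
        rw [h3]
        refine add_le_add ?_ (by gcongr)
        exact (mul_le_mul_of_nonneg_left hsq (by positivity)).trans
          (le_mul_of_one_le_right (by positivity) (one_le_pow₀ hlog))
      _ = (K + C * 3 ^ c * 2 ^ C) * (n : ℝ) ^ c * Real.log (n + 2) ^ C := by ring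
  · push_cast
    have := Nat.le_ceil (C * (3 : ℝ) ^ c * 2 ^ C)
    have h1 : (0 : ℝ) ≤ C := Nat.cast_nonneg C
    linarith

/-! ### Walks and simple paths -/

section Paths

variable {n : ℕ}

theorem pathWeight_append (W : Fin n → Fin n → ℝ≥0∞) (u x : Fin n) (l l' : List (Fin n)) :
    pathWeight W u (l ++ x :: l') = pathWeight W u (l ++ [x]) + pathWeight W x l' := by
  induction l generalizing u with
  | nil => simp [pathWeight]
  | cons y l ih => simp [pathWeight, ih y, add_assoc]

theorem pathCapacity_append (W : Fin n → Fin n → ℕ∞) (u x : Fin n) (l l' : List (Fin n)) :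
    pathCapacity W u (l ++ x :: l') = min (pathCapacity W u (l ++ [x])) (pathCapacity W x l') := by
  induction l generalizing u with
  | nil => simp [pathCapacity]
  | cons y l ih => simp [pathCapacity, ih y, min_assoc]

/-- Every walk contains a simple path with the same ends; weight does not increase and capacity does
not decrease, for all weights `W` and capacities `U`. -/
theorem exists_simple_path (u : Fin n) (l : List (Fin n)) : ∃ l' : List (Fin n), l'.length < n ∧
    (u :: l').getLast (List.cons_ne_nil u l') = (u :: l).getLast (List.cons_ne_nil u l) ∧
    (∀ W, pathWeight W u l' ≤ pathWeight W u l) ∧ ∀ U, pathCapacity U u l ≤ pathCapacity U u l' := by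
  suffices H : ∃ l' : List (Fin n), (u :: l').Nodup ∧
      (u :: l').getLast (List.cons_ne_nil u l') = (u :: l).getLast (List.cons_ne_nil u l) ∧
      (∀ W, pathWeight W u l' ≤ pathWeight W u l) ∧
      ∀ U, pathCapacity U u l ≤ pathCapacity U u l' by
    obtain ⟨l', h1, h2⟩ := H
    refine ⟨l', ?_, h2⟩
    have := h1.length_le_card
    simpa [Nat.succ_le_iff] using this
  induction l generalizing u with
  | nil => exact ⟨[], by simp, rfl, fun _ => le_rfl, fun _ => le_rfl⟩
  | cons x l ih =>
    obtain ⟨l', hnd, hlast, hw, hc⟩ := ih x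
    by_cases hu : u ∈ x :: l'
    · obtain ⟨a, b, hab⟩ := List.append_of_mem hu
      refine ⟨b, ?_, ?_, fun W => ?_, fun U => ?_⟩
      · rw [hab] at hnd; exact (List.nodup_append.1 hnd).2.1
      · have h1 : (x :: l').getLast (List.cons_ne_nil _ _) = (u :: b).getLast (List.cons_ne_nil _ _) := by
          simp only [hab]
          exact List.getLast_append_of_ne_nil _ (List.cons_ne_nil _ _)
        rw [← h1, hlast, List.getLast_cons (List.cons_ne_nil x l)]
      · rcases a with _ | ⟨y, a⟩
        · simp only [List.nil_append, List.cons.injEq] at hab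
          obtain ⟨rfl, rfl⟩ := hab
          exact (hw W).trans le_add_self
        · simp only [List.cons_append, List.cons.injEq] at hab
          obtain ⟨rfl, rfl⟩ := hab
          refine le_trans ?_ ((hw W).trans le_add_self)
          rw [pathWeight_append]
          exact le_add_self
      · rcases a with _ | ⟨y, a⟩
        · simp only [List.nil_append, List.cons.injEq] at hab
          obtain ⟨rfl, rfl⟩ := hab
          exact (min_le_right _ _).trans (hc U)
        · simp only [List.cons_append, List.cons.injEq] at hab
          obtain ⟨rfl, rfl⟩ := hab
          refine le_trans ((min_le_right _ _).trans (hc U)) ?_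
          rw [pathCapacity_append]
          exact min_le_right _ _
    · refine ⟨x :: l', List.nodup_cons.2 ⟨hu, hnd⟩, ?_, fun W => ?_, fun U => ?_⟩
      · rw [List.getLast_cons (List.cons_ne_nil x l'), hlast, List.getLast_cons (List.cons_ne_nil x l)]
      · exact add_le_add_right (hw W) _
      · exact min_le_min_left _ (hc U)

theorem graphDist_le (W : Fin n → Fin n → ℝ≥0∞) {u v : Fin n} {l : List (Fin n)}
    (h : (u :: l).getLast (List.cons_ne_nil u l) = v) : graphDist W u v ≤ pathWeight W u l :=
  iInf₂_le (f := fun l (_ : l ∈ {l : List (Fin n) |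
    (u :: l).getLast (List.cons_ne_nil u l) = v}) => pathWeight W u l) l h

theorem le_bottleneck (U : Fin n → Fin n → ℕ∞) {u v : Fin n} {l : List (Fin n)}
    (h : (u :: l).getLast (List.cons_ne_nil u l) = v) : pathCapacity U u l ≤ bottleneck U u v :=
  le_iSup₂ (f := fun l (_ : l ∈ {l : List (Fin n) |
    (u :: l).getLast (List.cons_ne_nil u l) = v}) => pathCapacity U u l) l h

/-- A walk shorter than `b` uses only edges lighter than `b`. -/
theorem le_bottleneck_of_graphDist_lt {W : Fin n → Fin n → ℝ≥0∞} {U : Fin n → Fin n → ℕ∞}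
    {t : ℕ∞} {b : ℝ≥0∞} (h : ∀ x y, W x y < b → t ≤ U x y) {u v : Fin n}
    (hd : graphDist W u v < b) : t ≤ bottleneck U u v := by
  simp only [graphDist, iInf_lt_iff] at hd
  obtain ⟨l, hl, hd⟩ := hd
  refine le_trans ?_ (le_bottleneck U hl)
  clear hl
  induction l generalizing u with
  | nil => exact le_top
  | cons x l ih =>
    exact le_min (h u x (lt_of_le_of_lt le_self_add hd)) (ih (lt_of_le_of_lt le_add_self hd))

/-- The heaviest edge `(x, y)` of a walk. -/
theorem exists_heaviest_edge (W : Fin n → Fin n → ℝ≥0∞) (U : Fin n → Fin n → ℕ∞) (u : Fin n)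
    (l : List (Fin n)) (hl : l ≠ []) : ∃ x y, pathCapacity U u l ≤ U x y ∧
      W x y ≤ pathWeight W u l ∧ pathWeight W u l ≤ l.length * W x y := by
  induction l generalizing u with
  | nil => exact absurd rfl hl
  | cons z l ih =>
    rcases eq_or_ne l [] with rfl | hl'
    · exact ⟨u, z, min_le_left _ _, le_self_add, by simp [pathWeight]⟩
    · obtain ⟨x, y, h1, h2, h3⟩ := ih z hl'
      rcases le_total (W u z) (W x y) with h | h
      · refine ⟨x, y, (min_le_right _ _).trans h1, h2.trans le_add_self, ?_⟩
        calc W u z + pathWeight W z l ≤ W x y + l.length * W x y := add_le_add h h3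
          _ = ((z :: l).length : ℝ≥0∞) * W x y := by simp; ring
      · refine ⟨u, z, min_le_left _ _, le_self_add, ?_⟩
        calc W u z + pathWeight W z l ≤ W u z + l.length * W u z := by gcongr; exact h3.trans (by gcongr)
          _ = ((z :: l).length : ℝ≥0∞) * W u z := by simp; ring

theorem graphDist_self (W : Fin n → Fin n → ℝ≥0∞) (u : Fin n) : graphDist W u u = 0 :=
  nonpos_iff_eq_zero.1 (graphDist_le W (l := []) rfl)

theorem graphDist_le_edge (W : Fin n → Fin n → ℝ≥0∞) (u v : Fin n) : graphDist W u v ≤ W u v :=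
  (graphDist_le W (l := [v]) rfl).trans (by simp [pathWeight])

theorem one_le_graphDist {W : Fin n → Fin n → ℝ≥0∞} (hW : ∀ x y, 1 ≤ W x y) {u v : Fin n}
    (h : u ≠ v) : 1 ≤ graphDist W u v := by
  refine le_iInf₂ fun l hl => ?_
  match l, hl with
  | [], hl => exact absurd hl h
  | x :: l, _ => exact (hW u x).trans le_self_add

theorem graphDist_triangle (W : Fin n → Fin n → ℝ≥0∞) (u x v : Fin n) :
    graphDist W u v ≤ graphDist W u x + graphDist W x v := by
  refine ENNReal.le_of_forall_pos_le_add fun ε hε hfin => ?_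
  have hlt : ∀ a b : Fin n, graphDist W a b ≠ ⊤ → ∃ l : List (Fin n),
      (a :: l).getLast (List.cons_ne_nil a l) = b ∧ pathWeight W a l < graphDist W a b + ε / 2 := by
    intro a b hab
    have : graphDist W a b < graphDist W a b + ε / 2 :=
      ENNReal.lt_add_right hab (by simp [hε.ne'])
    conv_lhs at this => rw [graphDist]
    simp only [iInf_lt_iff] at this
    obtain ⟨l, hl, h⟩ := this
    exact ⟨l, hl, h⟩
  obtain ⟨l, hl, h⟩ := hlt u x (ne_top_of_le_ne_top hfin.ne le_self_add)
  obtain ⟨l', hl', h'⟩ := hlt x v (ne_top_of_le_ne_top hfin.ne le_add_self)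
  have hlast : (u :: (l ++ l')).getLast (List.cons_ne_nil _ _) = v := by
    rcases l' with _ | ⟨y, l'⟩
    · simpa [hl] using hl'
    · rw [List.getLast_cons (List.cons_ne_nil y l')] at hl'
      rw [List.getLast_cons (by simp), List.getLast_append_of_ne_nil _ (List.cons_ne_nil y l')]
      exact hl'
  have hw : pathWeight W u (l ++ l') = pathWeight W u l + pathWeight W x l' := by
    rcases List.eq_nil_or_concat l with rfl | ⟨a, y, rfl⟩
    · obtain rfl : u = x := hl
      simp [pathWeight]
    · obtain rfl : y = x := by simpa using hl
      rw [List.concat_eq_append, List.append_assoc, List.singleton_append, pathWeight_append]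
  calc graphDist W u v ≤ pathWeight W u (l ++ l') := graphDist_le W hlast
    _ ≤ (graphDist W u x + ε / 2) + (graphDist W x v + ε / 2) := by
      rw [hw]; exact add_le_add h.le h'.le
    _ = graphDist W u x + graphDist W x v + ε := by
      rw [add_add_add_comm, ENNReal.add_halves]

/-- `D` is an approximation, by the factor `r`, of the minimal weights of walks with between `1` and
`m` edges. The lower bound is by the distance, that is, by all walks. -/
def ApproxWalks (W D : Fin n → Fin n → ℝ≥0∞) (r : ℝ≥0∞) (m : ℕ) : Prop :=
  (∀ u v, graphDist W u v ≤ D u v) ∧ ∀ u v (l : List (Fin n)), l ≠ [] → l.length ≤ m →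
    (u :: l).getLast (List.cons_ne_nil u l) = v → D u v ≤ r * pathWeight W u l

theorem approxWalks_one (W : Fin n → Fin n → ℝ≥0∞) : ApproxWalks W W 1 1 := by
  refine ⟨graphDist_le_edge W, fun u v l h1 h2 h3 => ?_⟩
  match l, h1, h2, h3 with
  | [x], _, _, h3 =>
    obtain rfl : x = v := h3
    simp [pathWeight]

/-- A step of repeated squaring: approximate min-plus squaring doubles the number of edges. -/
theorem ApproxWalks.square {W D C D' : Fin n → Fin n → ℝ≥0∞} {r e : ℝ≥0∞} {m : ℕ} (hm : 1 ≤ m)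
    (h : ApproxWalks W D r m) (hC : ∀ u v, minPlus D D u v ≤ C u v)
    (hC' : ∀ u v, C u v ≤ (1 + e) * minPlus D D u v) (hD' : ∀ u v, D' u v = min (D u v) (C u v)) :
    ApproxWalks W D' ((1 + e) * r) (2 * m) := by
  refine ⟨fun u v => ?_, fun u v l h1 h2 h3 => ?_⟩
  · rw [hD']
    refine le_min (h.1 u v) (le_trans (le_iInf fun x => ?_) (hC u v))
    exact (graphDist_triangle W u x v).trans (add_le_add (h.1 u x) (h.1 x v))
  · rw [hD']
    by_cases hl : l.length ≤ m
    · refine (min_le_left _ _).trans ((h.2 u v l h1 hl h3).trans ?_)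
      rw [mul_assoc]
      exact le_mul_of_one_le_left' le_self_add
    · have hlen : (l.take m).length = m := by rw [List.length_take]; omega
      have hne : l.take m ≠ [] := fun h => by rw [h] at hlen; simp at hlen; omega
      have hdrop : l.drop m ≠ [] := fun h => by rw [List.drop_eq_nil_iff] at h; omega
      set x := (l.take m).getLast hne with hx
      have hsplit : l = (l.take m).dropLast ++ x :: l.drop m := by
        conv_lhs => rw [← List.take_append_drop m l, ← List.dropLast_append_getLast hne]
        simp [hx]
      have e1 : (l.take m).dropLast ++ [x] = l.take m := List.dropLast_append_getLast hne
      have hw : pathWeight W u l = pathWeight W u (l.take m) + pathWeight W x (l.drop m) := by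
        conv_lhs => rw [hsplit]
        rw [pathWeight_append, e1]
      have b1 := h.2 u x (l.take m) hne hlen.le (by rw [List.getLast_cons hne])
      have b2 := h.2 x v (l.drop m) hdrop (by rw [List.length_drop]; omega) (by
        rw [List.getLast_cons hdrop, List.getLast_drop, ← h3, List.getLast_cons h1])
      refine (min_le_right _ _).trans ((hC' u v).trans ?_)
      rw [mul_assoc, hw, mul_add]
      gcongr
      exact (iInf_le _ x).trans (add_le_add b1 b2)

/-- Simple paths have fewer than `n` edges, so walks with at most `m ≥ n` edges yield all distances.
Off the diagonal only: walks from `u` to `u` with no edges are not covered by `ApproxWalks`. -/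
theorem ApproxWalks.le_graphDist {W D : Fin n → Fin n → ℝ≥0∞} {r : ℝ≥0∞} {m : ℕ}
    (h : ApproxWalks W D r m) (hr : r ≠ ⊤) (hr0 : r ≠ 0) (hm : n ≤ m) {u v : Fin n} (huv : u ≠ v) :
    D u v ≤ r * graphDist W u v := by
  rw [graphDist, ENNReal.mul_iInf_of_ne hr0 hr]
  refine le_iInf fun l => ?_
  rw [ENNReal.mul_iInf_of_ne hr0 hr]
  refine le_iInf fun hl => ?_
  obtain ⟨l', h1, h2, h3, -⟩ := exists_simple_path u l
  have hne : l' ≠ [] := by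
    rintro rfl
    exact huv (h2.trans hl)
  exact (h.2 u v l' hne (by omega) (h2.trans hl)).trans (by gcongr; exact h3 W)

end Paths

namespace WordRAM

/-! ### Floating-point numbers -/

theorem fval_pos (γ : ℕ) (e : ℤ) (f : ℕ) : 0 < fval γ e f := by
  unfold fval; positivity

theorem zpow_le_fval (γ : ℕ) (e : ℤ) (f : ℕ) : (2 : ℝ) ^ e ≤ fval γ e f := by
  unfold fval
  exact le_mul_of_one_le_right (by positivity) (by simp; positivity)

theorem fval_lt_zpow {γ : ℕ} (e : ℤ) {f : ℕ} (hf : f < 2 ^ γ) : fval γ e f < (2 : ℝ) ^ (e + 1) := by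
  unfold fval
  rw [zpow_add_one₀ (by norm_num)]
  have : (f : ℝ) / 2 ^ γ < 1 := by
    rw [div_lt_one (by positivity)]; exact_mod_cast hf
  gcongr
  linarith

theorem one_le_fval {γ : ℕ} {e : ℤ} {f : ℕ} (he : 0 ≤ e) : 1 ≤ fval γ e f :=
  (one_le_zpow₀ (by norm_num) he).trans (zpow_le_fval γ e f)

theorem exp_nonneg_of_one_le_fval {γ : ℕ} {e : ℤ} {f : ℕ} (hf : f < 2 ^ γ) (h : 1 ≤ fval γ e f) :
    0 ≤ e := by
  by_contra hc
  have h1 := fval_lt_zpow e hf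
  have h2 : (2 : ℝ) ^ (e + 1) ≤ 1 := zpow_le_one_of_nonpos₀ (by norm_num) (by omega)
  linarith

theorem exp_lt_of_fval_lt {γ : ℕ} {e : ℤ} {f : ℕ} {k : ℤ} (h : fval γ e f < (2 : ℝ) ^ k) : e < k :=
  (zpow_lt_zpow_iff_right₀ (by norm_num : (1 : ℝ) < 2)).1 ((zpow_le_fval γ e f).trans_lt h)

/-- Floating-point numbers are ordered lexicographically by exponent and mantissa. -/
theorem fval_le_fval_iff {γ : ℕ} {e e' : ℤ} {f f' : ℕ} (hf : f < 2 ^ γ) (hf' : f' < 2 ^ γ) :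
    fval γ e f ≤ fval γ e' f' ↔ e * 2 ^ γ + f ≤ e' * 2 ^ γ + f' := by
  have key : ∀ {e e' : ℤ} {f f' : ℕ}, f < 2 ^ γ → f' < 2 ^ γ → e * 2 ^ γ + f ≤ e' * 2 ^ γ + f' →
      fval γ e f ≤ fval γ e' f' := by
    intro e e' f f' hf hf' h
    have hf2 : (f : ℤ) < 2 ^ γ := by exact_mod_cast hf
    have hf2' : (f' : ℤ) < 2 ^ γ := by exact_mod_cast hf'
    have hpos : (0 : ℤ) < 2 ^ γ := by positivity
    rcases lt_trichotomy e e' with hlt | rfl | hgt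
    · refine (fval_lt_zpow e hf).le.trans (le_trans ?_ (zpow_le_fval γ e' f'))
      exact zpow_le_zpow_right₀ (by norm_num) (by omega)
    · have : f ≤ f' := by omega
      unfold fval
      gcongr
    · exfalso; nlinarith
  refine ⟨fun h => ?_, key hf hf'⟩
  by_contra hc
  have hc := not_le.1 hc
  have h1 := key hf' hf hc.le
  have heq := le_antisymm h h1
  have he : e = e' := by
    have a1 := exp_lt_of_fval_lt (heq ▸ fval_lt_zpow e' hf')
    have a2 := exp_lt_of_fval_lt (heq ▸ fval_lt_zpow e hf : fval γ e' f' < _)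
    omega
  subst he
  unfold fval at heq
  have h2 : (2 : ℝ) ^ e ≠ 0 := by positivity
  have h3 := mul_left_cancel₀ h2 heq
  have h4 : (f : ℝ) = f' := by
    field_simp at h3
    linarith
  have : f = f' := by exact_mod_cast h4
  omega

/-- Rounding of a positive real to a floating-point number with `γ`-bit mantissa. -/
noncomputable def fl (γ : ℕ) (z : ℝ) : ℝ := fval γ (fexp z) (fman γ z).toNat

theorem zpow_fexp_le {z : ℝ} (hz : 0 < z) : (2 : ℝ) ^ fexp z ≤ z := by
  simpa [fexp, hz] using Int.zpow_log_le_self (b := 2) (by norm_num) hz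

theorem lt_zpow_fexp {z : ℝ} (hz : 0 < z) : z < (2 : ℝ) ^ (fexp z + 1) := by
  simpa [fexp, hz] using Int.lt_zpow_succ_log_self (b := 2) (by norm_num) z

theorem fexp_nonneg {z : ℝ} (hz : 1 ≤ z) : 0 ≤ fexp z := by
  have h := lt_zpow_fexp (by linarith : 0 < z)
  by_contra hc
  have h2 : (2 : ℝ) ^ (fexp z + 1) ≤ 1 := zpow_le_one_of_nonpos₀ (by norm_num) (by omega)
  linarith

theorem fexp_lt {z : ℝ} (hz : 0 < z) {k : ℤ} (h : z < (2 : ℝ) ^ k) : fexp z < k :=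
  (zpow_lt_zpow_iff_right₀ (by norm_num : (1 : ℝ) < 2)).1 ((zpow_fexp_le hz).trans_lt h)

theorem fman_nonneg {γ : ℕ} {z : ℝ} (hz : 0 < z) : 0 ≤ fman γ z := by
  simp only [fman, hz, if_true]
  apply Int.floor_nonneg.2
  have : 1 ≤ z / 2 ^ fexp z := by rw [one_le_div (by positivity)]; exact zpow_fexp_le hz
  have h2 : (0 : ℝ) ≤ 2 ^ γ := by positivity
  nlinarith

theorem fman_lt {γ : ℕ} {z : ℝ} (hz : 0 < z) : fman γ z < 2 ^ γ := by
  simp only [fman, hz, if_true]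
  rw [Int.floor_lt]
  have : z / 2 ^ fexp z < 2 := by
    rw [div_lt_iff₀ (by positivity)]
    have := lt_zpow_fexp hz
    rwa [zpow_add_one₀ (by norm_num), mul_comm] at this
  have h2 : (0 : ℝ) < 2 ^ γ := by positivity
  push_cast
  nlinarith

theorem toNat_fman_lt {γ : ℕ} {z : ℝ} (hz : 0 < z) : (fman γ z).toNat < 2 ^ γ := by
  have h1 := fman_lt (γ := γ) hz
  have h2 := fman_nonneg (γ := γ) hz
  zify
  rwa [Int.toNat_of_nonneg h2]

theorem fl_eq {γ : ℕ} {z : ℝ} (hz : 0 < z) :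
    fl γ z = (2 : ℝ) ^ fexp z * (1 + (⌊(z / (2 : ℝ) ^ fexp z - 1) * 2 ^ γ⌋ : ℝ) / 2 ^ γ) := by
  have h2 := fman_nonneg (γ := γ) hz
  have h3 : ((fman γ z).toNat : ℝ) = ((fman γ z : ℤ) : ℝ) := by
    exact_mod_cast Int.toNat_of_nonneg h2
  unfold fl fval
  rw [h3]
  simp only [fman, hz, if_true]

theorem fl_le {γ : ℕ} {z : ℝ} (hz : 0 < z) : fl γ z ≤ z := by
  rw [fl_eq hz]
  have h := Int.floor_le ((z / (2 : ℝ) ^ fexp z - 1) * 2 ^ γ)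
  calc _ ≤ (2 : ℝ) ^ fexp z * (1 + ((z / (2 : ℝ) ^ fexp z - 1) * 2 ^ γ) / 2 ^ γ) := by gcongr
    _ = z := by field_simp; ring

theorem le_fl {γ : ℕ} {z : ℝ} (hz : 0 < z) : (1 - 1 / 2 ^ γ) * z ≤ fl γ z := by
  rw [fl_eq hz]
  have h := (Int.sub_one_lt_floor ((z / (2 : ℝ) ^ fexp z - 1) * 2 ^ γ)).le
  have h1 := zpow_fexp_le hz
  calc (1 - 1 / 2 ^ γ) * z = z - z / 2 ^ γ := by ring
    _ ≤ z - 2 ^ fexp z / 2 ^ γ := by gcongr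
    _ = (2 : ℝ) ^ fexp z * (1 + ((z / (2 : ℝ) ^ fexp z - 1) * 2 ^ γ - 1) / 2 ^ γ) := by
      field_simp; ring
    _ ≤ _ := by gcongr

theorem one_le_fl {γ : ℕ} {z : ℝ} (hz : 1 ≤ z) : 1 ≤ fl γ z := one_le_fval (fexp_nonneg hz)

theorem fl_natCast {γ k : ℕ} (hk : 1 ≤ k) (hk' : k < 2 ^ γ) : fl γ k = k := by
  have hz : (0 : ℝ) < k := by exact_mod_cast hk
  have h1 : 0 ≤ fexp (k : ℝ) := fexp_nonneg (by exact_mod_cast hk)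
  have h2 : fexp (k : ℝ) < γ := fexp_lt hz (by rw [zpow_natCast]; exact_mod_cast hk')
  rw [fl_eq hz]
  obtain ⟨e, he⟩ := Int.eq_ofNat_of_zero_le h1
  rw [he] at h2 ⊢
  have h3 : γ = (γ - e) + e := by omega
  have h4 : ((k : ℝ) / 2 ^ ((e : ℕ) : ℤ) - 1) * 2 ^ γ = ((k * 2 ^ (γ - e) - 2 ^ γ : ℤ) : ℝ) := by
    push_cast
    rw [zpow_natCast, sub_mul, one_mul]
    congr 1
    conv_lhs => rw [h3, pow_add]
    field_simp
  rw [h4, Int.floor_intCast]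
  push_cast
  rw [zpow_natCast]
  have : (2 : ℝ) ^ γ = 2 ^ (γ - e) * 2 ^ e := by rw [← pow_add, ← h3]
  field_simp
  rw [this]; ring

theorem toInt_ofInt {w : ℕ} {e : ℤ} {B : ℕ} (hB : B + 1 < w) (h1 : -2 ^ B ≤ e) (h2 : e < 2 ^ B) :
    (BitVec.ofInt w e).toInt = e := by
  have : (2 : ℤ) ^ B * 2 ≤ 2 ^ (w - 1) := by
    rw [← pow_succ]; exact pow_le_pow_right₀ (by norm_num) (by omega)
  have h3 : (0 : ℤ) < 2 ^ B := by positivity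
  apply BitVec.toInt_ofInt_eq_self (by omega) <;> omega

theorem toNat_ofInt {w : ℕ} {e : ℤ} (h1 : 0 ≤ e) (h2 : e < 2 ^ w) :
    (BitVec.ofInt w e).toNat = e.toNat := by
  rw [BitVec.toNat_ofInt]
  congr 1
  exact Int.emod_eq_of_lt h1 (by exact_mod_cast h2)

/-- The value and the ranges of the result of a floating-point operation in machine words. -/
theorem float_result {w γ B : ℕ} {z : ℝ} (hB : B + 1 < w) (hγ : γ ≤ w) (hz : 1 ≤ z)
    (hzB : z < (2 : ℝ) ^ (2 ^ B : ℤ)) :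
    (BitVec.ofInt w (fexp z)).toInt = fexp z ∧ (BitVec.ofInt w (fman γ z)).toNat < 2 ^ γ ∧
    fval γ (BitVec.ofInt w (fexp z)).toInt (BitVec.ofInt w (fman γ z)).toNat = fl γ z := by
  have hz0 : 0 < z := by linarith
  have h1 := fexp_lt hz0 hzB
  have h2 := fexp_nonneg hz
  have h3 : (BitVec.ofInt w (fexp z)).toInt = fexp z :=
    toInt_ofInt hB (le_trans (by simp) h2) h1
  have h4 : (BitVec.ofInt w (fman γ z)).toNat = (fman γ z).toNat :=
    toNat_ofInt (fman_nonneg hz0)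
      ((fman_lt hz0).trans_le (pow_le_pow_right₀ (by norm_num) hγ))
  refine ⟨h3, h4 ▸ toNat_fman_lt hz0, ?_⟩
  rw [h3, h4]; rfl

/-- The number held by a tag, an exponent and a mantissa. -/
noncomputable def floatCell {w : ℕ} (γ : ℕ) (t e f : BitVec w) : ℝ≥0∞ :=
  if t.toNat = 0 then 0 else if t.toNat = 1 then ENNReal.ofReal (fval γ e.toInt f.toNat) else ⊤

theorem State.floatMat_eq {w : ℕ} (σ : State w) (γ s n : ℕ) (i j : Fin n) :
    σ.floatMat γ s n i j =
      floatCell γ (σ.cell s n i j) (σ.cell (s + 1) n i j) (σ.cell (s + 2) n i j) := rfl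

end WordRAM

namespace WordRAM

/-! ### Repeated squaring -/

theorem index_lt {n : ℕ} (i j : Fin n) : i.val * n + j.val < n * n := by
  have := i.isLt; have := j.isLt; nlinarith

theorem index_div {n : ℕ} (i j : Fin n) : (i.val * n + j.val) / n = i := by
  rw [mul_comm, Nat.mul_add_div (by have := i.isLt; omega), Nat.div_eq_of_lt j.isLt, add_zero]

theorem index_mod {n : ℕ} (i j : Fin n) : (i.val * n + j.val) % n = j := by
  rw [mul_comm, Nat.mul_add_mod, Nat.mod_eq_of_lt j.isLt]

/-- Computation of the least `l` with `N ≤ 2 ^ l`, by doubling. -/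
theorem Runs.clog {w a pw l one N : ℕ} {σ : State w} (h1 : pw ≠ a) (h2 : l ≠ a) (h3 : pw ≠ l)
    (h4 : one ≠ pw) (h5 : one ≠ l) (hN : 2 * N < 2 ^ w) (ha : σ.reg a = BitVec.ofNat w N)
    (hone : σ.reg one = BitVec.ofNat w 1)
    (hpw : σ.reg pw = BitVec.ofNat w 1) (hl : σ.reg l = BitVec.ofNat w 0) :
    Runs (.loop (.lt pw a) (.op .add pw pw pw ;; .op .add l l one)) (Nat.clog 2 N * 3 + 1) σ
      (fun σ' => σ'.reg pw = BitVec.ofNat w (2 ^ Nat.clog 2 N) ∧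
        σ'.reg l = BitVec.ofNat w (Nat.clog 2 N) ∧
        (∀ r, r ≠ pw → r ≠ l → σ'.reg r = σ.reg r) ∧ σ'.mem = σ.mem) := by
  have hpow : ∀ k ≤ Nat.clog 2 N, 1 < 2 ^ w → 2 ^ k < 2 ^ w := by
    intro k hk hw
    rcases Nat.eq_zero_or_pos k with rfl | hk0
    · simpa using hw
    · have : 2 ^ (k - 1) < N := (Nat.lt_clog_iff_pow_lt (by norm_num)).1 (by omega)
      have h2 : 2 ^ k = 2 * 2 ^ (k - 1) := by rw [← pow_succ']; congr 1; omega
      omega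
  refine Runs.mono (Runs.loop (T := 2) (B := Nat.clog 2 N) (fun k σ' => k ≤ Nat.clog 2 N ∧
    σ'.reg pw = BitVec.ofNat w (2 ^ k) ∧ σ'.reg l = BitVec.ofNat w k ∧
        (∀ r, r ≠ pw → r ≠ l → σ'.reg r = σ.reg r) ∧ σ'.mem = σ.mem) ?_ ?_) le_rfl ?_
  · rintro k σ' ⟨hk, p1, p2, p3, p4⟩ hb
    have hw : 1 < 2 ^ w := by
      by_contra hw
      have : N = 0 := by omega
      simp [Test.holds, p3 a h1.symm h2.symm, ha, this] at hb
    have hb' : 2 ^ k < N := by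
      simpa only [Test.holds, p3 a h1.symm h2.symm, ha, p1,
        toNat_ofNat_of_lt (hpow k hk hw), toNat_ofNat_of_lt (show N < 2 ^ w by omega)] using hb
    have hk' := (Nat.lt_clog_iff_pow_lt (by norm_num)).2 hb'
    refine ⟨hk', Runs.eval (P := .op .add pw pw pw ;; .op .add l l one) ⟨trivial, trivial⟩
      ⟨hk', ?_, ?_, fun r hr hr' => ?_, ?_⟩⟩
    · have : (2 : ℕ) ^ (k + 1) = 2 ^ k + 2 ^ k := by ring
      rw [this, BitVec.ofNat_add, ← p1]
      simp [Prog.eval, WordOp.eval, h3]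
    · simp [Prog.eval, WordOp.eval, h3.symm, h4, p2, p3 one h4 h5, hone, ← BitVec.ofNat_add]
    · simp [Prog.eval, hr, hr', p3 r hr hr']
    · simp [Prog.eval, p4]
  · exact ⟨Nat.zero_le _, by simpa using hpw, hl, fun _ _ _ => rfl, rfl⟩
  · rintro σ' ⟨k, -, ⟨hk, p1, p2, p3, p4⟩, hb⟩
    have : k = Nat.clog 2 N := by
      by_contra hne
      have hlt : k < Nat.clog 2 N := by omega
      have hlt' : 2 ^ k < N := (Nat.lt_clog_iff_pow_lt (by norm_num)).1 hlt
      have : 1 ≤ 2 ^ k := Nat.one_le_two_pow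
      refine hb ?_
      simpa only [Test.holds, p3 a h1.symm h2.symm, ha, p1,
        toNat_ofNat_of_lt (hpow k hk (by omega)),
        toNat_ofNat_of_lt (show N < 2 ^ w by omega)] using hlt'
    subst this
    exact ⟨p1, p2, p3, p4⟩

/-- The cell holds `∞` or a floating-point number at least `1` with a `γ`-bit mantissa and exponent
less than `B`. -/
def GoodCell {w : ℕ} (γ : ℕ) (B : ℤ) (t e f : BitVec w) : Prop :=
  (t.toNat = 1 ∧ 0 ≤ e.toInt ∧ e.toInt < B ∧ f.toNat < 2 ^ γ) ∨ t.toNat = 2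

theorem GoodCell.mono {w γ : ℕ} {B B' : ℤ} {t e f : BitVec w} (h : GoodCell γ B t e f)
    (hB : B ≤ B') : GoodCell γ B' t e f :=
  h.imp (fun ⟨h1, h2, h3, h4⟩ => ⟨h1, h2, h3.trans_le hB, h4⟩) id

theorem GoodCell.one_le {w γ : ℕ} {B : ℤ} {t e f : BitVec w} (h : GoodCell γ B t e f) :
    1 ≤ floatCell γ t e f := by
  rcases h with ⟨h1, h2, h3, h4⟩ | h
  · simp only [floatCell, h1, one_ne_zero, if_false, if_true]
    rw [ENNReal.one_le_ofReal]
    exact one_le_fval h2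
  · simp [floatCell, h]

theorem GoodCell.lt {w γ : ℕ} {B : ℤ} {t e f : BitVec w} (h : GoodCell γ B t e f)
    (hfin : floatCell γ t e f ≠ ⊤) : floatCell γ t e f < ENNReal.ofReal ((2 : ℝ) ^ B) := by
  rcases h with ⟨h1, h2, h3, h4⟩ | h
  · simp only [floatCell, h1, one_ne_zero, if_false, if_true]
    rw [ENNReal.ofReal_lt_ofReal_iff (by positivity)]
    exact (fval_lt_zpow _ h4).trans_le (zpow_le_zpow_right₀ (by norm_num) (by omega))
  · simp [floatCell, h] at hfin

theorem GoodCell.of_value {w γ : ℕ} {B : ℤ} {t e f : BitVec w}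
    (hf : t.toNat = 1 → f.toNat < 2 ^ γ) (h1 : 1 ≤ floatCell γ t e f)
    (hB : floatCell γ t e f < ENNReal.ofReal ((2 : ℝ) ^ B)) : GoodCell γ B t e f := by
  left
  unfold floatCell at h1 hB
  split_ifs at h1 hB with a b
  · simp at h1
  · rw [ENNReal.one_le_ofReal] at h1
    rw [ENNReal.ofReal_lt_ofReal_iff (by positivity)] at hB
    exact ⟨b, exp_nonneg_of_one_le_fval (hf b) h1, exp_lt_of_fval_lt hB, hf b⟩
  · simp at hB

/-- One round of repeated squaring: the matrix `D` in the segments `10, 11, 12` is replaced by the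
entrywise minimum of `D` and the product of `D` with itself that the program `P` computes. The
minimum makes up for the missing zeros on the diagonal of `D`. -/
def squaringRound (P : Prog) : Prog :=
  forUp 40 7 (.load 42 10 40 ;; .store 100 40 42 ;; .store 103 40 42 ;;
    .load 42 11 40 ;; .store 101 40 42 ;; .store 104 40 42 ;;
    .load 42 12 40 ;; .store 102 40 42 ;; .store 105 40 42) ;;
  (.op .or 100 0 0 ;; .op .or 101 1 1 ;; .op .or 102 5 5 ;; .op .or 103 12 12) ;;
  P.shift 100 ;;
  forUp 40 7 (.load 42 106 40 ;; .load 43 107 40 ;; .load 44 108 40 ;;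
    .load 45 10 40 ;; .load 46 11 40 ;; .load 47 12 40 ;;
    .ite (.eq 42 5)
      (.ite (.eq 45 5) (.ite (.flt 43 44 46 47 1) (.store 11 40 43 ;; .store 12 40 44) .skip)
        (.store 10 40 5 ;; .store 11 40 43 ;; .store 12 40 44)) .skip)

/-- The reduction of directed APSP to Min-Plus Product by the program `P`, by repeated squaring of
the weight matrix with precision `1 / (2 (l + 1) (⌊q / p⌋ + 1))`, where `n ≤ 2 ^ l`. -/
def apspByMinPlus (P : Prog) : Prog :=
  (.const 5 1 ;; .op .div 6 3 2 ;; .op .add 6 6 5 ;; .op .mul 7 0 0 ;; .const 10 1 ;;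
    .const 11 0) ;;
  .loop (.lt 10 0) (.op .add 10 10 10 ;; .op .add 11 11 5) ;;
  (.op .add 12 11 5 ;; .op .mul 12 12 6 ;; .op .add 12 12 12) ;;
  forUp 40 7 (.load 42 0 40 ;; .store 10 40 42 ;; .load 42 1 40 ;; .store 11 40 42 ;;
    .load 42 2 40 ;; .store 12 40 42) ;;
  forUp 20 11 (squaringRound P) ;;
  forUp 40 7 (.op .div 43 40 0 ;; .op .mod 44 40 0 ;;
    .load 42 10 40 ;; .store 6 40 42 ;; .load 42 11 40 ;; .store 7 40 42 ;;
    .load 42 12 40 ;; .store 8 40 42 ;; .const 42 0 ;;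
    .ite (.eq 43 44) (.store 6 40 42) .skip)

theorem one_add_pow_le {x : ℝ} (hx : 0 ≤ x) (k : ℕ) (hk : 2 * k * x ≤ 1) :
    (1 + x) ^ k ≤ 1 + 2 * k * x := by
  induction k with
  | zero => simp
  | succ k ih =>
    push_cast at hk ⊢
    have h1 := ih (by nlinarith)
    have h2 : 0 ≤ (k : ℝ) * x := by positivity
    calc (1 + x) ^ (k + 1) = (1 + x) ^ k * (1 + x) := pow_succ _ _
      _ ≤ (1 + 2 * k * x) * (1 + x) := by gcongr
      _ ≤ 1 + 2 * (k + 1) * x := by nlinarith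

/-- The error of `l` rounds of repeated squaring. -/
theorem squaring_error {p q l : ℕ} (hp : 0 < p) (hpq : 10 * p < q) :
    (1 + ((1 : ℕ) : ℝ≥0∞) / ((2 * ((l + 1) * (q / p + 1)) : ℕ) : ℝ≥0∞)) ^ l ≤
      1 + (p : ℝ≥0∞) / q := by
  have hq : 0 < q := by omega
  have hp' : (0 : ℝ) < p := by exact_mod_cast hp
  have hq' : (0 : ℝ) < q := by exact_mod_cast hq
  have key : (1 + ((1 : ℕ) : ℝ) / ((2 * ((l + 1) * (q / p + 1)) : ℕ) : ℝ)) ^ l ≤ 1 + (p : ℝ) / q := by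
    have hE : (q : ℝ) / p < (q / p + 1 : ℕ) := by
      rw [div_lt_iff₀ hp']
      rw [mul_comm]
      exact_mod_cast Nat.lt_mul_div_succ q hp
    set E : ℝ := ((q / p + 1 : ℕ) : ℝ) with hEdef
    have hEpos : 0 < E := lt_trans (by positivity) hE
    have e1 : ((1 : ℕ) : ℝ) / ((2 * ((l + 1) * (q / p + 1)) : ℕ) : ℝ) = 1 / (2 * (l + 1) * E) := by
      rw [Nat.cast_mul, Nat.cast_mul, ← hEdef]; push_cast; ring
    have h3 : 1 / E ≤ (p : ℝ) / q := by
      rw [div_le_div_iff₀ hEpos hq']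
      rw [div_lt_iff₀ hp'] at hE
      linarith
    have h4 : 2 * l * (1 / (2 * (l + 1) * E)) ≤ 1 / E := by
      have : 2 * (l : ℝ) * (1 / (2 * (l + 1) * E)) = (l / (l + 1)) * (1 / E) := by field_simp
      rw [this]
      exact mul_le_of_le_one_left (by positivity) (by rw [div_le_one (by positivity)]; linarith)
    have h5 : (p : ℝ) / q ≤ 1 := by
      rw [div_le_one hq']
      exact_mod_cast (by omega : p ≤ q)
    rw [e1]
    refine (one_add_pow_le (by positivity) l (h4.trans (h3.trans h5))).trans ?_
    linarith
  have conv : ∀ a b : ℕ, 0 < b → (1 : ℝ≥0∞) + (a : ℝ≥0∞) / b = ENNReal.ofReal (1 + (a : ℝ) / b) := by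
    intro a b hb
    rw [ENNReal.ofReal_add (by norm_num) (by positivity), ENNReal.ofReal_one,
      ENNReal.ofReal_div_of_pos (by exact_mod_cast hb), ENNReal.ofReal_natCast,
      ENNReal.ofReal_natCast]
  rw [conv _ _ (by positivity), conv _ _ hq, ← ENNReal.ofReal_pow (by positivity)]
  exact ENNReal.ofReal_le_ofReal key

end WordRAM

namespace WordRAM

theorem forall_index {n : ℕ} {p : ℕ → Prop} (h : ∀ i j : Fin n, p (i.val * n + j.val)) :
    ∀ x < n * n, p x := by
  intro x hx
  have hn : 0 < n := Nat.pos_of_ne_zero (by rintro rfl; simp at hx)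
  have h1 : x / n < n := Nat.div_lt_of_lt_mul hx
  have := h ⟨x / n, h1⟩ ⟨x % n, Nat.mod_lt _ hn⟩
  rwa [Nat.div_add_mod'] at this

/-- One round of repeated squaring, with precision `1 / Q`. -/
theorem squaringRound_runs {P : Prog} {w n γ κ Q T : ℕ} {B : ℤ} {W : Fin n → Fin n → ℝ≥0∞}
    {r : ℝ≥0∞} {m : ℕ} (hm : 1 ≤ m) (hn : 1 ≤ n) (hQ : 1 ≤ Q) (hw2 : 2 < 2 ^ w)
    (hnw : n * n < 2 ^ w) (hγ : γ < 2 ^ w) (hB : B ≤ 2 ^ κ)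
    (hP : ∀ τ : State w, τ.reg 0 = BitVec.ofNat w n → τ.reg 1 = BitVec.ofNat w γ →
      τ.reg 2 = BitVec.ofNat w 1 → τ.reg 3 = BitVec.ofNat w Q →
      τ.FloatInput γ κ 0 n ∧ τ.FloatInput γ κ 3 n →
      Runs P T τ (fun τ' => τ'.FloatOutput γ 6 n ∧ ∀ i j : Fin n,
        minPlus (τ.floatMat γ 0 n) (τ.floatMat γ 3 n) i j ≤ τ'.floatMat γ 6 n i j ∧
        τ'.floatMat γ 6 n i j ≤ (1 + ((1 : ℕ) : ℝ≥0∞) / (Q : ℝ≥0∞)) *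
          minPlus (τ.floatMat γ 0 n) (τ.floatMat γ 3 n) i j))
    (σ : State w) (r0 : σ.reg 0 = BitVec.ofNat w n) (r1 : σ.reg 1 = BitVec.ofNat w γ)
    (r5 : σ.reg 5 = BitVec.ofNat w 1) (r7 : σ.reg 7 = BitVec.ofNat w (n * n))
    (r12 : σ.reg 12 = BitVec.ofNat w Q)
    (hD : ∀ x < n * n, GoodCell γ B (σ.mem 10 (.ofNat w x)) (σ.mem 11 (.ofNat w x))
      (σ.mem 12 (.ofNat w x)))
    (hW : ApproxWalks W (σ.floatMat γ 10 n) r m) :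
    Runs (squaringRound P) (100 + 100 * (n * n) + T) σ (fun σ' => (∀ r < 40, σ'.reg r = σ.reg r) ∧
        (∀ x < n * n, GoodCell γ (B + 2) (σ'.mem 10 (.ofNat w x)) (σ'.mem 11 (.ofNat w x))
          (σ'.mem 12 (.ofNat w x))) ∧
        ApproxWalks W (σ'.floatMat γ 10 n) ((1 + ((1 : ℕ) : ℝ≥0∞) / (Q : ℝ≥0∞)) * r) (2 * m)) := by
  refine Runs.andThen (Runs.forEach (S := [100, 101, 102, 103, 104, 105]) rfl (by decide) hnw r7
    (fun x col => (col 100 = σ.mem 10 (.ofNat w x) ∧ col 101 = σ.mem 11 (.ofNat w x) ∧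
      col 102 = σ.mem 12 (.ofNat w x)) ∧ col 103 = σ.mem 10 (.ofNat w x) ∧
      col 104 = σ.mem 11 (.ofNat w x) ∧ col 105 = σ.mem 12 (.ofNat w x)) ?_) ?_ ?_
  · intro x hx σ₁ hs h40 hcol
    simp [Prog.eval, h40, hcol]
  · simp [Prog.size]; omega
  rintro σ₁ ⟨hs₁, hR₁⟩
  beta_reduce at hR₁
  refine Runs.andThen (Runs.eval (Q := fun σ₂ => σ₂.mem = σ₁.mem ∧
    (∀ r < 40, σ₂.reg r = σ.reg r) ∧ σ₂.reg 100 = BitVec.ofNat w n ∧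
    σ₂.reg 101 = BitVec.ofNat w γ ∧ σ₂.reg 102 = BitVec.ofNat w 1 ∧ σ₂.reg 103 = BitVec.ofNat w Q)
    (by simp [Prog.LoopFree]) ?_) ?_ ?_
  · refine ⟨rfl, fun r hr => ?_, ?_, ?_, ?_, ?_⟩
    · simp only [Prog.eval, State.setReg_reg]
      rw [if_neg (by omega), if_neg (by omega), if_neg (by omega), if_neg (by omega), hs₁.reg r hr]
    all_goals simp [Prog.eval, WordOp.eval, hs₁.reg, r0, r1, r5, r12]
  · simp [Prog.size]; omega
  rintro σ₂ ⟨m2, hreg₂, c0, c1, c2, c3⟩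
  set D := σ.floatMat γ 10 n with hDdef
  have hτ0 : (σ₂.view 100).floatMat γ 0 n = D := by
    funext i j
    have := (hR₁ _ (index_lt i j)).1
    simp only [State.floatMat_eq, State.cell, State.view, m2, hDdef, zero_add, Nat.reduceAdd]
    rw [this.1, this.2.1, this.2.2]
  have hτ3 : (σ₂.view 100).floatMat γ 3 n = D := by
    funext i j
    have := (hR₁ _ (index_lt i j)).2
    simp only [State.floatMat_eq, State.cell, State.view, m2, hDdef, Nat.reduceAdd]
    rw [this.1, this.2.1, this.2.2]
  refine Runs.andThen (Runs.shift (hP (σ₂.view 100) c0 c1 c2 c3 ⟨fun i j => ?_, fun i j => ?_⟩)) ?_ ?_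
  · have := (hR₁ _ (index_lt i j)).1
    simp only [State.cell, State.view, m2, zero_add, Nat.reduceAdd]
    rw [this.1, this.2.1, this.2.2]
    exact (hD _ (index_lt i j)).mono hB
  · have := (hR₁ _ (index_lt i j)).2
    simp only [State.cell, State.view, m2, Nat.reduceAdd]
    rw [this.1, this.2.1, this.2.2]
    exact (hD _ (index_lt i j)).mono hB
  · simp [Prog.size]; omega
  rw [hτ0, hτ3]
  rintro σ₃ ⟨⟨hout, hC⟩, hreg₃, hmem₃⟩
  have hmem : ∀ s < 100, σ₃.mem s = σ.mem s := fun s hs =>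
    (hmem₃ s hs).trans ((congrFun m2 s).trans (hs₁.mem s (by simp; omega)))
  have hreg : ∀ s < 40, σ₃.reg s = σ.reg s := fun s hs => (hreg₃ s (by omega)).trans (hreg₂ s hs)
  set C := (σ₃.view 100).floatMat γ 6 n with hCdef
  -- the entries of the approximate product are in range
  have hCgood : ∀ x < n * n, GoodCell γ (B + 2) (σ₃.mem 106 (.ofNat w x)) (σ₃.mem 107 (.ofNat w x))
      (σ₃.mem 108 (.ofNat w x)) ∨ floatCell γ (σ₃.mem 106 (.ofNat w x)) (σ₃.mem 107 (.ofNat w x))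
      (σ₃.mem 108 (.ofNat w x)) = ⊤ := by
    refine forall_index fun i j => ?_
    by_cases htop : C i j = ⊤
    · exact Or.inr htop
    left
    have : Nonempty (Fin n) := ⟨⟨0, hn⟩⟩
    obtain ⟨k, hk⟩ := exists_eq_ciInf_of_finite (f := fun k => D i k + D k j)
    have hk' : minPlus D D i j = D i k + D k j := hk.symm
    have hfin : D i k + D k j ≠ ⊤ := fun h => htop (top_le_iff.1 (h ▸ hk' ▸ (hC i j).1))
    refine GoodCell.of_value (hout i j) ?_ ?_
    · refine le_trans ?_ (hC i j).1
      rw [hk']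
      exact (hD _ (index_lt i k)).one_le.trans le_self_add
    · have b1 := (hD _ (index_lt i k)).lt (ne_top_of_le_ne_top hfin le_self_add)
      have b2 := (hD _ (index_lt k j)).lt (ne_top_of_le_ne_top hfin le_add_self)
      have b3 : (1 + ((1 : ℕ) : ℝ≥0∞) / (Q : ℝ≥0∞)) ≤ 2 := by
        rw [← one_add_one_eq_two]
        gcongr
        exact ENNReal.div_le_of_le_mul (by simpa using hQ)
      calc C i j ≤ (1 + ((1 : ℕ) : ℝ≥0∞) / (Q : ℝ≥0∞)) * (D i k + D k j) := hk' ▸ (hC i j).2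
        _ ≤ 2 * (D i k + D k j) := by gcongr
        _ < 2 * (ENNReal.ofReal (2 ^ B) + ENNReal.ofReal (2 ^ B)) :=
          ENNReal.mul_lt_mul_right (by norm_num) (by norm_num) (ENNReal.add_lt_add b1 b2)
        _ = ENNReal.ofReal (2 ^ (B + 2)) := by
          rw [← ENNReal.ofReal_add (by positivity) (by positivity),
            ← ENNReal.ofReal_ofNat 2, ← ENNReal.ofReal_mul (by positivity)]
          congr 1
          rw [zpow_add₀ (by norm_num)]
          norm_num; ring
  refine Runs.mono (Runs.forEach (S := [10, 11, 12]) rfl (by decide) (N := n * n) hnw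
    ((hreg 7 (by decide)).trans r7)
    (fun x col => GoodCell γ (B + 2) (col 10) (col 11) (col 12) ∧
      floatCell γ (col 10) (col 11) (col 12) =
        min (floatCell γ (σ.mem 10 (.ofNat w x)) (σ.mem 11 (.ofNat w x)) (σ.mem 12 (.ofNat w x)))
          (floatCell γ (σ₃.mem 106 (.ofNat w x)) (σ₃.mem 107 (.ofNat w x))
            (σ₃.mem 108 (.ofNat w x)))) ?_) ?_ ?_
  · intro x hx σ₄ hs₄ h40 hcol
    have q1 := (hs₄.reg 1 (by decide)).trans ((hreg 1 (by decide)).trans r1)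
    have q5 := (hs₄.reg 5 (by decide)).trans ((hreg 5 (by decide)).trans r5)
    have m10 := (hcol 10).trans (congrFun (hmem 10 (by decide)) _)
    have m11 := (hcol 11).trans (congrFun (hmem 11 (by decide)) _)
    have m12 := (hcol 12).trans (congrFun (hmem 12 (by decide)) _)
    have g1 := hD x hx
    have g2 := hCgood x hx
    have n106 := hcol 106
    have n107 := hcol 107
    have n108 := hcol 108
    have tγ := toNat_ofNat_of_lt hγ
    generalize σ.mem 10 (.ofNat w x) = tD at *
    generalize σ.mem 11 (.ofNat w x) = eD at *
    generalize σ.mem 12 (.ofNat w x) = fD at *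
    generalize σ₃.mem 106 (.ofNat w x) = tC at *
    generalize σ₃.mem 107 (.ofNat w x) = eC at *
    generalize σ₃.mem 108 (.ofNat w x) = fC at *
    have one : (BitVec.ofNat w 1).toNat = 1 := toNat_ofNat_of_lt (by omega)
    by_cases hC1 : tC = BitVec.ofNat w 1
    · have g2 : GoodCell γ (B + 2) tC eC fC := g2.resolve_right (by simp [floatCell, hC1, one, -BitVec.toNat_ofNat])
      subst hC1
      by_cases hD1 : tD = BitVec.ofNat w 1
      · subst hD1
        by_cases hlt : fval γ eC.toInt fC.toNat < fval γ eD.toInt fD.toNat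
        · simp [Prog.eval, Test.holds, State.freg, h40, q1, q5, m10, m11, m12, n106, n107, n108, tγ,
            hlt, g2, -BitVec.toNat_ofNat]
          simp [floatCell, one, -BitVec.toNat_ofNat]
          exact ENNReal.ofReal_le_ofReal hlt.le
        · simp [Prog.eval, Test.holds, State.freg, h40, q1, q5, m10, m11, m12, n106, n107, n108, tγ,
            hlt, g1.mono (show B ≤ B + 2 by omega), -BitVec.toNat_ofNat]
          simp [floatCell, one, -BitVec.toNat_ofNat]
          exact ENNReal.ofReal_le_ofReal (not_lt.1 hlt)
      · have htop : floatCell γ tD eD fD = ⊤ := by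
          rcases g1 with ⟨h, -⟩ | h
          · exact absurd ((eq_ofNat_iff _ (by omega)).2 h) hD1
          · simp [floatCell, h]
        simp [Prog.eval, Test.holds, h40, q5, m10, m11, m12, n106, n107, n108, hD1, g2, htop]
    · have htop : floatCell γ tC eC fC = ⊤ := by
        rcases g2 with (⟨h, -⟩ | h) | h
        · exact absurd ((eq_ofNat_iff _ (by omega)).2 h) hC1
        · simp [floatCell, h]
        · exact h
      simp [Prog.eval, Test.holds, h40, q5, m10, m11, m12, n106, n107, n108, hC1, htop,
        g1.mono (show B ≤ B + 2 by omega)]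
  · simp [Prog.size]; omega
  rintro σ₄ ⟨hs₄, hR₄⟩
  refine ⟨fun r hr => (hs₄.reg r hr).trans (hreg r hr), fun x hx => (hR₄ x hx).1, ?_⟩
  exact hW.square hm (fun i j => (hC i j).1) (fun i j => (hC i j).2)
    (fun i j => (hR₄ _ (index_lt i j)).2)

/-- Correctness of repeated squaring. The matrices passed to `P` have larger exponents than the input:
an entry less than quadruples, and so its exponent grows by at most `2`, in each of the rounds. -/
theorem apspByMinPlus_runs {P : Prog} {w n p q γ κ κ' T : ℕ} (hn : 1 ≤ n) (hp : 0 < p)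
    (hpq : 10 * p < q) (hq : q < 2 ^ w) (hnw : 2 * (n * n) < 2 ^ w) (hγ : γ < 2 ^ w)
    (hκ : 2 ^ κ + 2 * Nat.clog 2 n ≤ 2 ^ κ')
    (hP : ∀ τ : State w, τ.reg 0 = BitVec.ofNat w n → τ.reg 1 = BitVec.ofNat w γ →
      τ.reg 2 = BitVec.ofNat w 1 →
      τ.reg 3 = BitVec.ofNat w (2 * ((Nat.clog 2 n + 1) * (q / p + 1))) →
      τ.FloatInput γ κ' 0 n ∧ τ.FloatInput γ κ' 3 n →
      Runs P T τ (fun τ' => τ'.FloatOutput γ 6 n ∧ ∀ i j : Fin n,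
        minPlus (τ.floatMat γ 0 n) (τ.floatMat γ 3 n) i j ≤ τ'.floatMat γ 6 n i j ∧
        τ'.floatMat γ 6 n i j ≤ (1 + ((1 : ℕ) : ℝ≥0∞) /
          ((2 * ((Nat.clog 2 n + 1) * (q / p + 1)) : ℕ) : ℝ≥0∞)) *
          minPlus (τ.floatMat γ 0 n) (τ.floatMat γ 3 n) i j))
    (σ : State w) (r0 : σ.reg 0 = BitVec.ofNat w n) (r1 : σ.reg 1 = BitVec.ofNat w γ)
    (r2 : σ.reg 2 = BitVec.ofNat w p) (r3 : σ.reg 3 = BitVec.ofNat w q)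
    (hin : σ.FloatInput γ κ 0 n) :
    Runs (apspByMinPlus P)
      (200 + 200 * (n * n) + 3 * Nat.clog 2 n + Nat.clog 2 n * (100 + 100 * (n * n) + T + 3)) σ
      (fun σ₁ => σ₁.FloatOutput γ 6 n ∧ ∀ u v : Fin n,
        graphDist (σ.floatMat γ 0 n) u v ≤ σ₁.floatMat γ 6 n u v ∧
        σ₁.floatMat γ 6 n u v ≤ (1 + (p : ℝ≥0∞) / q) * graphDist (σ.floatMat γ 0 n) u v) := by
  have hnn : n ≤ n * n := Nat.le_mul_of_pos_left n hn
  have hw2 : 2 < 2 ^ w := by omega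
  have herr := squaring_error (l := Nat.clog 2 n) hp hpq
  set L := Nat.clog 2 n with hL
  have hLn : L ≤ n := Nat.clog_le_of_le_pow (Nat.lt_two_pow_self).le
  set Q := 2 * ((L + 1) * (q / p + 1)) with hQ
  have hQ1 : 1 ≤ Q := by rw [hQ]; exact Nat.mul_pos (by norm_num) (by positivity)
  set W := σ.floatMat γ 0 n with hW
  refine Runs.andThen (Runs.eval (Q := fun σ₁ => (∀ r < 4, σ₁.reg r = σ.reg r) ∧
    σ₁.reg 5 = BitVec.ofNat w 1 ∧ σ₁.reg 6 = BitVec.ofNat w (q / p + 1) ∧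
    σ₁.reg 7 = BitVec.ofNat w (n * n) ∧ σ₁.reg 10 = BitVec.ofNat w 1 ∧
    σ₁.reg 11 = BitVec.ofNat w 0 ∧ σ₁.mem = σ.mem) (by simp [Prog.LoopFree]) ?_) ?_ ?_
  · refine ⟨fun r hr => ?_, ?_⟩
    · simp only [Prog.eval, State.setReg_reg]
      iterate 6 rw [if_neg (by omega)]
    · simp [Prog.eval, WordOp.eval, r0, r2, r3, ofNat_div hq (show p < 2 ^ w by omega),
        ← BitVec.ofNat_mul, ← BitVec.ofNat_add]
  · simp [Prog.size]; omega
  rintro σ₁ ⟨hr₁, r5, r6, r7, r10, r11, m1⟩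
  refine Runs.andThen (Runs.clog (N := n) (by decide) (by decide) (by decide) (by decide) (by decide)
    (by omega) ((hr₁ 0 (by decide)).trans r0) r5 r10 r11) ?_ ?_
  · simp [Prog.size]; omega
  rintro σ₂ ⟨-, t11, hr₂, m2⟩
  refine Runs.andThen (Runs.eval (Q := fun σ₃ => (∀ r < 12, r ≠ 10 → r ≠ 11 → σ₃.reg r = σ₁.reg r) ∧
    σ₃.reg 11 = BitVec.ofNat w L ∧ σ₃.reg 12 = BitVec.ofNat w Q ∧ σ₃.mem = σ.mem)
    (by simp [Prog.LoopFree]) ?_) ?_ ?_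
  · refine ⟨fun r hr h1 h2 => ?_, ?_, ?_, m2.trans m1⟩
    · simp only [Prog.eval, State.setReg_reg]
      iterate 3 rw [if_neg (by omega)]
      exact hr₂ r h1 h2
    · simp [Prog.eval, t11, hL]
    · simp [Prog.eval, WordOp.eval, t11, hr₂, r5, r6, ← BitVec.ofNat_mul, ← BitVec.ofNat_add]
      rw [hQ, ← hL, two_mul]
  · simp [Prog.size]; omega
  rintro σ₃ ⟨hr₃, v11, v12, m3⟩
  have v0 : σ₃.reg 0 = BitVec.ofNat w n :=
    (hr₃ 0 (by decide) (by decide) (by decide)).trans ((hr₁ 0 (by decide)).trans r0)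
  have v1 : σ₃.reg 1 = BitVec.ofNat w γ :=
    (hr₃ 1 (by decide) (by decide) (by decide)).trans ((hr₁ 1 (by decide)).trans r1)
  have v5 := (hr₃ 5 (by decide) (by decide) (by decide)).trans r5
  have v7 := (hr₃ 7 (by decide) (by decide) (by decide)).trans r7
  refine Runs.andThen (Runs.forEach (S := [10, 11, 12]) rfl (by decide) (N := n * n) (by omega) v7
    (fun x col => col 10 = σ.mem 0 (.ofNat w x) ∧ col 11 = σ.mem 1 (.ofNat w x) ∧
      col 12 = σ.mem 2 (.ofNat w x)) ?_) ?_ ?_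
  · intro x hx σ' hs h40 hcol
    simp [Prog.eval, h40, hcol, m3]
  · simp [Prog.size]; omega
  rintro σ₄ ⟨hs₄, hR₄⟩
  beta_reduce at hR₄
  have hW₄ : σ₄.floatMat γ 10 n = W := by
    funext i j
    obtain ⟨h1, h2, h3⟩ := hR₄ _ (index_lt i j)
    simp only [State.floatMat_eq, State.cell, hW, zero_add, Nat.reduceAdd, h1, h2, h3]
  have hin' : ∀ x < n * n, GoodCell γ (2 ^ κ) (σ.mem 0 (.ofNat w x)) (σ.mem 1 (.ofNat w x))
      (σ.mem 2 (.ofNat w x)) := forall_index fun i j => hin i j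
  refine Runs.andThen (Runs.forUp (T := 100 + 100 * (n * n) + T) (i := 20) (lim := 11) (by decide)
    (N := L) (by omega) (fun k σ' => σ'.reg 20 = BitVec.ofNat w k ∧
      (∀ r < 20, σ'.reg r = σ₃.reg r) ∧
      (∀ x < n * n, GoodCell γ (2 ^ κ + 2 * k) (σ'.mem 10 (.ofNat w x)) (σ'.mem 11 (.ofNat w x))
        (σ'.mem 12 (.ofNat w x))) ∧
      ApproxWalks W (σ'.floatMat γ 10 n) ((1 + ((1 : ℕ) : ℝ≥0∞) / (Q : ℝ≥0∞)) ^ k) (2 ^ k))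
    (fun k σ' h => ⟨h.1, (h.2.1 11 (by decide)).trans v11⟩) ?_ ?_) ?_ ?_
  · rintro k hk σ' ⟨h20, hr, hg, hA⟩
    refine Runs.mono (squaringRound_runs (κ := κ') Nat.one_le_two_pow hn hQ1 hw2 (by omega) hγ ?_ hP σ'
      ((hr 0 (by decide)).trans v0) ((hr 1 (by decide)).trans v1) ((hr 5 (by decide)).trans v5)
      ((hr 7 (by decide)).trans v7) ((hr 12 (by decide)).trans v12) hg hA) le_rfl ?_
    · have : ((2 ^ κ + 2 * L : ℕ) : ℤ) ≤ ((2 ^ κ' : ℕ) : ℤ) := by exact_mod_cast hκ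
      push_cast at this
      omega
    · rintro σ'' ⟨e1, e2, e3⟩
      refine ⟨?_, fun r hr' => ?_, fun x hx => ?_, ?_⟩
      · simp only [State.setReg_reg, if_true, e1 20 (by decide), h20]
        exact (BitVec.ofNat_add k 1).symm
      · simp only [State.setReg_reg]
        rw [if_neg (by omega), if_neg (by omega), e1 r (by omega), hr r hr']
      · exact (e2 x hx).mono (by push_cast; omega)
      · rw [pow_succ', pow_succ']
        exact e3
  · refine ⟨by simp, fun r hr => ?_, fun x hx => ?_, ?_⟩
    · simp only [State.setReg_reg]
      rw [if_neg (by omega), hs₄.reg r (by omega)]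
    · obtain ⟨h1, h2, h3⟩ := hR₄ x hx
      simp only [State.setReg_mem, h1, h2, h3]
      exact (hin' x hx).mono (by simp)
    · rw [pow_zero, pow_zero]
      have : (σ₄.setReg 20 (BitVec.ofNat w 0)).floatMat γ 10 n = W := hW₄
      rw [this]
      exact approxWalks_one W
  · simp [Prog.size]; omega
  rintro σ₅ ⟨-, hr₅, hg₅, hA₅⟩
  refine Runs.mono (Runs.forEach (S := [6, 7, 8]) rfl (by decide) (N := n * n) (by omega)
    ((hr₅ 7 (by decide)).trans v7)
    (fun x col => (x / n = x % n → col 6 = .ofNat w 0) ∧ (x / n ≠ x % n →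
      col 6 = σ₅.mem 10 (.ofNat w x) ∧ col 7 = σ₅.mem 11 (.ofNat w x) ∧
      col 8 = σ₅.mem 12 (.ofNat w x)) ∧ col 8 = σ₅.mem 12 (.ofNat w x)) ?_) ?_ ?_
  · intro x hx σ' hs h40 hcol
    have q0 := (hs.reg 0 (by decide)).trans ((hr₅ 0 (by decide)).trans v0)
    have hx' : x < 2 ^ w := by omega
    have d1 := ofNat_div hx' (show n < 2 ^ w by omega)
    have d2 := ofNat_mod hx' (show n < 2 ^ w by omega)
    have d3 := ofNat_eq_iff ((Nat.div_le_self x n).trans_lt hx') ((Nat.mod_le x n).trans_lt hx')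
    by_cases hd : x / n = x % n
    · simp [Prog.eval, WordOp.eval, Test.holds, h40, hcol, q0, d1, d2, hd]
    · simp [Prog.eval, WordOp.eval, Test.holds, h40, hcol, q0, d1, d2, d3, hd]
  · simp [Prog.size]; omega
  rintro σ₆ ⟨-, hR₆⟩
  refine ⟨fun u v h6 => ?_, fun u v => ?_⟩
  · have H := hR₆ _ (index_lt u v)
    by_cases huv : u = v
    · have h0 := H.1 (by rw [index_div, index_mod, huv])
      have h0' : σ₆.cell 6 n u v = BitVec.ofNat w 0 := h0
      rw [h0'] at h6
      simp at h6
    · have h1 := H.2.1 (by rw [index_div, index_mod]; exact fun h => huv (Fin.ext h))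
      rcases hg₅ _ (index_lt u v) with h | h
      · have h8 : σ₆.cell (6 + 2) n u v = σ₅.mem 12 (.ofNat w (u * n + v)) := h1.2.2
        rw [h8]; exact h.2.2.2
      · have h6' : σ₆.cell 6 n u v = σ₅.mem 10 (.ofNat w (u * n + v)) := h1.1
        rw [h6', h] at h6
        simp at h6
  · have H := hR₆ _ (index_lt u v)
    by_cases huv : u = v
    · subst huv
      have h0 : σ₆.cell 6 n u u = BitVec.ofNat w 0 := H.1 (by rw [index_div, index_mod])
      simp [State.floatMat, h0, graphDist_self]
    · have h1 := H.2.1 (by rw [index_div, index_mod]; exact fun h => huv (Fin.ext h))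
      have heq : σ₆.floatMat γ 6 n u v = σ₅.floatMat γ 10 n u v := by
        simp only [State.floatMat_eq, State.cell, Nat.reduceAdd, h1]
      rw [heq]
      refine ⟨hA₅.1 u v, (hA₅.le_graphDist ?_ ?_ (Nat.le_pow_clog (by norm_num) n) huv).trans ?_⟩
      · refine ne_top_of_le_ne_top ?_ herr
        exact ENNReal.add_ne_top.2 ⟨by simp, ENNReal.div_ne_top (by simp) (by simp; omega)⟩
      · exact pow_ne_zero _ (by simp)
      · gcongr

end WordRAM

/-! ### Estimates for the precision parameter -/

/-- Time bounds with different constants and exponents are unified by taking the largest one. -/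
theorem approx_time_le {n t C a b : ℕ} {K c ε ℓ : ℝ} (hε : 0 < ε) (hε1 : ε ≤ 1) (hℓ : 1 ≤ ℓ)
    (ht : (t : ℝ) ≤ K * (n : ℝ) ^ c / ε ^ a * ℓ ^ b) (hK : K ≤ C) (ha : a ≤ C) (hb : b ≤ C) :
    (t : ℝ) ≤ C * (n : ℝ) ^ c / ε ^ C * ℓ ^ C := by
  have h3 : (0 : ℝ) ≤ (n : ℝ) ^ c := by positivity
  have h4 : ε ^ C ≤ ε ^ a := pow_le_pow_of_le_one hε.le hε1 ha
  have h5 : ℓ ^ b ≤ ℓ ^ C := pow_le_pow_right₀ hℓ hb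
  refine ht.trans ?_
  gcongr

theorem two_le_log {x : ℝ} (hx : 10 ≤ x) : 2 ≤ Real.log x := by
  rw [Real.le_log_iff_exp_le (by linarith)]
  have h := Real.exp_one_lt_d9
  have h1 : Real.exp 2 = Real.exp 1 * Real.exp 1 := by rw [← Real.exp_add]; norm_num
  nlinarith [Real.exp_pos 1]

/-- Elementary consequences of `ε = p / q < 1 / 10`. The number `n * (q / p)` is the quantity `n / ε` of
the time bounds. -/
theorem precision_facts {n p q : ℕ} (hn : 1 ≤ n) (hp : 0 < p) (hpq : 10 * p < q) :
    (0 : ℝ) < (p : ℝ) / q ∧ (p : ℝ) / q ≤ 1 / 10 ∧ (1 : ℝ) / ((p : ℝ) / q) = q / p ∧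
    (10 : ℝ) ≤ q / p ∧ (n : ℝ) / ((p : ℝ) / q) = n * (q / p) ∧
    (n : ℝ) ≤ n * (q / p) ∧ (q : ℝ) / p ≤ n * (q / p) := by
  have hp' : (0 : ℝ) < p := by exact_mod_cast hp
  have hq' : (0 : ℝ) < q := by exact_mod_cast (by omega : 0 < q)
  have hn' : (1 : ℝ) ≤ n := by exact_mod_cast hn
  have hpq' : (10 : ℝ) * p ≤ q := by exact_mod_cast hpq.le
  have h10 : (10 : ℝ) ≤ q / p := by rw [le_div_iff₀ hp']; exact hpq'
  refine ⟨by positivity, ?_, by field_simp, h10, by field_simp, ?_, ?_⟩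
  · rw [div_le_div_iff₀ hq' (by norm_num)]; linarith
  · exact le_mul_of_one_le_right (by linarith) (by linarith)
  · exact le_mul_of_one_le_left (by linarith) hn'

theorem clog_add_one_le {n : ℕ} {ℓ : ℝ} (hℓ : 2 ≤ ℓ) (h : Real.log n ≤ ℓ) :
    ((Nat.clog 2 n + 1 : ℕ) : ℝ) ≤ 3 * ℓ := by
  rcases Nat.eq_zero_or_pos (Nat.clog 2 n) with h0 | h0
  · rw [h0]; push_cast; linarith
  have h1 : 2 ^ (Nat.clog 2 n - 1) < n := (Nat.lt_clog_iff_pow_lt (by norm_num)).1 (by omega)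
  have h2 : ((2 : ℝ) ^ (Nat.clog 2 n - 1)) ≤ n := by exact_mod_cast h1.le
  have h3 := Real.log_le_log (by positivity) h2
  rw [Real.log_pow] at h3
  have h4 := Real.log_two_gt_d9
  have h5 : ((Nat.clog 2 n - 1 : ℕ) : ℝ) = (Nat.clog 2 n : ℝ) - 1 := by
    rw [Nat.cast_sub h0]; norm_num
  rw [h5] at h3
  have h6 : (1 : ℝ) ≤ Nat.clog 2 n := by exact_mod_cast h0
  push_cast
  nlinarith

set_option maxHeartbeats 1000000 in
/-- With `x = n / ε`, the precision `1 / Q` of the products satisfies `Q ≤ x ^ 2`, so that `n * Q ≤ x ^ 3`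
and the required mantissa length for the products is at most three times that for `x`. -/
theorem approxDirectedAPSPSolvable_of_approxMinPlusSolvable {c : ℝ} (hc : 2 ≤ c)
    (h : ApproxMinPlusSolvable c) : ApproxDirectedAPSPSolvable c := by
  obtain ⟨P, C, hP⟩ := h
  refine ⟨apspByMinPlus P, 3 + 3 * C + ⌈1500 * (1 + C * (36 : ℝ) ^ C)⌉₊, ?_⟩
  set C' := 3 + 3 * C + ⌈1500 * (1 + C * (36 : ℝ) ^ C)⌉₊ with hC'
  intro n p q γ κ w hn hp hpq hq hγ hw σ h0 h1 h2 h3 hin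
  obtain ⟨ε0, ε1, e1, e10, ex, hnx, hqx⟩ := precision_facts hn hp hpq
  have hn' : (1 : ℝ) ≤ n := by exact_mod_cast hn
  rw [ex] at hγ ⊢
  set ε : ℝ := (p : ℝ) / q with hε
  set x : ℝ := n * ((q : ℝ) / p) with hx
  have hx10 : 10 ≤ x := e10.trans hqx
  have hℓ := two_le_log hx10
  set ℓ := Real.log x with hℓdef
  have hpow : ∀ a ≤ C', x ^ a ≤ 2 ^ γ := fun a ha =>
    (pow_le_pow_right₀ (by linarith) ha).trans hγ
  have hγ1 : 1 ≤ γ := by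
    by_contra hcon
    have := hpow 1 (by omega)
    rw [show γ = 0 by omega] at this
    norm_num at this; linarith
  have hγw : γ ≤ w := by nlinarith
  have hpowγ : ∀ m : ℕ, (m : ℝ) ≤ 2 ^ γ → m ≤ 2 ^ w := fun m hm => by
    have : m ≤ 2 ^ γ := by exact_mod_cast hm
    exact this.trans (Nat.pow_le_pow_right (by norm_num) hγw)
  set L := Nat.clog 2 n with hL
  set E := q / p + 1 with hE
  set Q := 2 * ((L + 1) * E) with hQ
  have hL3 : ((L + 1 : ℕ) : ℝ) ≤ 3 * ℓ :=
    clog_add_one_le hℓ (Real.log_le_log (by linarith) hnx)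
  have hLn : L ≤ n := Nat.clog_le_of_le_pow (Nat.lt_two_pow_self).le
  have hLγ : L ≤ γ := Nat.clog_le_of_le_pow (by
    have := hnx.trans ((pow_one x).symm.le.trans (hpow 1 (by omega)))
    exact_mod_cast this)
  have hE2 : (E : ℝ) ≤ 2 * (q / p) := by
    have : ((q / p : ℕ) : ℝ) ≤ q / p := Nat.cast_div_le
    rw [hE]; push_cast; linarith
  have hE11 : 11 ≤ E := by
    have : 10 ≤ q / p := (Nat.le_div_iff_mul_le hp).2 hpq.le
    omega
  have hQ22 : 22 ≤ Q := by rw [hQ]; nlinarith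
  have hQε : (Q : ℝ) ≤ 12 * ℓ * (q / p) := by
    rw [hQ, Nat.cast_mul, Nat.cast_mul]
    calc ((2 : ℕ) : ℝ) * (((L + 1 : ℕ) : ℝ) * E) ≤ 2 * ((3 * ℓ) * (2 * (q / p))) := by
          push_cast at hL3 ⊢; gcongr
      _ = 12 * ℓ * (q / p) := by ring
  have hQx : (Q : ℝ) ≤ x ^ 2 := by
    have hLn' : ((L + 1 : ℕ) : ℝ) ≤ 2 * n := by
      have : L + 1 ≤ 2 * n := by omega
      exact_mod_cast this
    rw [hQ, Nat.cast_mul, Nat.cast_mul]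
    calc ((2 : ℕ) : ℝ) * (((L + 1 : ℕ) : ℝ) * E) ≤ 2 * ((2 * n) * (2 * (q / p))) := by
          push_cast at hLn' ⊢; gcongr
      _ = 8 * x := by rw [hx]; ring
      _ ≤ x ^ 2 := by nlinarith
  have hnQ : (n : ℝ) * Q ≤ x ^ 3 := by
    calc (n : ℝ) * Q ≤ x * x ^ 2 := by gcongr
      _ = x ^ 3 := by ring
  have hγlt : γ < 2 ^ w := Nat.lt_two_pow_self.trans_le (Nat.pow_le_pow_right (by norm_num) hγw)
  -- the call of the Min-Plus program, with precision `1 / Q` and exponents of `κ + γ + 1` bits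
  have hQ' : ((1 : ℕ) : ℝ) / (Q : ℝ) = 1 / (Q : ℝ) := by simp
  have hnQ' : (n : ℝ) / (((1 : ℕ) : ℝ) / (Q : ℝ)) = n * Q := by simp
  have hcall := fun τ a b d e => hP n 1 Q γ (κ + γ + 1) w hn one_pos (by omega) ?_ ?_ ?_ τ a b d e
  rotate_left
  · have hw' : γ + 1 ≤ w := by nlinarith
    have : Q ≤ 2 ^ γ := by exact_mod_cast hQx.trans (hpow 2 (by omega))
    exact this.trans_lt (Nat.pow_lt_pow_right (by norm_num) (by omega))
  · rw [hnQ']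
    calc ((n : ℝ) * Q) ^ C ≤ (x ^ 3) ^ C := by gcongr
      _ = x ^ (3 * C) := (pow_mul _ _ _).symm
      _ ≤ 2 ^ γ := hpow _ (by omega)
  · calc C * (γ + (κ + γ + 1)) ≤ C * (3 * (γ + κ)) := by gcongr; omega
      _ = 3 * C * (γ + κ) := by ring
      _ ≤ C' * (γ + κ) := by gcongr; omega
      _ ≤ w := hw
  have hnw : 2 * (n * n) < 2 ^ w := by
    have h1 : (2 * (n * n) : ℝ) < x ^ 3 := by nlinarith [mul_le_mul hnx hnx (by linarith) (by linarith)]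
    have h2 := h1.trans_le (hpow 3 (by omega))
    have : 2 * (n * n) < 2 ^ γ := by exact_mod_cast h2
    exact this.trans_le (Nat.pow_le_pow_right (by norm_num) hγw)
  have hκ : 2 ^ κ + 2 * L ≤ 2 ^ (κ + γ + 1) := by
    have a1 : γ + 1 ≤ 2 ^ γ := Nat.lt_two_pow_self
    have a2 : 1 ≤ 2 ^ κ := Nat.one_le_two_pow
    have a3 : 1 * (2 * L) ≤ 2 ^ κ * (2 * γ) := Nat.mul_le_mul a2 (by omega)
    calc 2 ^ κ + 2 * L ≤ 2 ^ κ * (2 * (γ + 1)) := by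
          rw [show 2 * (γ + 1) = 2 * γ + 2 by ring, mul_add]; omega
      _ ≤ 2 ^ κ * (2 * 2 ^ γ) := by gcongr
      _ = 2 ^ (κ + γ + 1) := by rw [pow_succ, pow_add]; ring
  obtain ⟨t, σ₁, he, ht, hpost⟩ := apspByMinPlus_runs
    (T := ⌊C * (n : ℝ) ^ c / (((1 : ℕ) : ℝ) / (Q : ℝ)) ^ C *
      Real.log (n / (((1 : ℕ) : ℝ) / (Q : ℝ))) ^ C⌋₊) hn hp hpq hq hnw hγlt hκ
    (fun τ a b d e f => by
      obtain ⟨t, τ', he, ht, hpost⟩ := hcall τ a b d e f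
      exact ⟨t, τ', he, Nat.le_floor ht, hpost⟩) σ h0 h1 h2 h3 hin
  refine ⟨t, σ₁, he, ?_, hpost⟩
  refine approx_time_le (K := 1500 * (1 + C * (36 : ℝ) ^ C)) (a := C) (b := 2 * C + 1) ε0
    (by linarith) (by linarith) ?_ ?_ (by omega) (by omega)
  · have hlogQ : 0 ≤ Real.log (n * Q) := Real.log_nonneg (by
      have : (22 : ℝ) ≤ Q := by exact_mod_cast hQ22
      nlinarith)
    have hlogQ3 : Real.log (n * Q) ≤ 3 * ℓ := by
      have h22 : (22 : ℝ) ≤ Q := by exact_mod_cast hQ22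
      have : Real.log (x ^ 3) = 3 * ℓ := by rw [Real.log_pow]; norm_num [hℓdef]
      rw [← this]
      exact Real.log_le_log (by nlinarith) hnQ
    have hT : ((⌊C * (n : ℝ) ^ c / (((1 : ℕ) : ℝ) / (Q : ℝ)) ^ C *
        Real.log (n / (((1 : ℕ) : ℝ) / (Q : ℝ))) ^ C⌋₊ : ℕ) : ℝ) ≤
        C * (36 : ℝ) ^ C * ((n : ℝ) ^ c / ε ^ C * ℓ ^ (2 * C)) := by
      refine (Nat.floor_le (by rw [hnQ']; positivity)).trans ?_
      rw [hnQ']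
      calc C * (n : ℝ) ^ c / (((1 : ℕ) : ℝ) / (Q : ℝ)) ^ C * Real.log (n * Q) ^ C
          = C * (n : ℝ) ^ c * (Q : ℝ) ^ C * Real.log (n * Q) ^ C := by
            rw [hQ', one_div, inv_pow, div_inv_eq_mul]
        _ ≤ C * (n : ℝ) ^ c * (12 * ℓ * (q / p)) ^ C * (3 * ℓ) ^ C := by gcongr
        _ = C * (36 : ℝ) ^ C * ((n : ℝ) ^ c / ε ^ C * ℓ ^ (2 * C)) := by
            rw [← e1, show (36 : ℝ) = 12 * 3 by norm_num, two_mul C, pow_add]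
            simp only [mul_pow, div_pow, one_pow]
            ring
    set T := ⌊C * (n : ℝ) ^ c / (((1 : ℕ) : ℝ) / (Q : ℝ)) ^ C *
        Real.log (n / (((1 : ℕ) : ℝ) / (Q : ℝ))) ^ C⌋₊
    have ht' : t ≤ 500 * ((L + 1) * (n ^ 2 + T)) := by
      have a1 : 1 ≤ n ^ 2 := Nat.one_le_pow _ _ hn
      rw [← pow_two] at ht
      have a2 : L ≤ L * n ^ 2 := Nat.le_mul_of_pos_right L a1
      nlinarith [Nat.zero_le (L * T)]
    have hsq := sq_le_rpow hn hc
    have hbig : 1 ≤ 1 / ε ^ C * ℓ ^ (2 * C) := by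
      have b1 : 1 ≤ 1 / ε ^ C := by
        rw [one_le_div (by positivity)]
        exact pow_le_one₀ ε0.le (by linarith)
      have b2 : 1 ≤ ℓ ^ (2 * C) := one_le_pow₀ (by linarith)
      nlinarith
    have hsq' : ((n ^ 2 : ℕ) : ℝ) ≤ (n : ℝ) ^ c / ε ^ C * ℓ ^ (2 * C) := by
      refine hsq.trans ?_
      calc (n : ℝ) ^ c ≤ (n : ℝ) ^ c * (1 / ε ^ C * ℓ ^ (2 * C)) :=
            le_mul_of_one_le_right (by positivity) hbig
        _ = _ := by ring
    calc (t : ℝ) ≤ 500 * (((L + 1 : ℕ) : ℝ) * (((n ^ 2 : ℕ) : ℝ) + T)) := by exact_mod_cast ht'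
      _ ≤ 500 * ((3 * ℓ) * ((n : ℝ) ^ c / ε ^ C * ℓ ^ (2 * C) +
          C * (36 : ℝ) ^ C * ((n : ℝ) ^ c / ε ^ C * ℓ ^ (2 * C)))) := by gcongr
      _ = 1500 * (1 + C * (36 : ℝ) ^ C) * (n : ℝ) ^ c / ε ^ C * ℓ ^ (2 * C + 1) := by
        rw [pow_succ]; ring
  · rw [hC']
    push_cast
    have := Nat.le_ceil (1500 * (1 + C * (36 : ℝ) ^ C))
    have h1 : (0 : ℝ) ≤ C := Nat.cast_nonneg C
    linarith

/-! ### Sums as minima of maxima -/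

namespace WordRAM

/-- Multiplication of an extended nonnegative real by `r`, rounded to a floating-point number. -/
noncomputable def flScale (γ : ℕ) (r : ℝ) (z : ℝ≥0∞) : ℝ≥0∞ :=
  if z = ⊤ then ⊤ else ENNReal.ofReal (fl γ (z.toReal * r))

@[simp] theorem flScale_top (γ : ℕ) (r : ℝ) : flScale γ r ⊤ = ⊤ := by simp [flScale]

theorem flScale_ofReal (γ : ℕ) (r : ℝ) {x : ℝ} (hx : 0 ≤ x) :
    flScale γ r (ENNReal.ofReal x) = ENNReal.ofReal (fl γ (x * r)) := by
  simp [flScale, ENNReal.toReal_ofReal hx]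

theorem one_sub_inv_nonneg (γ : ℕ) : (0 : ℝ) ≤ 1 - 1 / 2 ^ γ := by
  have : (1 : ℝ) / 2 ^ γ ≤ 1 := by
    rw [div_le_one (by positivity)]; exact one_le_pow₀ (by norm_num)
  linarith

theorem le_fl_mul_fl {γ : ℕ} {x y : ℝ} (hx : 0 < x) (hy : 0 < y) :
    (1 - 1 / 2 ^ γ) ^ 2 * (x * y) ≤ fl γ (x * fl γ y) := by
  have h0 := one_sub_inv_nonneg γ
  have h1 : 0 < fl γ y := fval_pos _ _ _
  calc (1 - 1 / 2 ^ γ) ^ 2 * (x * y) = (1 - 1 / 2 ^ γ) * (x * ((1 - 1 / 2 ^ γ) * y)) := by ring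
    _ ≤ (1 - 1 / 2 ^ γ) * (x * fl γ y) := by gcongr; exact le_fl hy
    _ ≤ fl γ (x * fl γ y) := le_fl (by positivity)

theorem fl_mul_fl_le {γ : ℕ} {x y : ℝ} (hx : 0 < x) (hy : 0 < y) : fl γ (x * fl γ y) ≤ x * y := by
  have h1 : 0 < fl γ y := fval_pos _ _ _
  calc fl γ (x * fl γ y) ≤ x * fl γ y := fl_le (by positivity)
    _ ≤ x * y := by gcongr; exact fl_le hy

/-- For every ratio `ρ = k / m`, the sum `x + y` is at most the larger of `x (1 + ρ)` and
`y (1 + 1 / ρ)`. -/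
theorem add_le_max_scaled {x y m k : ℝ} (hm : 0 < m) (hk : 0 < k) :
    x + y ≤ max (x * ((m + k) / m)) (y * ((m + k) / k)) := by
  rcases le_total (y * m) (x * k) with h | h
  · refine le_max_of_le_left ?_
    rw [mul_div_assoc', le_div_iff₀ hm]
    nlinarith
  · refine le_max_of_le_right ?_
    rw [mul_div_assoc', le_div_iff₀ hk]
    nlinarith

/-- For a ratio `ρ = k / m` near `y / x`, the larger of `x (1 + ρ)` and `y (1 + 1 / ρ)` is near
`x + y`. The largest ratio is good enough for all `y > m x`. -/
theorem exists_max_scaled_le {x y : ℝ} (hx : 0 < x) (hy : 0 < y) {m : ℕ} (hm : 1 ≤ m) :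
    ∃ k < m * m, max (x * (((m : ℝ) + (k + 1 : ℕ)) / m)) (y * (((m : ℝ) + (k + 1 : ℕ)) / (k + 1 : ℕ))) ≤
      (1 + 1 / m) * (x + y) := by
  have hm' : (1 : ℝ) ≤ m := by exact_mod_cast hm
  rcases le_or_gt (m * y / x) (m * m : ℕ) with h | h
  · have hpos : 0 < m * y / x := by positivity
    have hk1 : 1 ≤ ⌈m * y / x⌉₊ := Nat.one_le_ceil_iff.2 hpos
    refine ⟨⌈m * y / x⌉₊ - 1, ?_, ?_⟩
    · have : ⌈m * y / x⌉₊ ≤ m * m := Nat.ceil_le.2 h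
      omega
    rw [Nat.sub_add_cancel hk1]
    have h1 := Nat.le_ceil (m * y / x)
    have h2 := Nat.ceil_lt_add_one hpos.le
    set k : ℝ := ((⌈m * y / x⌉₊ : ℕ) : ℝ)
    have hk : 0 < k := by linarith
    rw [div_le_iff₀ hx] at h1
    have h3 : (k - 1) * x ≤ m * y := by
      have : k - 1 ≤ m * y / x := by linarith
      rwa [le_div_iff₀ hx] at this
    refine max_le ?_ ?_
    · rw [mul_div_assoc', div_le_iff₀ (by linarith)]
      have : (1 + 1 / (m : ℝ)) * (x + y) * m = (m + 1) * (x + y) := by field_simp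
      nlinarith
    · calc y * ((m + k) / k) ≤ x + y := by
            rw [mul_div_assoc', div_le_iff₀ hk]; nlinarith
        _ ≤ (1 + 1 / m) * (x + y) := le_mul_of_one_le_left (by positivity) (by simp)
  · have hmm : 1 ≤ m * m := Nat.one_le_iff_ne_zero.2 (by positivity)
    refine ⟨m * m - 1, by omega, ?_⟩
    rw [Nat.sub_add_cancel hmm]
    rw [lt_div_iff₀ hx] at h
    push_cast at h ⊢
    have h1 : m * x ≤ y := by
      have : (m : ℝ) * (m * x) < m * y := by linarith
      exact (lt_of_mul_lt_mul_left this (by linarith)).le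
    have h2 : ((m : ℝ) + m * m) / m = 1 + m := by field_simp
    have h3 : ((m : ℝ) + m * m) / (m * m) = 1 + 1 / m := by field_simp; ring
    rw [h2, h3]
    have h4 : 0 < 1 / (m : ℝ) := by positivity
    exact max_le (by nlinarith) (by nlinarith)

/-- The rounded version of `add_le_max_scaled`. Both a scaling factor and the product with it are rounded,
whence the factor `(1 - 1 / 2 ^ γ) ^ 2`. -/
theorem sum_le_max_flScale {γ m k : ℕ} (hm : 1 ≤ m) (hk : 1 ≤ k) {a b : ℝ≥0∞} (ha : 1 ≤ a)
    (hb : 1 ≤ b) : ENNReal.ofReal ((1 - 1 / 2 ^ γ) ^ 2) * (a + b) ≤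
      max (flScale γ (fl γ (((m : ℝ) + k) / m)) a) (flScale γ (fl γ (((m : ℝ) + k) / k)) b) := by
  by_cases ha' : a = ⊤
  · simp [ha']
  by_cases hb' : b = ⊤
  · simp [hb']
  have hm' : (0 : ℝ) < m := by exact_mod_cast hm
  have hk' : (0 : ℝ) < k := by exact_mod_cast hk
  obtain ⟨x, hx, rfl⟩ : ∃ x : ℝ, 0 < x ∧ a = ENNReal.ofReal x :=
    ⟨a.toReal, ENNReal.toReal_pos (by positivity) ha', (ENNReal.ofReal_toReal ha').symm⟩
  obtain ⟨y, hy, rfl⟩ : ∃ x : ℝ, 0 < x ∧ b = ENNReal.ofReal x :=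
    ⟨b.toReal, ENNReal.toReal_pos (by positivity) hb', (ENNReal.ofReal_toReal hb').symm⟩
  rw [flScale_ofReal _ _ hx.le, flScale_ofReal _ _ hy.le, ← ENNReal.ofReal_add hx.le hy.le,
    ← ENNReal.ofReal_mul (by positivity), ← ENNReal.ofReal_max]
  refine ENNReal.ofReal_le_ofReal ?_
  rcases le_max_iff.1 (add_le_max_scaled (x := x) (y := y) hm' hk') with h | h
  · refine le_max_of_le_left (le_trans ?_ (le_fl_mul_fl hx (by positivity)))
    gcongr
  · refine le_max_of_le_right (le_trans ?_ (le_fl_mul_fl hy (by positivity)))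
    gcongr

/-- The rounded version of `exists_max_scaled_le`. Rounding is downward, so no error term is needed. -/
theorem exists_max_flScale_le {γ m : ℕ} (hm : 1 ≤ m) {a b : ℝ≥0∞} (ha : 1 ≤ a)
    (hb : 1 ≤ b) : ∃ k < m * m, max (flScale γ (fl γ (((m : ℝ) + (k + 1 : ℕ)) / m)) a)
      (flScale γ (fl γ (((m : ℝ) + (k + 1 : ℕ)) / (k + 1 : ℕ))) b) ≤
      ENNReal.ofReal (1 + 1 / m) * (a + b) := by
  have hm' : (0 : ℝ) < m := by exact_mod_cast hm
  have hmm : 0 < m * m := Nat.mul_pos hm hm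
  have hpos : ENNReal.ofReal (1 + 1 / m) ≠ 0 := by
    rw [Ne, ENNReal.ofReal_eq_zero, not_le]; positivity
  by_cases ha' : a = ⊤
  · exact ⟨0, hmm, by simp only [ha', top_add]; rw [ENNReal.mul_top hpos]; exact le_top⟩
  by_cases hb' : b = ⊤
  · exact ⟨0, hmm, by simp only [hb', add_top]; rw [ENNReal.mul_top hpos]; exact le_top⟩
  obtain ⟨x, hx, rfl⟩ : ∃ x : ℝ, 0 < x ∧ a = ENNReal.ofReal x :=
    ⟨a.toReal, ENNReal.toReal_pos (by positivity) ha', (ENNReal.ofReal_toReal ha').symm⟩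
  obtain ⟨y, hy, rfl⟩ : ∃ x : ℝ, 0 < x ∧ b = ENNReal.ofReal x :=
    ⟨b.toReal, ENNReal.toReal_pos (by positivity) hb', (ENNReal.ofReal_toReal hb').symm⟩
  obtain ⟨k, hk, h⟩ := exists_max_scaled_le hx hy hm
  refine ⟨k, hk, ?_⟩
  rw [flScale_ofReal _ _ hx.le, flScale_ofReal _ _ hy.le, ← ENNReal.ofReal_add hx.le hy.le,
    ← ENNReal.ofReal_mul (by positivity), ← ENNReal.ofReal_max]
  refine ENNReal.ofReal_le_ofReal (le_trans (max_le_max ?_ ?_) h)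
  · exact fl_mul_fl_le hx (by positivity)
  · exact fl_mul_fl_le hy (by positivity)

/-- The products of the scaled matrices determine the Min-Plus Product up to the factor `1 + ε`. The
last scaling, by `1 + 1 / m`, outweighs all rounding. -/
theorem minPlus_of_scaled {n γ m : ℕ} (hn : 1 ≤ n) (hm : 1 ≤ m) (hγ : 4 * (m + 1) ≤ 2 ^ γ) {ε : ℝ}
    (hε1 : ε ≤ 1) (hmε : 4 / m ≤ ε) {A B : Fin n → Fin n → ℝ≥0∞} (hA : ∀ i j, 1 ≤ A i j)
    (hB : ∀ i j, 1 ≤ B i j) {i j : Fin n} {z : ℝ≥0∞}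
    (h1 : ∀ k < m * m, ∀ l, z ≤ max (flScale γ (fl γ (((m : ℝ) + (k + 1 : ℕ)) / m)) (A i l))
      (flScale γ (fl γ (((m : ℝ) + (k + 1 : ℕ)) / (k + 1 : ℕ))) (B l j)))
    (h2 : z = ⊤ ∨ ∃ k < m * m, ∃ l, z = max (flScale γ (fl γ (((m : ℝ) + (k + 1 : ℕ)) / m)) (A i l))
      (flScale γ (fl γ (((m : ℝ) + (k + 1 : ℕ)) / (k + 1 : ℕ))) (B l j))) :
    minPlus A B i j ≤ flScale γ (fl γ (((m : ℝ) + 1) / m)) z ∧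
    flScale γ (fl γ (((m : ℝ) + 1) / m)) z ≤ ENNReal.ofReal (1 + ε) * minPlus A B i j := by
  have hm' : (1 : ℝ) ≤ m := by exact_mod_cast hm
  have hγ' : 4 * ((m : ℝ) + 1) ≤ 2 ^ γ := by exact_mod_cast hγ
  set δ : ℝ := 1 / 2 ^ γ with hδ
  have hδ0 : 0 < δ := by positivity
  have hδm : 4 * δ * (m + 1) ≤ 1 := by
    rw [hδ]
    have : 4 * (1 / 2 ^ γ : ℝ) * (m + 1) = 4 * (m + 1) / 2 ^ γ := by ring
    rw [this, div_le_one (by positivity)]; exact hγ'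
  have hδ1 := one_sub_inv_nonneg γ
  have hlow : ENNReal.ofReal ((1 - δ) ^ 2) * minPlus A B i j ≤ z := by
    rcases h2 with rfl | ⟨k, hk, l, rfl⟩
    · exact le_top
    · refine le_trans ?_ (sum_le_max_flScale hm (Nat.succ_pos k) (hA i l) (hB l j))
      gcongr
      exact iInf_le _ l
  have : Nonempty (Fin n) := ⟨⟨0, hn⟩⟩
  obtain ⟨l, hl⟩ := exists_eq_ciInf_of_finite (f := fun l => A i l + B l j)
  have hl' : minPlus A B i j = A i l + B l j := hl.symm
  have hup : z ≤ ENNReal.ofReal (1 + 1 / m) * minPlus A B i j := by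
    obtain ⟨k, hk, h⟩ := exists_max_flScale_le (γ := γ) hm (hA i l) (hB l j)
    rw [hl']
    exact (h1 k hk l).trans h
  have hS1 : 1 ≤ minPlus A B i j := hl' ▸ (hA i l).trans le_self_add
  by_cases htop : minPlus A B i j = ⊤
  · have hz : z = ⊤ := by
      refine top_le_iff.1 (le_trans (le_of_eq ?_) hlow)
      rw [htop, ENNReal.mul_top]
      rw [Ne, ENNReal.ofReal_eq_zero, not_le]
      have : 0 < 1 - δ := by nlinarith
      positivity
    rw [htop, hz, flScale_top, ENNReal.mul_top]
    · exact ⟨le_rfl, le_rfl⟩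
    · rw [Ne, ENNReal.ofReal_eq_zero, not_le]
      have : 0 < 4 / (m : ℝ) := by positivity
      linarith
  obtain ⟨s, hs, hs'⟩ : ∃ x : ℝ, 0 < x ∧ minPlus A B i j = ENNReal.ofReal x :=
    ⟨_, ENNReal.toReal_pos (by positivity) htop, (ENNReal.ofReal_toReal htop).symm⟩
  rw [hs'] at hlow hup ⊢
  rw [← ENNReal.ofReal_mul (by positivity)] at hlow hup
  have hz : z ≠ ⊤ := ne_top_of_le_ne_top ENNReal.ofReal_ne_top hup
  have hδlt : δ < 1 := by nlinarith
  have hz0 : 0 < z.toReal := by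
    refine ENNReal.toReal_pos ?_ hz
    rintro rfl
    rw [nonpos_iff_eq_zero, ENNReal.ofReal_eq_zero] at hlow
    have : 0 < (1 - δ) ^ 2 * s := by
      have : 0 < 1 - δ := by linarith
      positivity
    linarith
  rw [ENNReal.ofReal_le_iff_le_toReal hz] at hlow
  rw [ENNReal.le_ofReal_iff_toReal_le hz (by positivity)] at hup
  rw [← ENNReal.ofReal_toReal hz, flScale_ofReal _ _ hz0.le, ← ENNReal.ofReal_mul (by
    have : 0 < 4 / (m : ℝ) := by positivity
    linarith)]
  have hmm : ((m : ℝ) + 1) / m = 1 + 1 / m := by field_simp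
  have hu : 0 < ((m : ℝ) + 1) / m := by positivity
  refine ⟨ENNReal.ofReal_le_ofReal ?_, ENNReal.ofReal_le_ofReal ?_⟩
  · refine le_trans ?_ (le_fl_mul_fl hz0 hu)
    have h4 : 1 ≤ ((1 - δ) ^ 2) ^ 2 * (((m : ℝ) + 1) / m) := by
      rw [mul_div_assoc', le_div_iff₀ (by linarith), one_mul]
      have e1 : 1 - 4 * δ ≤ ((1 - δ) ^ 2) ^ 2 := by nlinarith [sq_nonneg δ, sq_nonneg (δ - 1), sq_nonneg (δ ^ 2 - 2 * δ)]
      nlinarith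
    calc s = 1 * s := (one_mul s).symm
      _ ≤ ((1 - δ) ^ 2) ^ 2 * (((m : ℝ) + 1) / m) * s := by gcongr
      _ = (1 - δ) ^ 2 * (((1 - δ) ^ 2 * s) * (((m : ℝ) + 1) / m)) := by ring
      _ ≤ (1 - δ) ^ 2 * (z.toReal * (((m : ℝ) + 1) / m)) := by gcongr
  · refine (fl_mul_fl_le hz0 hu).trans ?_
    rw [hmm]
    have hm1 : 4 * (1 / (m : ℝ)) ≤ ε := by rw [mul_one_div]; exact hmε
    have hm0 : 0 < 1 / (m : ℝ) := by positivity
    calc z.toReal * (1 + 1 / m) ≤ ((1 + 1 / m) * s) * (1 + 1 / m) := by gcongr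
      _ = ((1 + 1 / m) * (1 + 1 / m)) * s := by ring
      _ ≤ (1 + ε) * s := by gcongr; nlinarith

/-! ### Floating-point numbers as integers -/

/-- The integer code of a floating-point number at least `1`: exponent and mantissa, written one
after the other in binary, plus `1`. -/
def Codes (γ : ℕ) (c : ℕ∞) (z : ℝ≥0∞) : Prop :=
  (c = ⊤ ∧ z = ⊤) ∨ ∃ e f : ℕ, f < 2 ^ γ ∧ c = (e * 2 ^ γ + f + 1 : ℕ) ∧
    z = ENNReal.ofReal (fval γ e f)

theorem Codes.le_iff {γ : ℕ} {c c' : ℕ∞} {z z' : ℝ≥0∞} (h : Codes γ c z) (h' : Codes γ c' z') :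
    c ≤ c' ↔ z ≤ z' := by
  rcases h with ⟨rfl, rfl⟩ | ⟨e, f, hf, rfl, rfl⟩ <;>
  rcases h' with ⟨rfl, rfl⟩ | ⟨e', f', hf', rfl, rfl⟩
  · simp
  · simp only [top_le_iff, ENat.natCast_ne_top, ENNReal.ofReal_ne_top]
  · simp
  · rw [Nat.cast_le, ENNReal.ofReal_le_ofReal_iff (fval_pos _ _ _).le, fval_le_fval_iff hf hf',
      add_le_add_iff_right]
    norm_cast

theorem Codes.max {γ : ℕ} {c c' : ℕ∞} {z z' : ℝ≥0∞} (h : Codes γ c z) (h' : Codes γ c' z') :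
    Codes γ (max c c') (max z z') := by
  rcases le_total c c' with hl | hl
  · rw [max_eq_right hl, max_eq_right ((h.le_iff h').1 hl)]; exact h'
  · rw [max_eq_left hl, max_eq_left ((h'.le_iff h).1 hl)]; exact h

theorem Codes.min {γ : ℕ} {c c' : ℕ∞} {z z' : ℝ≥0∞} (h : Codes γ c z) (h' : Codes γ c' z') :
    Codes γ (min c c') (min z z') := by
  rcases le_total c c' with hl | hl
  · rw [min_eq_left hl, min_eq_left ((h.le_iff h').1 hl)]; exact h
  · rw [min_eq_right hl, min_eq_right ((h'.le_iff h).1 hl)]; exact h'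

theorem Codes.minMax {γ n : ℕ} (hn : 1 ≤ n) {A B : Fin n → Fin n → ℕ∞}
    {A' B' : Fin n → Fin n → ℝ≥0∞} (hA : ∀ i j, Codes γ (A i j) (A' i j))
    (hB : ∀ i j, Codes γ (B i j) (B' i j)) (i j : Fin n) :
    Codes γ (_root_.minMax A B i j) (⨅ l, Max.max (A' i l) (B' l j)) := by
  obtain ⟨⟨k, hk⟩, hle⟩ := (minMax_eq_iff hn A B i j _).1 rfl
  have h : (⨅ l, Max.max (A' i l) (B' l j)) = Max.max (A' i k) (B' k j) :=
    le_antisymm (iInf_le _ k) (le_iInf fun l =>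
      (((hA i k).max (hB k j)).le_iff ((hA i l).max (hB l j))).1 (hk ▸ hle l))
  rw [h, hk]
  exact (hA i k).max (hB k j)

end WordRAM

namespace WordRAM

/-! ### Min-Plus Product from Min-Max Product -/

theorem ofInt_eq_ofNat {w : ℕ} {e : ℤ} (he : 0 ≤ e) : BitVec.ofInt w e = BitVec.ofNat w e.toNat := by
  obtain ⟨k, rfl⟩ := Int.eq_ofNat_of_zero_le he
  simp

theorem one_shl {w γ : ℕ} (hγ : γ < 2 ^ w) :
    BitVec.ofNat w 1 <<< BitVec.ofNat w γ = BitVec.ofNat w (2 ^ γ) := by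
  apply BitVec.eq_of_toNat_eq
  rw [BitVec.shiftLeft_eq', BitVec.toNat_shiftLeft, toNat_ofNat_of_lt hγ, BitVec.toNat_ofNat,
    BitVec.toNat_ofNat, Nat.shiftLeft_eq]
  simp

/-- The code, in the sense of `Codes`, of the rounding of `z`. -/
noncomputable def flCode (γ : ℕ) (z : ℝ) : ℕ := (fexp z).toNat * 2 ^ γ + (fman γ z).toNat + 1

theorem codes_flCode {γ : ℕ} {z : ℝ} (hz : 1 ≤ z) :
    Codes γ (flCode γ z : ℕ) (ENNReal.ofReal (fl γ z)) := by
  refine Or.inr ⟨_, _, toNat_fman_lt (by linarith), rfl, ?_⟩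
  rw [Int.toNat_of_nonneg (fexp_nonneg hz)]; rfl

theorem flCode_lt {γ B w : ℕ} {z : ℝ} (hz : 1 ≤ z) (hzB : z < (2 : ℝ) ^ (2 ^ B : ℤ))
    (hB : B + γ + 1 ≤ w) : flCode γ z < 2 ^ w := by
  have h1 := fexp_lt (by linarith) hzB
  have h2 := toNat_fman_lt (γ := γ) (show 0 < z by linarith)
  have h3 : (fexp z).toNat < 2 ^ B := by
    have := fexp_nonneg hz
    zify; rwa [Int.toNat_of_nonneg this]
  have h4 : ((fexp z).toNat + 1) * 2 ^ γ ≤ 2 ^ B * 2 ^ γ := Nat.mul_le_mul_right _ h3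
  have h5 : 2 ^ (B + γ + 1) ≤ 2 ^ w := Nat.pow_le_pow_right (by norm_num) hB
  have h6 : 0 < 2 ^ B * 2 ^ γ := by positivity
  rw [pow_succ, pow_add] at h5
  unfold flCode
  nlinarith

/-- The word computed as the code of a rounded number. -/
theorem word_flCode {w γ : ℕ} {z : ℝ} (hz : 1 ≤ z) :
    BitVec.ofInt w (fexp z) * BitVec.ofNat w (2 ^ γ) + BitVec.ofInt w (fman γ z) +
      BitVec.ofNat w 1 = BitVec.ofNat w (flCode γ z) := by
  rw [ofInt_eq_ofNat (fexp_nonneg hz), ofInt_eq_ofNat (fman_nonneg (by linarith)),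
    ← BitVec.ofNat_mul, ← BitVec.ofNat_add, ← BitVec.ofNat_add]
  rfl

theorem freg_setReg_setReg {w γ B e f g : ℕ} (σ : State w) {z : ℝ} (hef : e ≠ f) (he : g ≠ e)
    (hf : g ≠ f) (hg : σ.reg g = BitVec.ofNat w γ) (hB : B + 1 < w) (hγ : γ ≤ w) (hz : 1 ≤ z)
    (hzB : z < (2 : ℝ) ^ (2 ^ B : ℤ)) :
    ((σ.setReg e (BitVec.ofInt w (fexp z))).setReg f (BitVec.ofInt w (fman γ z))).freg g e f =
      fl γ z := by
  have hγw : γ < 2 ^ w := Nat.lt_two_pow_self.trans_le (Nat.pow_le_pow_right (by norm_num) hγ)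
  simp only [State.freg, State.setReg_reg, hef, he, hf, if_true, if_false, hg,
    toNat_ofNat_of_lt hγw]
  exact (float_result hB hγ hz hzB).2.2

/-- One round of the reduction of Min-Plus Product to Min-Max Product by the program `P`: the entries
of the two matrices are scaled by the floating-point numbers in the registers `25, 26` and `27, 28`
and encoded as integers, their Min-Max Product is computed, and the segments `10, 11` are updated to
the minimum of their previous contents and the product. -/
def scaledRound (P : Prog) : Prog :=
  forUp 40 7
    (.load 42 0 40 ;; .ite (.eq 42 5) (.load 43 1 40 ;; .load 44 2 40 ;;
        .fop .mul 43 44 43 44 25 26 1 ;; .op .mul 43 43 8 ;; .op .add 43 43 44 ;; .op .add 43 43 5 ;;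
        .store 100 40 5 ;; .store 101 40 43) (.store 100 40 10) ;;
     .load 42 3 40 ;; .ite (.eq 42 5) (.load 43 4 40 ;; .load 44 5 40 ;;
        .fop .mul 43 44 43 44 27 28 1 ;; .op .mul 43 43 8 ;; .op .add 43 43 44 ;; .op .add 43 43 5 ;;
        .store 102 40 5 ;; .store 103 40 43) (.store 102 40 10)) ;;
  .op .or 100 0 0 ;;
  P.shift 100 ;;
  forUp 40 7 (.load 42 104 40 ;; .load 43 105 40 ;; .load 44 10 40 ;; .load 45 11 40 ;;
    .ite (.eq 42 5)
      (.ite (.eq 44 5) (.ite (.lt 43 45) (.store 11 40 43) .skip) (.store 10 40 5 ;; .store 11 40 43))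
      .skip)

/-- The cell that `scaledRound` writes for an entry encodes the scaled entry and is a legal input of
Min-Max Product. -/
theorem codes_encode {w γ κ B : ℕ} (hw2 : 2 < 2 ^ w) (hB : B + γ + 1 ≤ w) {t e f t' v' : BitVec w} {a : ℝ}
    (h : GoodCell γ (2 ^ κ) t e f) (ha : 1 ≤ a) (hab : (2 : ℝ) ^ (2 ^ κ : ℤ) * a ≤ 2 ^ (2 ^ B : ℤ))
    (h1 : t = BitVec.ofNat w 1 → t' = BitVec.ofNat w 1 ∧
      v' = BitVec.ofNat w (flCode γ (fval γ e.toInt f.toNat * a)))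
    (h2 : t ≠ BitVec.ofNat w 1 → t' = BitVec.ofNat w 2) :
    Codes γ (intCell t' v') (flScale γ a (floatCell γ t e f)) ∧
      ((t'.toNat = 1 ∧ 1 ≤ v'.toNat) ∨ t'.toNat = 2) := by
  rcases h with ⟨ht, he, he', hf⟩ | ht
  · obtain ⟨rfl, rfl⟩ := h1 ((eq_ofNat_iff _ (by omega)).2 ht)
    have hv1 : 1 ≤ fval γ e.toInt f.toNat := one_le_fval he
    have hz : 1 ≤ fval γ e.toInt f.toNat * a := by nlinarith
    have hzB : fval γ e.toInt f.toNat * a < 2 ^ (2 ^ B : ℤ) := by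
      refine lt_of_lt_of_le ?_ hab
      have := (fval_lt_zpow e.toInt hf).trans_le
        (zpow_le_zpow_right₀ (by norm_num : (1 : ℝ) ≤ 2) (Int.add_one_le_iff.2 he'))
      gcongr
    have hlt := flCode_lt hz hzB hB
    rw [toNat_ofNat_of_lt hlt]
    have one : (BitVec.ofNat w 1).toNat = 1 := toNat_ofNat_of_lt (by omega)
    refine ⟨?_, Or.inl ⟨one, by unfold flCode; omega⟩⟩
    simp only [intCell, floatCell, one, ht, one_ne_zero, if_false, if_true, toNat_ofNat_of_lt hlt]
    rw [flScale_ofReal _ _ (by linarith)]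
    exact codes_flCode hz
  · have := h2 (fun h => by rw [eq_ofNat_iff _ (by omega)] at h; omega)
    subst this
    have two : (BitVec.ofNat w 2).toNat = 2 := toNat_ofNat_of_lt hw2
    refine ⟨Or.inl ?_, Or.inr two⟩
    simp [intCell, floatCell, two, ht, -BitVec.toNat_ofNat]

theorem Codes.ne_zero {γ : ℕ} {z : ℝ≥0∞} (h : Codes γ 0 z) : False := by
  rcases h with ⟨h, -⟩ | ⟨e, f, -, h, -⟩
  · simp at h
  · have := h.symm
    rw [Nat.cast_eq_zero] at this
    omega

/-- Segments `10, 11` hold a running minimum `Z`. The words never overflow, since the exponents of the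
scaled entries have at most `B` bits. -/
theorem scaledRound_runs {P : Prog} {w n γ κ B T : ℕ} {a b : ℝ} (hn : 1 ≤ n) (hw2 : 2 < 2 ^ w)
    (hnw : n * n < 2 ^ w) (hB : B + γ + 1 ≤ w) (ha : 1 ≤ a) (hb : 1 ≤ b)
    (hab : (2 : ℝ) ^ (2 ^ κ : ℤ) * a ≤ 2 ^ (2 ^ B : ℤ))
    (hbb : (2 : ℝ) ^ (2 ^ κ : ℤ) * b ≤ 2 ^ (2 ^ B : ℤ))
    (hP : ∀ τ : State w, τ.reg 0 = BitVec.ofNat w n → τ.IntInput 0 n ∧ τ.IntInput 2 n →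
      Runs P T τ (fun τ' => ∀ i j : Fin n,
        τ'.intMat 4 n i j = minMax (τ.intMat 0 n) (τ.intMat 2 n) i j))
    (σ : State w) (r0 : σ.reg 0 = BitVec.ofNat w n) (r1 : σ.reg 1 = BitVec.ofNat w γ)
    (r5 : σ.reg 5 = BitVec.ofNat w 1) (r7 : σ.reg 7 = BitVec.ofNat w (n * n))
    (r8 : σ.reg 8 = BitVec.ofNat w (2 ^ γ)) (r10 : σ.reg 10 = BitVec.ofNat w 2)
    (ra : σ.freg 1 25 26 = a) (rb : σ.freg 1 27 28 = b)
    (hA : ∀ x < n * n, GoodCell γ (2 ^ κ) (σ.mem 0 (.ofNat w x)) (σ.mem 1 (.ofNat w x))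
      (σ.mem 2 (.ofNat w x)))
    (hA' : ∀ x < n * n, GoodCell γ (2 ^ κ) (σ.mem 3 (.ofNat w x)) (σ.mem 4 (.ofNat w x))
      (σ.mem 5 (.ofNat w x)))
    (Z : Fin n → Fin n → ℝ≥0∞) (hZ : ∀ i j, Codes γ (σ.intMat 10 n i j) (Z i j)) :
    Runs (scaledRound P) (100 + 100 * (n * n) + T) σ (fun σ' => (∀ r < 40, σ'.reg r = σ.reg r) ∧
      (∀ s < 10, σ'.mem s = σ.mem s) ∧
      ∀ i j, Codes γ (σ'.intMat 10 n i j) (min (Z i j) (⨅ l,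
        max (flScale γ a (σ.floatMat γ 0 n i l)) (flScale γ b (σ.floatMat γ 3 n l j))))) := by
  have hγw : γ < 2 ^ w :=
    Nat.lt_two_pow_self.trans_le (Nat.pow_le_pow_right (by norm_num) (by omega))
  refine Runs.andThen (Runs.forEach (S := [100, 101, 102, 103]) rfl (by decide) hnw r7
    (fun x col => (Codes γ (intCell (col 100) (col 101)) (flScale γ a (floatCell γ
      (σ.mem 0 (.ofNat w x)) (σ.mem 1 (.ofNat w x)) (σ.mem 2 (.ofNat w x)))) ∧
      (((col 100).toNat = 1 ∧ 1 ≤ (col 101).toNat) ∨ (col 100).toNat = 2)) ∧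
      (Codes γ (intCell (col 102) (col 103)) (flScale γ b (floatCell γ
      (σ.mem 3 (.ofNat w x)) (σ.mem 4 (.ofNat w x)) (σ.mem 5 (.ofNat w x)))) ∧
      (((col 102).toNat = 1 ∧ 1 ≤ (col 103).toNat) ∨ (col 102).toNat = 2))) ?_) ?_ ?_
  · intro x hx σ₁ hs h40 hcol
    have q1 := (hs.reg 1 (by decide)).trans r1
    have q5 := (hs.reg 5 (by decide)).trans r5
    have q8 := (hs.reg 8 (by decide)).trans r8
    have q10 := (hs.reg 10 (by decide)).trans r10
    have q25 := hs.reg 25 (by decide)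
    have q26 := hs.reg 26 (by decide)
    have q27 := hs.reg 27 (by decide)
    have q28 := hs.reg 28 (by decide)
    have tγ := toNat_ofNat_of_lt hγw
    have g := hA x hx
    have g' := hA' x hx
    simp only [State.freg, r1, tγ] at ra rb
    have n0 := hcol 0
    have n1 := hcol 1
    have n2 := hcol 2
    have n3 := hcol 3
    have n4 := hcol 4
    have n5 := hcol 5
    generalize σ.mem 0 (.ofNat w x) = tA at *
    generalize σ.mem 1 (.ofNat w x) = eA at *
    generalize σ.mem 2 (.ofNat w x) = fA at *
    generalize σ.mem 3 (.ofNat w x) = tB at *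
    generalize σ.mem 4 (.ofNat w x) = eB at *
    generalize σ.mem 5 (.ofNat w x) = fB at *
    have hvA : tA = BitVec.ofNat w 1 → 1 ≤ fval γ eA.toInt fA.toNat * a := fun h => by
      rcases g with ⟨-, h, -⟩ | h'
      · nlinarith [one_le_fval (γ := γ) (f := fA.toNat) h]
      · rw [eq_ofNat_iff _ (by omega)] at h; omega
    have hvB : tB = BitVec.ofNat w 1 → 1 ≤ fval γ eB.toInt fB.toNat * b := fun h => by
      rcases g' with ⟨-, h, -⟩ | h'
      · nlinarith [one_le_fval (γ := γ) (f := fB.toNat) h]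
      · rw [eq_ofNat_iff _ (by omega)] at h; omega
    have wA := fun h => word_flCode (w := w) (γ := γ) (hvA h)
    have wB := fun h => word_flCode (w := w) (γ := γ) (hvB h)
    generalize BitVec.ofNat w (2 ^ γ) = G at *
    refine ⟨codes_encode hw2 hB g ha hab ?_ ?_, codes_encode hw2 hB g' hb hbb ?_ ?_⟩ <;> intro ht
    · by_cases hB1 : tB = BitVec.ofNat w 1 <;>
      simp [Prog.eval, WordOp.eval, FloatOp.eval, State.freg, Test.holds, h40, q1, q5, q8, q10, q25,
        q26, q27, q28, n0, n1, n2, n3, n4, n5, ht, hB1, ra, rb, wA ht, tγ, -BitVec.toNat_ofNat]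
    · by_cases hB1 : tB = BitVec.ofNat w 1 <;>
      simp [Prog.eval, WordOp.eval, FloatOp.eval, State.freg, Test.holds, h40, q1, q5, q8, q10, q27,
        q28, n0, n3, n4, n5, ht, hB1, rb, tγ, -BitVec.toNat_ofNat]
    · by_cases hA1 : tA = BitVec.ofNat w 1 <;>
      simp [Prog.eval, WordOp.eval, FloatOp.eval, State.freg, Test.holds, h40, q1, q5, q8, q10, q25,
        q26, q27, q28, n0, n1, n2, n3, n4, n5, ht, hA1, ra, rb, wB ht, tγ, -BitVec.toNat_ofNat]
    · by_cases hA1 : tA = BitVec.ofNat w 1 <;>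
      simp [Prog.eval, WordOp.eval, FloatOp.eval, State.freg, Test.holds, h40, q1, q5, q8, q10, q25,
        q26, n0, n1, n2, n3, ht, hA1, ra, tγ, -BitVec.toNat_ofNat]
  · simp [Prog.size]; omega
  rintro σ₁ ⟨hs₁, hR₁⟩
  beta_reduce at hR₁
  refine Runs.andThen (Runs.eval (P := .op .or 100 0 0) (Q := fun σ₂ =>
    σ₂ = σ₁.setReg 100 (BitVec.ofNat w n)) trivial ?_) ?_ ?_
  · simp [Prog.eval, WordOp.eval, hs₁.reg 0, r0]
  · simp [Prog.size]; omega
  rintro _ rfl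
  set τ : State w := (σ₁.setReg 100 (BitVec.ofNat w n)).view 100 with hτ
  have hτA : ∀ i j, Codes γ (τ.intMat 0 n i j) (flScale γ a (σ.floatMat γ 0 n i j)) :=
    fun i j => (hR₁ _ (index_lt i j)).1.1
  have hτB : ∀ i j, Codes γ (τ.intMat 2 n i j) (flScale γ b (σ.floatMat γ 3 n i j)) :=
    fun i j => (hR₁ _ (index_lt i j)).2.1
  refine Runs.andThen (Runs.shift (hP τ (by simp [hτ, State.view])
    ⟨fun i j => (hR₁ _ (index_lt i j)).1.2, fun i j => (hR₁ _ (index_lt i j)).2.2⟩)) ?_ ?_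
  · simp [Prog.size]; omega
  rintro σ₃ ⟨hpost, hreg₃, hmem₃⟩
  have hmem : ∀ s < 100, σ₃.mem s = σ.mem s := fun s hs =>
    (hmem₃ s hs).trans (hs₁.mem s (by simp; omega))
  have hreg : ∀ s < 40, σ₃.reg s = σ.reg s := fun s hs =>
    (hreg₃ s (by omega)).trans (by
      rw [State.setReg_reg, if_neg (by omega), hs₁.reg s hs])
  have hC : ∀ i j, Codes γ ((σ₃.view 100).intMat 4 n i j) (⨅ l,
      max (flScale γ a (σ.floatMat γ 0 n i l)) (flScale γ b (σ.floatMat γ 3 n l j))) := by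
    intro i j
    rw [hpost]
    exact Codes.minMax hn hτA hτB i j
  have hnz : ∀ i j, σ.intMat 10 n i j ≠ 0 ∧ (σ₃.view 100).intMat 4 n i j ≠ 0 := fun i j =>
    ⟨fun h => (h ▸ hZ i j).ne_zero, fun h => (h ▸ hC i j).ne_zero⟩
  refine Runs.mono (Runs.forEach (S := [10, 11]) rfl (by decide) (N := n * n) hnw
    ((hreg 7 (by decide)).trans r7)
    (fun x col => intCell (σ.mem 10 (.ofNat w x)) (σ.mem 11 (.ofNat w x)) ≠ 0 ∧
      intCell (σ₃.mem 104 (.ofNat w x)) (σ₃.mem 105 (.ofNat w x)) ≠ 0 →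
      intCell (col 10) (col 11) = min (intCell (σ.mem 10 (.ofNat w x)) (σ.mem 11 (.ofNat w x)))
        (intCell (σ₃.mem 104 (.ofNat w x)) (σ₃.mem 105 (.ofNat w x)))) ?_) ?_ ?_
  · rintro x hx σ₄ hs₄ h40 hcol ⟨hn1, hn2⟩
    have q5 := (hs₄.reg 5 (by decide)).trans ((hreg 5 (by decide)).trans r5)
    have m10 := (hcol 10).trans (congrFun (hmem 10 (by decide)) _)
    have m11 := (hcol 11).trans (congrFun (hmem 11 (by decide)) _)
    have n104 := hcol 104
    have n105 := hcol 105
    generalize σ.mem 10 (.ofNat w x) = tD at *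
    generalize σ.mem 11 (.ofNat w x) = vD at *
    generalize σ₃.mem 104 (.ofNat w x) = tC at *
    generalize σ₃.mem 105 (.ofNat w x) = vC at *
    have one : (BitVec.ofNat w 1).toNat = 1 := toNat_ofNat_of_lt (by omega)
    have htop : ∀ t v : BitVec w, intCell t v ≠ 0 → t ≠ BitVec.ofNat w 1 → intCell t v = ⊤ := by
      intro t v h0 h1
      rw [Ne, eq_ofNat_iff _ (by omega)] at h1
      unfold intCell at h0 ⊢
      split_ifs at h0 ⊢ with h
      · exact absurd rfl h0
      · rfl
    by_cases hC1 : tC = BitVec.ofNat w 1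
    · subst hC1
      by_cases hD1 : tD = BitVec.ofNat w 1
      · subst hD1
        by_cases hlt : vC.toNat < vD.toNat
        · simp [Prog.eval, Test.holds, h40, q5, m10, m11, n104, n105, hlt, intCell, one,
            -BitVec.toNat_ofNat]
          exact hlt.le
        · simp [Prog.eval, Test.holds, h40, q5, m10, m11, n104, n105, hlt, intCell, one,
            -BitVec.toNat_ofNat]
          exact not_lt.1 hlt
      · simp [Prog.eval, Test.holds, h40, q5, m10, m11, n104, n105, hD1, htop tD vD hn1 hD1]
    · simp [Prog.eval, Test.holds, h40, q5, m10, m11, n104, n105, hC1, htop tC vC hn2 hC1]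
  · simp [Prog.size]; omega
  rintro σ₄ ⟨hs₄, hR₄⟩
  refine ⟨fun r hr => (hs₄.reg r hr).trans (hreg r hr), fun s hs => ?_, fun i j => ?_⟩
  · rw [hs₄.mem s (by simp; omega), hmem s (by omega)]
  · have := hR₄ _ (index_lt i j) (hnz i j)
    rw [State.intMat_eq]
    change Codes γ (intCell (σ₄.mem 10 _) (σ₄.mem 11 _)) _
    rw [this]
    exact (hZ i j).min (hC i j)

end WordRAM

namespace WordRAM

theorem State.freg_congr {w : ℕ} {σ σ' : State w} {g e f : ℕ} (hg : σ'.reg g = σ.reg g)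
    (he : σ'.reg e = σ.reg e) (hf : σ'.reg f = σ.reg f) : σ'.freg g e f = σ.freg g e f := by
  simp only [State.freg, hg, he, hf]

theorem freg_one {w g e f : ℕ} {σ : State w} (he : σ.reg e = BitVec.ofNat w 0)
    (hf : σ.reg f = BitVec.ofNat w 0) : σ.freg g e f = 1 := by
  simp [State.freg, fval, he, hf]

/-- A floating-point operation whose result is in range. -/
theorem Runs.fop {w γ B e f e₁ f₁ e₂ f₂ g : ℕ} {σ : State w} {o : FloatOp} {x y : ℝ} (hef : e ≠ f)
    (he : g ≠ e) (hf : g ≠ f) (hg : σ.reg g = BitVec.ofNat w γ) (hB : B + 1 < w) (hγ : γ ≤ w)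
    (hx : σ.freg g e₁ f₁ = x) (hy : σ.freg g e₂ f₂ = y) (hz : 1 ≤ o.eval x y)
    (hzB : o.eval x y < (2 : ℝ) ^ (2 ^ B : ℤ)) :
    Runs (.fop o e f e₁ f₁ e₂ f₂ g) 1 σ (fun σ' => σ'.freg g e f = fl γ (o.eval x y) ∧
      (∀ r, r ≠ e → r ≠ f → σ'.reg r = σ.reg r) ∧ σ'.mem = σ.mem) := by
  have hγw : γ < 2 ^ w := Nat.lt_two_pow_self.trans_le (Nat.pow_le_pow_right (by norm_num) hγ)
  refine Runs.eval (P := .fop o e f e₁ f₁ e₂ f₂ g) trivial ?_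
  simp only [Prog.eval, hx, hy, hg, toNat_ofNat_of_lt hγw]
  refine ⟨freg_setReg_setReg σ hef he hf hg hB hγ hz hzB, fun r h1 h2 => ?_, rfl⟩
  simp [h1, h2]

/-- Min-Plus Product by means of a program `P` for Min-Max Product, called once for each of the
`m ^ 2` ratios `k / m` with `m = 4 (⌊q / p⌋ + 1)`. The registers `13, 14` hold `m`, and `21, 22` the
current `k`, as floating-point numbers; `16, 17` hold `1` and `29, 30` the final factor. -/
def minPlusByMinMax (P : Prog) : Prog :=
  (.const 5 1 ;; .op .div 6 3 2 ;; .op .add 6 6 5 ;; .const 4 4 ;; .op .mul 6 6 4 ;;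
    .op .mul 7 0 0 ;; .op .shl 8 5 1 ;; .const 10 2 ;; .op .mul 12 6 6 ;; .op .sub 4 6 5 ;;
    .const 16 0 ;; .const 17 0 ;; .const 13 0 ;; .const 14 0 ;; .const 21 0 ;; .const 22 0) ;;
  forUp 40 7 (.store 10 40 10) ;;
  forUp 20 4 (.fop .add 13 14 13 14 16 17 1) ;;
  forUp 20 12 (.fop .add 23 24 13 14 21 22 1 ;; .fop .div 25 26 23 24 13 14 1 ;;
    .fop .div 27 28 23 24 21 22 1 ;; scaledRound P ;; .fop .add 21 22 21 22 16 17 1) ;;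
  .fop .add 29 30 13 14 16 17 1 ;; .fop .div 29 30 29 30 13 14 1 ;;
  forUp 40 7 (.load 42 10 40 ;; .ite (.eq 42 5) (.load 43 11 40 ;; .op .sub 43 43 5 ;;
      .op .mod 44 43 8 ;; .op .div 43 43 8 ;; .fop .mul 43 44 43 44 29 30 1 ;;
      .store 6 40 5 ;; .store 7 40 43 ;; .store 8 40 44) (.store 6 40 10))

/-- Decoding of an integer code, followed by a multiplication by `u`. -/
theorem codes_decode {w γ : ℕ} (hγ : 3 ≤ γ) (hγw : γ < w) {t v t' e' f' : BitVec w}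
    {u : ℝ} (hu1 : 1 ≤ u) (hu2 : u ≤ 2) {z : ℝ≥0∞} (hz : Codes γ (intCell t v) z)
    (h1 : ∀ e f : ℕ, t = BitVec.ofNat w 1 → v = BitVec.ofNat w (e * 2 ^ γ + f + 1) →
      f < 2 ^ γ → e * 2 ^ γ + f + 1 < 2 ^ w → e < 2 ^ (w - 3) → t' = BitVec.ofNat w 1 ∧
      e' = BitVec.ofInt w (fexp (fval γ e f * u)) ∧ f' = BitVec.ofInt w (fman γ (fval γ e f * u)))
    (h2 : t ≠ BitVec.ofNat w 1 → t' = BitVec.ofNat w 2) :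
    floatCell γ t' e' f' = flScale γ u z ∧ (t'.toNat = 1 → f'.toNat < 2 ^ γ) := by
  have hw4 : 2 ^ 2 ≤ 2 ^ w := Nat.pow_le_pow_right (by norm_num) (by omega)
  have one : (BitVec.ofNat w 1).toNat = 1 := toNat_ofNat_of_lt (by omega)
  have two : (BitVec.ofNat w 2).toNat = 2 := toNat_ofNat_of_lt (by omega)
  by_cases ht : t = BitVec.ofNat w 1
  · subst ht
    have hv : intCell (BitVec.ofNat w 1) v = (v.toNat : ℕ∞) := by
      simp [intCell, one, -BitVec.toNat_ofNat]
    rw [hv] at hz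
    rcases hz with ⟨h, -⟩ | ⟨e, f, hf, hc, rfl⟩
    · exact absurd h (ENat.natCast_ne_top _)
    have hc' : v.toNat = e * 2 ^ γ + f + 1 := by exact_mod_cast hc
    have hlt : e * 2 ^ γ + f + 1 < 2 ^ w := hc' ▸ v.isLt
    have he : e < 2 ^ (w - 3) := by
      have e1 : e * 2 ^ 3 ≤ e * 2 ^ γ :=
        Nat.mul_le_mul_left _ (Nat.pow_le_pow_right (by norm_num) hγ)
      have e2 : 2 ^ (w - 3) * 2 ^ 3 = 2 ^ w := by rw [← pow_add]; congr 1; omega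
      omega
    obtain ⟨rfl, rfl, rfl⟩ := h1 e f rfl ((eq_ofNat_iff _ hlt).2 hc') hf hlt he
    have hv1 : 1 ≤ fval γ e f := one_le_fval (by positivity)
    have hB : fval γ e f * u < (2 : ℝ) ^ (2 ^ (w - 2) : ℤ) := by
      have b1 := fval_lt_zpow (e : ℤ) hf
      have b2 : ((e + 2 : ℕ) : ℤ) ≤ 2 ^ (w - 2) := by
        have e3 : 2 ^ (w - 2) = 2 ^ (w - 3) * 2 := by rw [← pow_succ]; congr 1; omega
        have e4 : 1 ≤ 2 ^ (w - 3) := Nat.one_le_two_pow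
        have e5 : e + 2 ≤ 2 ^ (w - 2) := by omega
        exact_mod_cast e5
      calc fval γ e f * u < 2 ^ ((e : ℤ) + 1) * 2 := by
            have := fval_pos γ e f
            nlinarith
        _ = 2 ^ (((e + 2 : ℕ) : ℤ)) := by
            rw [show ((e + 2 : ℕ) : ℤ) = (e : ℤ) + 1 + 1 by push_cast; ring]
            rw [zpow_add_one₀ (by norm_num) ((e : ℤ) + 1)]
        _ ≤ _ := zpow_le_zpow_right₀ (by norm_num) b2
    obtain ⟨-, f2, f3⟩ := float_result (γ := γ) (w := w) (B := w - 2) (by omega) hγw.le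
      (show 1 ≤ fval γ e f * u by nlinarith) hB
    refine ⟨?_, fun _ => f2⟩
    rw [flScale_ofReal _ _ (by linarith)]
    simp only [floatCell, one, one_ne_zero, if_false, if_true, f3]
  · obtain rfl := h2 ht
    refine ⟨?_, fun h => absurd h (by rw [two]; norm_num)⟩
    rcases hz with ⟨-, rfl⟩ | ⟨e, f, hf, hc, rfl⟩
    · simp [floatCell, two, -BitVec.toNat_ofNat]
    · rw [eq_ofNat_iff _ (by omega)] at ht
      unfold intCell at hc
      split_ifs at hc with h0
      · have := hc.symm; rw [Nat.cast_eq_zero] at this; omega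
      · exact absurd hc.symm (ENat.natCast_ne_top _)

/-- Correctness of the reduction. The machine does not convert words to floating-point numbers, so `m` and the
numerators `k + 1 ≤ m ^ 2` of the ratios are obtained by repeated addition of `1`; these sums are exact
by `fl_natCast`. -/
theorem minPlusByMinMax_runs {P : Prog} {w n p q γ κ m T : ℕ} (hn : 1 ≤ n) (hp : 0 < p)
    (hpq : 10 * p < q) (hq : q < 2 ^ w) (hm : m = 4 * (q / p + 1)) (hnγ : n * n < 2 ^ γ)
    (hmγ : (m + 1) * (m + 1) < 2 ^ γ) (hw : κ + γ + γ + 1 ≤ w)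
    (hP : ∀ τ : State w, τ.reg 0 = BitVec.ofNat w n → τ.IntInput 0 n ∧ τ.IntInput 2 n →
      Runs P T τ (fun τ' => ∀ i j : Fin n,
        τ'.intMat 4 n i j = minMax (τ.intMat 0 n) (τ.intMat 2 n) i j))
    (σ : State w) (r0 : σ.reg 0 = BitVec.ofNat w n) (r1 : σ.reg 1 = BitVec.ofNat w γ)
    (r2 : σ.reg 2 = BitVec.ofNat w p) (r3 : σ.reg 3 = BitVec.ofNat w q)
    (hA : σ.FloatInput γ κ 0 n) (hA' : σ.FloatInput γ κ 3 n) :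
    Runs (minPlusByMinMax P)
      (100 + 100 * (n * n) + 4 * m + m * m * (104 + 100 * (n * n) + T + 3)) σ
      (fun σ₁ => σ₁.FloatOutput γ 6 n ∧ ∀ i j : Fin n,
        minPlus (σ.floatMat γ 0 n) (σ.floatMat γ 3 n) i j ≤ σ₁.floatMat γ 6 n i j ∧
        σ₁.floatMat γ 6 n i j ≤
          (1 + (p : ℝ≥0∞) / q) * minPlus (σ.floatMat γ 0 n) (σ.floatMat γ 3 n) i j) := by
  have hm4 : 4 ≤ m := hm ▸ Nat.le_mul_of_pos_right 4 (Nat.succ_pos _)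
  have hmm : m ≤ m * m := Nat.le_mul_of_pos_left m (by omega)
  have hexp : (m + 1) * (m + 1) = m * m + 2 * m + 1 := by ring
  have hγ3 : 3 ≤ γ := by
    by_contra hc
    have : 2 ^ γ ≤ 2 ^ 2 := Nat.pow_le_pow_right (by norm_num) (by omega)
    omega
  have hGw : 2 ^ γ ≤ 2 ^ (w - 1) := Nat.pow_le_pow_right (by norm_num) (by omega)
  have hGw' : 2 ^ γ < 2 ^ w := hGw.trans_lt (Nat.pow_lt_pow_right (by norm_num) (by omega))
  have hw2 : 2 < 2 ^ w := by omega
  have hγw : γ < 2 ^ w := Nat.lt_two_pow_self.trans hGw'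
  have hm' : (1 : ℝ) ≤ m := by exact_mod_cast (by omega : 1 ≤ m)
  have hmγ' : (m : ℝ) * m + 2 * m + 1 < 2 ^ γ := by exact_mod_cast hexp ▸ hmγ
  -- numbers below `2 ^ γ` are in the range of the exponents, also after scaling an input
  have hrange : ∀ {a : ℝ}, a ≤ 2 ^ γ → (2 : ℝ) ^ (2 ^ κ : ℤ) * a ≤ 2 ^ (2 ^ (κ + γ) : ℤ) := by
    intro a ha
    have b1 : 2 ^ κ + γ ≤ 2 ^ (κ + γ) := by
      have c1 : γ + 1 ≤ 2 ^ γ := Nat.lt_two_pow_self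
      have c2 : 2 ^ κ * (γ + 1) ≤ 2 ^ κ * 2 ^ γ := Nat.mul_le_mul_left _ c1
      have c3 : 1 * γ ≤ 2 ^ κ * γ := Nat.mul_le_mul_right _ Nat.one_le_two_pow
      rw [pow_add, mul_add] at *
      omega
    have b2 : ((2 : ℤ) ^ κ + (γ : ℤ)) ≤ 2 ^ (κ + γ) := by exact_mod_cast b1
    calc (2 : ℝ) ^ (2 ^ κ : ℤ) * a ≤ (2 : ℝ) ^ (2 ^ κ : ℤ) * 2 ^ (γ : ℤ) := by
          rw [zpow_natCast]; gcongr
      _ = 2 ^ ((2 : ℤ) ^ κ + (γ : ℤ)) := (zpow_add₀ (by norm_num) _ _).symm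
      _ ≤ _ := zpow_le_zpow_right₀ (by norm_num) b2
  have hlt : ∀ {a : ℝ}, 1 ≤ a → a ≤ 2 ^ γ → a < 2 ^ (2 ^ (κ + γ) : ℤ) := by
    intro a h1 h2
    refine lt_of_lt_of_le ?_ (hrange h2)
    have : (1 : ℝ) < 2 ^ (2 ^ κ : ℤ) := one_lt_zpow₀ (by norm_num) (by positivity)
    nlinarith
  have hfl : ∀ {a : ℝ}, 1 ≤ a → a ≤ 2 ^ γ → 1 ≤ fl γ a ∧ fl γ a ≤ 2 ^ γ := fun h1 h2 =>
    ⟨one_le_fl h1, (fl_le (by linarith)).trans h2⟩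
  refine Runs.andThen (Runs.eval (Q := fun σ₁ => (∀ r < 4, σ₁.reg r = σ.reg r) ∧
    σ₁.reg 5 = BitVec.ofNat w 1 ∧ σ₁.reg 7 = BitVec.ofNat w (n * n) ∧
    σ₁.reg 8 = BitVec.ofNat w (2 ^ γ) ∧ σ₁.reg 10 = BitVec.ofNat w 2 ∧
    σ₁.reg 12 = BitVec.ofNat w (m * m) ∧ σ₁.reg 4 = BitVec.ofNat w (m - 1) ∧
    σ₁.reg 16 = BitVec.ofNat w 0 ∧ σ₁.reg 17 = BitVec.ofNat w 0 ∧
    σ₁.reg 13 = BitVec.ofNat w 0 ∧ σ₁.reg 14 = BitVec.ofNat w 0 ∧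
    σ₁.reg 21 = BitVec.ofNat w 0 ∧ σ₁.reg 22 = BitVec.ofNat w 0 ∧
    σ₁.mem = σ.mem) (by simp [Prog.LoopFree]) ?_) ?_ ?_
  · refine ⟨fun r hr => ?_, ?_⟩
    · simp only [Prog.eval, State.setReg_reg]
      iterate 16 rw [if_neg (by omega)]
    · have d := ofNat_div hq (show p < 2 ^ w by omega)
      have e1 := one_shl hγw
      have e2 := ofNat_sub (w := w) (show 1 ≤ m by omega)
      rw [hm, mul_comm] at e2
      rw [hm, mul_comm 4]
      generalize BitVec.ofNat w (2 ^ γ) = G at *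
      simp [Prog.eval, WordOp.eval, r0, r1, r2, r3, d, e1, e2,
        ← BitVec.ofNat_mul, ← BitVec.ofNat_add]
  · simp [Prog.size]; omega
  rintro σ₁ ⟨hr₁, r5, r7, r8, r10, r12, r4, r16, r17, r13, r14, r21, r22, m1⟩
  have v0 := (hr₁ 0 (by decide)).trans r0
  have v1 := (hr₁ 1 (by decide)).trans r1
  refine Runs.andThen (Runs.forEach (S := [10]) rfl (by decide) (N := n * n) (by omega) r7
    (fun x col => col 10 = BitVec.ofNat w 2) ?_) ?_ ?_
  · intro x hx σ' hs h40 hcol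
    simp [Prog.eval, h40, (hs.reg 10 (by decide)).trans r10]
  · simp [Prog.size]; omega
  rintro σ₂ ⟨hs₂, hR₂⟩
  beta_reduce at hR₂
  -- the floating-point number `m`
  refine Runs.andThen (Runs.forUp (T := 1) (i := 20) (lim := 4) (by decide) (N := m - 1) (by omega)
    (fun k σ' => k ≤ m - 1 ∧ σ'.reg 20 = BitVec.ofNat w k ∧
      (∀ r < 40, r ≠ 13 → r ≠ 14 → r ≠ 20 → σ'.reg r = σ₁.reg r) ∧ σ'.mem = σ₂.mem ∧
      σ'.freg 1 13 14 = (k + 1 : ℕ))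
    (fun k σ' h => ⟨h.2.1, (h.2.2.1 4 (by decide) (by decide) (by decide) (by decide)).trans r4⟩)
    ?_ ?_) ?_ ?_
  · rintro k hk σ' ⟨-, h20, hr, hmem, hf⟩
    have w16 := (hr 16 (by decide) (by decide) (by decide) (by decide)).trans r16
    have w17 := (hr 17 (by decide) (by decide) (by decide) (by decide)).trans r17
    have hz : FloatOp.eval .add ((k + 1 : ℕ) : ℝ) 1 = ((k + 1 + 1 : ℕ) : ℝ) := by
      simp [FloatOp.eval]
    have hz1 : (1 : ℝ) ≤ ((k + 1 + 1 : ℕ) : ℝ) := by exact_mod_cast (by omega : 1 ≤ k + 1 + 1)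
    have hz2 : k + 1 + 1 < 2 ^ γ := by omega
    have hz2' : ((k + 1 + 1 : ℕ) : ℝ) ≤ 2 ^ γ := by exact_mod_cast hz2.le
    refine Runs.mono (Runs.fop (B := κ + γ) (γ := γ) (by decide) (by decide) (by decide)
      ((hr 1 (by decide) (by decide) (by decide) (by decide)).trans v1) (by omega) (by omega)
      hf (freg_one w16 w17) (hz ▸ hz1) (hz ▸ hlt hz1 hz2')) le_rfl ?_
    rintro σ'' ⟨f1, f2, f3⟩
    refine ⟨by omega, ?_, fun r hr' a b c => ?_, f3.trans hmem, ?_⟩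
    · simp only [State.setReg_reg, if_true, f2 20 (by decide) (by decide), h20]
      exact (BitVec.ofNat_add k 1).symm
    · simp only [State.setReg_reg]
      rw [if_neg c, if_neg (by omega), f2 r a b, hr r hr' a b c]
    · rw [hz, fl_natCast (by omega) hz2] at f1
      rw [← f1]
      exact State.freg_congr (by simp) (by simp) (by simp)
  · refine ⟨by omega, by simp, fun r hr a b c => ?_, rfl, ?_⟩
    · simp only [State.setReg_reg]
      rw [if_neg c, hs₂.reg r hr]
    · rw [freg_one] <;> simp [hs₂.reg, r13, r14]
  · simp [Prog.size]; omega
  rintro σ₃ ⟨-, -, hr₃, m3, hf₃⟩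
  rw [show m - 1 + 1 = m by omega] at hf₃
  have u : ∀ r < 20, r ≠ 13 → r ≠ 14 → σ₃.reg r = σ₁.reg r := fun r hr a b =>
    hr₃ r (by omega) a b (by omega)
  have hmem₃ : ∀ s < 10, σ₃.mem s = σ.mem s := fun s hs => by
    rw [m3, hs₂.mem s (by simp; omega), m1]
  have hA₀ : ∀ x < n * n, GoodCell γ (2 ^ κ) (σ.mem 0 (.ofNat w x)) (σ.mem 1 (.ofNat w x))
      (σ.mem 2 (.ofNat w x)) := forall_index fun i j => hA i j
  have hA₀' : ∀ x < n * n, GoodCell γ (2 ^ κ) (σ.mem 3 (.ofNat w x)) (σ.mem 4 (.ofNat w x))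
      (σ.mem 5 (.ofNat w x)) := forall_index fun i j => hA' i j
  set term : ℕ → Fin n → Fin n → Fin n → ℝ≥0∞ := fun k i j l =>
    max (flScale γ (fl γ (((m : ℝ) + (k + 1 : ℕ)) / m)) (σ.floatMat γ 0 n i l))
      (flScale γ (fl γ (((m : ℝ) + (k + 1 : ℕ)) / (k + 1 : ℕ))) (σ.floatMat γ 3 n l j)) with hterm
  -- after `k` rounds the segments `10, 11` hold the minimum over the first `k` ratios
  refine Runs.andThen (Runs.forUp (T := 104 + 100 * (n * n) + T) (i := 20) (lim := 12) (by decide)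
    (N := m * m) (by omega)
    (fun k σ' => k ≤ m * m ∧ σ'.reg 20 = BitVec.ofNat w k ∧
      (∀ r < 20, σ'.reg r = σ₃.reg r) ∧ (∀ s < 10, σ'.mem s = σ.mem s) ∧
      σ'.freg 1 21 22 = (k + 1 : ℕ) ∧ ∃ Z : Fin n → Fin n → ℝ≥0∞,
        (∀ i j, Codes γ (σ'.intMat 10 n i j) (Z i j)) ∧ ∀ i j,
        (∀ k' < k, ∀ l, Z i j ≤ term k' i j l) ∧
        (Z i j = ⊤ ∨ ∃ k' < k, ∃ l, Z i j = term k' i j l))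
    (fun k σ' h => ⟨h.2.1, (h.2.2.1 12 (by decide)).trans
      ((u 12 (by decide) (by decide) (by decide)).trans r12)⟩) ?_ ?_) ?_ ?_
  · rintro k hk σ' ⟨-, h20, hr, hmem, hf, Z, hZ, hZt⟩
    have w1 := (hr 1 (by decide)).trans ((u 1 (by decide) (by decide) (by decide)).trans v1)
    have w16 := (hr 16 (by decide)).trans ((u 16 (by decide) (by decide) (by decide)).trans r16)
    have w17 := (hr 17 (by decide)).trans ((u 17 (by decide) (by decide) (by decide)).trans r17)
    have w13 : σ'.freg 1 13 14 = (m : ℝ) := (State.freg_congr (hr 1 (by decide))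
      (hr 13 (by decide)) (hr 14 (by decide))).trans hf₃
    have hk0 : (1 : ℝ) ≤ (k + 1 : ℕ) := by exact_mod_cast (by omega : 1 ≤ k + 1)
    have hkm : ((k + 1 : ℕ) : ℝ) ≤ m * m := by exact_mod_cast hk
    have hs1 : m + (k + 1) < 2 ^ γ := by omega
    have hs2 : (m : ℝ) + (k + 1 : ℕ) ≤ 2 ^ γ := by exact_mod_cast hs1.le
    refine Runs.andThen (Runs.fop (B := κ + γ) (γ := γ) (by decide) (by decide) (by decide)
      w1 (by omega) (by omega) w13 hf (by simp only [FloatOp.eval]; linarith)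
      (hlt (by simp only [FloatOp.eval]; linarith) hs2)) ?_ ?_
    · omega
    rintro τ₁ ⟨f1, g1, n1⟩
    have f1 : τ₁.freg 1 23 24 = (m : ℝ) + (k + 1 : ℕ) := by
      rw [f1]
      simp only [FloatOp.eval]
      exact_mod_cast fl_natCast (γ := γ) (k := m + (k + 1)) (by omega) hs1
    have a1 : 1 ≤ ((m : ℝ) + (k + 1 : ℕ)) / m := by rw [one_le_div (by linarith)]; linarith
    have a2 : ((m : ℝ) + (k + 1 : ℕ)) / m ≤ 2 ^ γ := (div_le_self (by linarith) hm').trans hs2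
    refine Runs.andThen (Runs.fop (B := κ + γ) (γ := γ) (by decide) (by decide) (by decide)
      ((g1 1 (by decide) (by decide)).trans w1) (by omega) (by omega) f1
      ((State.freg_congr (g1 1 (by decide) (by decide)) (g1 13 (by decide) (by decide))
        (g1 14 (by decide) (by decide))).trans w13) a1 (hlt a1 a2)) ?_ ?_
    · omega
    rintro τ₂ ⟨f2, g2, n2⟩
    have b1 : 1 ≤ ((m : ℝ) + (k + 1 : ℕ)) / (k + 1 : ℕ) := by
      rw [one_le_div (by linarith)]; linarith
    have b2 : ((m : ℝ) + (k + 1 : ℕ)) / (k + 1 : ℕ) ≤ 2 ^ γ :=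
      (div_le_self (by linarith) hk0).trans hs2
    have g12 : ∀ r, r ≠ 23 → r ≠ 24 → r ≠ 25 → r ≠ 26 → τ₂.reg r = σ'.reg r := fun r a b c d =>
      (g2 r c d).trans (g1 r a b)
    refine Runs.andThen (Runs.fop (B := κ + γ) (γ := γ) (by decide) (by decide) (by decide)
      ((g12 1 (by decide) (by decide) (by decide) (by decide)).trans w1) (by omega) (by omega)
      ((State.freg_congr (g2 1 (by decide) (by decide)) (g2 23 (by decide) (by decide))
        (g2 24 (by decide) (by decide))).trans f1)
      ((State.freg_congr (g12 1 (by decide) (by decide) (by decide) (by decide))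
        (g12 21 (by decide) (by decide) (by decide) (by decide))
        (g12 22 (by decide) (by decide) (by decide) (by decide))).trans hf) b1 (hlt b1 b2)) ?_ ?_
    · omega
    rintro τ₃ ⟨f3, g3, n3⟩
    have g : ∀ r, r ≠ 23 → r ≠ 24 → r ≠ 25 → r ≠ 26 → r ≠ 27 → r ≠ 28 → τ₃.reg r = σ'.reg r :=
      fun r a b c d e f => (g3 r e f).trans (g12 r a b c d)
    have hmemτ : τ₃.mem = σ'.mem := n3.trans (n2.trans n1)
    have gv : ∀ r < 20, r ≠ 13 → r ≠ 14 → τ₃.reg r = σ₁.reg r := fun r hr' a b =>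
      (g r (by omega) (by omega) (by omega) (by omega) (by omega) (by omega)).trans
        ((hr r hr').trans (u r hr' a b))
    have f2' : τ₃.freg 1 25 26 = fl γ (((m : ℝ) + (k + 1 : ℕ)) / m) :=
      (State.freg_congr (g3 1 (by decide) (by decide)) (g3 25 (by decide) (by decide))
        (g3 26 (by decide) (by decide))).trans f2
    have hmemτ' : ∀ s < 10, τ₃.mem s = σ.mem s := fun s hs => by rw [hmemτ, hmem s hs]
    have hfm : ∀ s, s + 2 < 10 → τ₃.floatMat γ s n = σ.floatMat γ s n := fun s hs => by
      funext i j
      simp only [State.floatMat_eq, State.cell, hmemτ' s (by omega), hmemτ' (s + 1) (by omega),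
        hmemτ' (s + 2) hs]
    refine Runs.andThen (scaledRound_runs (κ := κ) (B := κ + γ) hn hw2 (by omega) (by omega)
      (hfl a1 a2).1 (hfl b1 b2).1 (hrange (hfl a1 a2).2) (hrange (hfl b1 b2).2) hP τ₃
      ((gv 0 (by decide) (by decide) (by decide)).trans v0)
      ((gv 1 (by decide) (by decide) (by decide)).trans v1)
      ((gv 5 (by decide) (by decide) (by decide)).trans r5)
      ((gv 7 (by decide) (by decide) (by decide)).trans r7)
      ((gv 8 (by decide) (by decide) (by decide)).trans r8)
      ((gv 10 (by decide) (by decide) (by decide)).trans r10) f2' f3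
      (by simpa only [hmemτ' 0 (by decide), hmemτ' 1 (by decide), hmemτ' 2 (by decide)] using hA₀)
      (by simpa only [hmemτ' 3 (by decide), hmemτ' 4 (by decide), hmemτ' 5 (by decide)] using hA₀')
      Z (by
        have : ∀ i j, τ₃.intMat 10 n i j = σ'.intMat 10 n i j := fun i j => by
          simp only [State.intMat_eq, State.cell, hmemτ]
        simpa only [this] using hZ)) ?_ ?_
    · omega
    rintro τ₄ ⟨g4, n4, c4⟩
    rw [hfm 0 (by decide), hfm 3 (by decide)] at c4
    have gg : ∀ r, r < 40 → r ≠ 23 → r ≠ 24 → r ≠ 25 → r ≠ 26 → r ≠ 27 → r ≠ 28 →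
        τ₄.reg r = σ'.reg r := fun r hr' a b c d e f => (g4 r hr').trans (g r a b c d e f)
    have hz : FloatOp.eval .add ((k + 1 : ℕ) : ℝ) 1 = ((k + 1 + 1 : ℕ) : ℝ) := by
      simp [FloatOp.eval]
    have hz1 : (1 : ℝ) ≤ ((k + 1 + 1 : ℕ) : ℝ) := by exact_mod_cast (by omega : 1 ≤ k + 1 + 1)
    have hz2 : k + 1 + 1 < 2 ^ γ := by omega
    have hz2' : ((k + 1 + 1 : ℕ) : ℝ) ≤ 2 ^ γ := by exact_mod_cast hz2.le
    refine Runs.mono (Runs.fop (B := κ + γ) (γ := γ) (by decide) (by decide) (by decide)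
      ((gg 1 (by decide) (by decide) (by decide) (by decide) (by decide) (by decide)
        (by decide)).trans w1) (by omega) (by omega)
      ((State.freg_congr
        (gg 1 (by decide) (by decide) (by decide) (by decide) (by decide) (by decide) (by decide))
        (gg 21 (by decide) (by decide) (by decide) (by decide) (by decide) (by decide) (by decide))
        (gg 22 (by decide) (by decide) (by decide) (by decide) (by decide) (by decide)
          (by decide))).trans hf)
      (freg_one ((gg 16 (by decide) (by decide) (by decide) (by decide) (by decide) (by decide)
          (by decide)).trans w16)
        ((gg 17 (by decide) (by decide) (by decide) (by decide) (by decide) (by decide)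
          (by decide)).trans w17))
      (hz ▸ hz1) (hz ▸ hlt hz1 hz2')) ?_ ?_
    · omega
    rintro τ₅ ⟨f5, g5, n5⟩
    have c5 : ∀ i j, ((τ₅.setReg 41 (BitVec.ofNat w 1)).setReg 20
        (τ₅.reg 20 + BitVec.ofNat w 1)).intMat 10 n i j = τ₄.intMat 10 n i j := fun i j => by
      simp only [State.intMat_eq, State.cell, State.setReg_mem, n5]
    refine ⟨hk, ?_, fun r hr' => ?_, fun s hs => ?_, ?_, _, fun i j => c5 i j ▸ c4 i j, fun i j => ⟨fun k' hk' l => ?_, ?_⟩⟩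
    · simp only [State.setReg_reg, if_true]
      rw [g5 20 (by decide) (by decide), gg 20 (by decide) (by decide) (by decide) (by decide)
        (by decide) (by decide) (by decide), h20]
      exact (BitVec.ofNat_add k 1).symm
    · simp only [State.setReg_reg]
      rw [if_neg (by omega), if_neg (by omega), g5 r (by omega) (by omega),
        gg r (by omega) (by omega) (by omega) (by omega) (by omega) (by omega) (by omega), hr r hr']
    · change τ₅.mem s = σ.mem s
      rw [n5, n4 s hs, hmemτ' s hs]
    · rw [hz, fl_natCast (by omega) hz2] at f5
      rw [← f5]
      exact State.freg_congr (by simp) (by simp) (by simp)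
    · rcases Nat.lt_succ_iff_lt_or_eq.1 hk' with h | rfl
      · exact (min_le_left _ _).trans ((hZt i j).1 k' h l)
      · exact (min_le_right _ _).trans (iInf_le _ l)
    · have : Nonempty (Fin n) := ⟨⟨0, hn⟩⟩
      obtain ⟨l, hl⟩ := exists_eq_ciInf_of_finite (f := fun l => term k i j l)
      rcases min_choice (Z i j) (⨅ l, term k i j l) with h | h
      · rw [hterm] at h
        beta_reduce at h
        rw [h]
        rcases (hZt i j).2 with h' | ⟨k', hk', l', h'⟩
        · exact Or.inl h'
        · exact Or.inr ⟨k', by omega, l', h'⟩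
      · exact Or.inr ⟨k, by omega, l, h.trans hl.symm⟩
  · refine ⟨by omega, by simp, fun r hr => ?_, hmem₃, ?_, fun _ _ => ⊤, fun i j => Or.inl ⟨?_, rfl⟩,
      fun i j => ⟨fun k' hk' => absurd hk' (by omega), Or.inl rfl⟩⟩
    · simp only [State.setReg_reg]
      rw [if_neg (by omega)]
    · rw [freg_one] <;> simp [hr₃, r21, r22]
    · have h2 : σ₂.mem 10 (BitVec.ofNat w (i * n + j)) = BitVec.ofNat w 2 := hR₂ _ (index_lt i j)
      simp [State.intMat, State.cell, m3, h2, toNat_ofNat_of_lt hw2, -BitVec.toNat_ofNat]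
  · simp [Prog.size]; omega
  rintro σ₄ ⟨-, -, hr₄, hmem₄, -, Z, hZ, hZt⟩
  have u4 : ∀ r < 20, r ≠ 13 → r ≠ 14 → σ₄.reg r = σ₁.reg r := fun r hr a b =>
    (hr₄ r hr).trans (u r hr a b)
  have w1 := (u4 1 (by decide) (by decide) (by decide)).trans v1
  have w16 := (u4 16 (by decide) (by decide) (by decide)).trans r16
  have w17 := (u4 17 (by decide) (by decide) (by decide)).trans r17
  have w13 : σ₄.freg 1 13 14 = (m : ℝ) := (State.freg_congr (hr₄ 1 (by decide))
    (hr₄ 13 (by decide)) (hr₄ 14 (by decide))).trans hf₃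
  have hs1 : m + 1 < 2 ^ γ := by omega
  have hs2 : (m : ℝ) + 1 ≤ 2 ^ γ := by exact_mod_cast hs1.le
  refine Runs.andThen (Runs.fop (B := κ + γ) (γ := γ) (by decide) (by decide) (by decide)
    w1 (by omega) (by omega) w13 (freg_one w16 w17) (by simp only [FloatOp.eval]; linarith)
    (hlt (by simp only [FloatOp.eval]; linarith) hs2)) ?_ ?_
  · simp [Prog.size]; omega
  rintro σ₅ ⟨f5, g5, n5⟩
  have f5 : σ₅.freg 1 29 30 = (m : ℝ) + 1 := by
    rw [f5]
    simp only [FloatOp.eval]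
    exact_mod_cast fl_natCast (γ := γ) (k := m + 1) (by omega) hs1
  have a1 : 1 ≤ ((m : ℝ) + 1) / m := by rw [one_le_div (by linarith)]; linarith
  have a2 : ((m : ℝ) + 1) / m ≤ 2 := by rw [div_le_iff₀ (by linarith)]; linarith
  have a3 : ((m : ℝ) + 1) / m ≤ 2 ^ γ := (div_le_self (by linarith) hm').trans hs2
  refine Runs.andThen (Runs.fop (B := κ + γ) (γ := γ) (by decide) (by decide) (by decide)
    ((g5 1 (by decide) (by decide)).trans w1) (by omega) (by omega) f5
    ((State.freg_congr (g5 1 (by decide) (by decide)) (g5 13 (by decide) (by decide))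
      (g5 14 (by decide) (by decide))).trans w13) a1 (hlt a1 a3)) ?_ ?_
  · simp [Prog.size]; omega
  rintro σ₆ ⟨f6, g6, n6⟩
  have u6 : ∀ r < 20, r ≠ 13 → r ≠ 14 → σ₆.reg r = σ₁.reg r := fun r hr a b => by
    rw [g6 r (by omega) (by omega), g5 r (by omega) (by omega), u4 r hr a b]
  have hZ' : ∀ x < n * n, ∃ i j : Fin n, x = i.val * n + j.val := forall_index fun i j => ⟨i, j, rfl⟩
  change σ₆.freg 1 29 30 = fl γ (((m : ℝ) + 1) / m) at f6
  set μ := fl γ (((m : ℝ) + 1) / m) with hμ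
  have hμ1 : 1 ≤ μ := one_le_fl a1
  have hμ2 : μ ≤ 2 := (fl_le (by linarith)).trans a2
  refine Runs.mono (Runs.forEach (S := [6, 7, 8]) rfl (by decide) (N := n * n) (by omega)
    ((u6 7 (by decide) (by decide) (by decide)).trans r7)
    (fun x col => ∀ i j : Fin n, x = i.val * n + j.val →
      floatCell γ (col 6) (col 7) (col 8) = flScale γ μ (Z i j) ∧
      ((col 6).toNat = 1 → (col 8).toNat < 2 ^ γ)) ?_) ?_ ?_
  · rintro x hx σ' hs h40 hcol i j rfl
    have q1 := (hs.reg 1 (by decide)).trans ((u6 1 (by decide) (by decide) (by decide)).trans v1)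
    have q5 := (hs.reg 5 (by decide)).trans ((u6 5 (by decide) (by decide) (by decide)).trans r5)
    have q8 := (hs.reg 8 (by decide)).trans ((u6 8 (by decide) (by decide) (by decide)).trans r8)
    have q10 := (hs.reg 10 (by decide)).trans
      ((u6 10 (by decide) (by decide) (by decide)).trans r10)
    have q29 := hs.reg 29 (by decide)
    have q30 := hs.reg 30 (by decide)
    have tγ := toNat_ofNat_of_lt hγw
    have q6 := u6 1 (by decide) (by decide) (by decide)
    rw [v1] at q6
    simp only [State.freg, q6, tγ] at f6
    have n10 := hcol 10
    have n11 := hcol 11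
    refine codes_decode hγ3 (by omega) hμ1 hμ2 (hZ i j) ?_ ?_
    · intro e f ht hv hf hlt' he
      simp only [State.cell] at ht hv
      rw [n6, n5] at n10 n11
      rw [ht] at n10
      rw [hv] at n11
      have hG := ofNat_mod (w := w) (a := e * 2 ^ γ + f) (b := 2 ^ γ) (by omega) hGw'
      have hG' := ofNat_div (w := w) (a := e * 2 ^ γ + f) (b := 2 ^ γ) (by omega) hGw'
      have hS := ofNat_sub (w := w) (a := e * 2 ^ γ + f + 1) (b := 1) (by omega)
      rw [Nat.add_sub_cancel] at hS
      have i1 : (e * 2 ^ γ + f) % 2 ^ γ = f := by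
        rw [mul_comm, Nat.mul_add_mod, Nat.mod_eq_of_lt hf]
      have i2 : (e * 2 ^ γ + f) / 2 ^ γ = e := by
        rw [mul_comm, Nat.mul_add_div (by positivity), Nat.div_eq_of_lt hf, add_zero]
      rw [i1] at hG
      rw [i2] at hG'
      have tf : (BitVec.ofNat w f).toNat = f := toNat_ofNat_of_lt (by omega)
      have te : (BitVec.ofNat w e).toInt = e := by
        have : 2 ^ (w - 3) * 2 ^ 3 = 2 ^ w := by rw [← pow_add]; congr 1; omega
        rw [BitVec.toInt_eq_toNat_of_lt] <;> rw [toNat_ofNat_of_lt (by omega)]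
        omega
      generalize BitVec.ofNat w (2 ^ γ) = G at *
      generalize BitVec.ofNat w (e * 2 ^ γ + f + 1) = c1 at *
      generalize BitVec.ofNat w (e * 2 ^ γ + f) = c2 at *
      generalize BitVec.ofNat w e = c3 at *
      generalize BitVec.ofNat w f = c4 at *
      simp [Prog.eval, WordOp.eval, FloatOp.eval, State.freg, Test.holds, h40, q1, q5, q8, q29,
        q30, n10, n11, hS, hG, hG', te, tf, tγ, f6, -BitVec.toNat_ofNat]
    · intro ht
      simp only [State.cell] at ht
      rw [n6, n5] at n10
      simp [Prog.eval, Test.holds, h40, q5, q10, n10, ht]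
  · simp [Prog.size]; omega
  rintro σ₇ ⟨-, hR₇⟩
  have H : ∀ i j, σ₇.floatMat γ 6 n i j = flScale γ μ (Z i j) ∧
      ((σ₇.cell 6 n i j).toNat = 1 → (σ₇.cell (6 + 2) n i j).toNat < 2 ^ γ) :=
    fun i j => hR₇ _ (index_lt i j) i j rfl
  refine ⟨fun i j => (H i j).2, fun i j => ?_⟩
  rw [(H i j).1]
  have hp' : (0 : ℝ) < p := by exact_mod_cast hp
  have hq' : (0 : ℝ) < q := by exact_mod_cast (by omega : 0 < q)
  have hpq' : (10 : ℝ) * p ≤ q := by exact_mod_cast hpq.le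
  have hε : ENNReal.ofReal (1 + (p : ℝ) / q) = 1 + (p : ℝ≥0∞) / q := by
    rw [ENNReal.ofReal_add (by norm_num) (by positivity), ENNReal.ofReal_div_of_pos hq']
    simp
  rw [← hε]
  refine minPlus_of_scaled hn (by omega) (by nlinarith) ?_ ?_
    (fun i j => (hA₀ _ (index_lt i j)).one_le) (fun i j => (hA₀' _ (index_lt i j)).one_le)
    (hZt i j).1 (hZt i j).2
  · rw [div_le_one hq']; linarith
  · have : (q : ℝ) / p ≤ (q / p : ℕ) + 1 := by
      rw [div_le_iff₀ hp']
      have := Nat.lt_div_mul_add (a := q) hp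
      have : q ≤ (q / p + 1) * p := by rw [add_mul]; omega
      exact_mod_cast this
    rw [hm]
    push_cast
    rw [div_le_div_iff₀ (by positivity) hq']
    rw [div_le_iff₀ hp'] at this
    linarith

end WordRAM

/-- With `x = n / ε`, the number `m` of subdivisions is at most `8 / ε`, and all integers that the
reduction handles are bounded by powers of `x`, hence by `2 ^ γ`. The `m ^ 2` calls cost a factor of
the order of `1 / ε ^ 2`. -/
theorem approxMinPlusSolvable_of_minMaxSolvable {c : ℝ} (hc : 2 ≤ c) (h : MinMaxSolvable c) :
    ApproxMinPlusSolvable c := by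
  obtain ⟨P, C, hP⟩ := h
  refine ⟨minPlusByMinMax P, 10 + 2 * C + ⌈30000 + 64 * (C * (2 : ℝ) ^ C)⌉₊, ?_⟩
  set C' := 10 + 2 * C + ⌈30000 + 64 * (C * (2 : ℝ) ^ C)⌉₊ with hC'
  intro n p q γ κ w hn hp hpq hq hγ hw σ h0 h1 h2 h3 hin
  obtain ⟨ε0, ε1, e1, e10, ex, hnx, hqx⟩ := precision_facts hn hp hpq
  have hn' : (1 : ℝ) ≤ n := by exact_mod_cast hn
  rw [ex] at hγ ⊢
  set ε : ℝ := (p : ℝ) / q with hε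
  set x : ℝ := n * ((q : ℝ) / p) with hx
  have hx10 : 10 ≤ x := e10.trans hqx
  have hℓ := two_le_log hx10
  set ℓ := Real.log x with hℓdef
  have hpow : ∀ a ≤ C', x ^ a ≤ 2 ^ γ := fun a ha =>
    (pow_le_pow_right₀ (by linarith) ha).trans hγ
  have hpowγ : ∀ k : ℕ, ∀ a ≤ C', (k : ℝ) ≤ x ^ a → k ≤ 2 ^ γ := fun k a ha hk => by
    exact_mod_cast hk.trans (hpow a ha)
  have hγ1 : 1 ≤ γ := by
    by_contra hcon
    have := hpow 1 (by omega)
    rw [show γ = 0 by omega] at this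
    norm_num at this; linarith
  have hw3 : κ + γ + γ + 1 ≤ w := by
    have : 3 * (γ + κ) ≤ C' * (γ + κ) := Nat.mul_le_mul_right _ (by omega)
    omega
  obtain ⟨m, hm⟩ : ∃ m, m = 4 * (q / p + 1) := ⟨_, rfl⟩
  have hm8 : (m : ℝ) ≤ 8 * (q / p) := by
    have : ((q / p : ℕ) : ℝ) ≤ q / p := Nat.cast_div_le
    rw [hm]; push_cast; linarith
  have hn1x : ((n + 1 : ℕ) : ℝ) ≤ x ^ 2 := by push_cast; nlinarith
  have hmγ : (m + 1) * (m + 1) < 2 ^ γ := by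
    have : ((m + 1 : ℕ) : ℝ) ≤ x ^ 2 := by push_cast; nlinarith
    refine Nat.lt_of_lt_of_le (Nat.lt_succ_self _) (hpowγ _ 5 (by omega) ?_)
    push_cast at this ⊢
    have h4 : (1 : ℝ) ≤ x ^ 4 := one_le_pow₀ (by linarith)
    calc ((m : ℝ) + 1) * (m + 1) + 1 ≤ x ^ 2 * x ^ 2 + x ^ 4 := by gcongr
      _ = 2 * x ^ 4 := by ring
      _ ≤ x * x ^ 4 := by gcongr; linarith
      _ = x ^ 5 := by ring
  have hnγ : n * n < 2 ^ γ := by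
    refine Nat.lt_of_lt_of_le (Nat.lt_succ_self _) (hpowγ _ 3 (by omega) ?_)
    push_cast
    have h4 : (1 : ℝ) ≤ x ^ 2 := one_le_pow₀ (by linarith)
    calc (n : ℝ) * n + 1 ≤ x * x + x ^ 2 := by gcongr
      _ = 2 * x ^ 2 := by ring
      _ ≤ x * x ^ 2 := by gcongr; linarith
      _ = x ^ 3 := by ring
  have hcallw : (n + 1) ^ C ≤ 2 ^ w := by
    refine (hpowγ _ (2 * C) (by omega) ?_).trans (Nat.pow_le_pow_right (by norm_num) (by omega))
    push_cast at hn1x ⊢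
    rw [pow_mul]; gcongr
  obtain ⟨T, hT⟩ : ∃ T, T = ⌊C * (n : ℝ) ^ c * Real.log (n + 2) ^ C⌋₊ := ⟨_, rfl⟩
  obtain ⟨t, σ₁, he, ht, hpost⟩ := minPlusByMinMax_runs (T := T) hn hp hpq hq hm hnγ hmγ hw3
    (fun τ a b => by
      obtain ⟨t, τ', he, ht, hpost⟩ := hP n w hn hcallw τ a b
      exact ⟨t, τ', he, hT ▸ Nat.le_floor ht, hpost⟩) σ h0 h1 h2 h3 hin.1 hin.2
  refine ⟨t, σ₁, he, ?_, hpost⟩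
  refine approx_time_le (K := 30000 + 64 * (C * (2 : ℝ) ^ C)) (a := 2) (b := C) ε0
    (by linarith) (by linarith) ?_ ?_ (by omega) (by omega)
  · have hlog : Real.log (n + 2) ≤ 2 * ℓ := by
      have : Real.log (x ^ 2) = 2 * ℓ := by rw [Real.log_pow]; norm_num [hℓdef]
      rw [← this]
      exact Real.log_le_log (by linarith) (by nlinarith)
    have hlog0 : 0 ≤ Real.log (n + 2) := Real.log_nonneg (by linarith)
    set N := (n : ℝ) ^ c with hN
    have hN0 : 0 ≤ N := by positivity
    have hN1 : 1 ≤ N := Real.one_le_rpow hn' (by linarith)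
    have hsq : ((n ^ 2 : ℕ) : ℝ) ≤ N := sq_le_rpow hn hc
    have hTN : (T : ℝ) ≤ C * 2 ^ C * (N * ℓ ^ C) := by
      rw [hT]
      refine (Nat.floor_le (by positivity)).trans ?_
      calc C * N * Real.log (n + 2) ^ C ≤ C * N * (2 * ℓ) ^ C := by gcongr
        _ = C * 2 ^ C * (N * ℓ ^ C) := by rw [mul_pow]; ring
    have hℓC : 1 ≤ ℓ ^ C := one_le_pow₀ (by linarith)
    have hNℓ : N ≤ N * ℓ ^ C := le_mul_of_one_le_right hN0 hℓC
    have hm1 : 1 ≤ m := hm ▸ Nat.mul_pos (by norm_num) (Nat.succ_pos _)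
    have ht' : t ≤ m * m * (411 * n ^ 2 + T) := by
      have a1 : 1 ≤ n ^ 2 := Nat.one_le_pow _ _ hn
      have a2 : m ≤ m * m := Nat.le_mul_of_pos_left m hm1
      have a3 : n ^ 2 ≤ m * m * n ^ 2 := Nat.le_mul_of_pos_left _ (Nat.mul_pos hm1 hm1)
      have a4 : m * m ≤ m * m * n ^ 2 := Nat.le_mul_of_pos_right _ a1
      rw [← pow_two n] at ht
      have a5 : m * m * (104 + 100 * n ^ 2 + T + 3) =
          107 * (m * m) + 100 * (m * m * n ^ 2) + m * m * T := by ring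
      have a6 : m * m * (411 * n ^ 2 + T) = 411 * (m * m * n ^ 2) + m * m * T := by ring
      omega
    have e2 : (q : ℝ) / p = 1 / ε := e1.symm
    calc (t : ℝ) ≤ (m : ℝ) * m * (411 * ((n ^ 2 : ℕ) : ℝ) + T) := by exact_mod_cast ht'
      _ ≤ (8 * (1 / ε)) * (8 * (1 / ε)) *
          (411 * (N * ℓ ^ C) + C * 2 ^ C * (N * ℓ ^ C)) := by
        rw [e2] at hm8
        have := hsq.trans hNℓ
        gcongr
      _ = (26304 + 64 * (C * (2 : ℝ) ^ C)) * N / ε ^ 2 * ℓ ^ C := by field_simp; ring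
      _ ≤ (30000 + 64 * (C * (2 : ℝ) ^ C)) * N / ε ^ 2 * ℓ ^ C := by gcongr; norm_num
  · rw [hC']
    push_cast
    have := Nat.le_ceil (30000 + 64 * (C * (2 : ℝ) ^ C))
    have h1 : (0 : ℝ) ≤ C := Nat.cast_nonneg C
    linarith

/-! ### Bottlenecks from approximate distances -/

/-- `W` and `U` are edge weights and capacities such that the edges of capacity `g r` have weight
`2 ^ (2 * n * r)`. For antitone `g`, the weight of an edge exceeds by far the sum of the weights of
`n` edges of larger capacity. -/
def RankWeights {n : ℕ} (m : ℕ) (g : ℕ → ℕ∞) (W : Fin n → Fin n → ℝ≥0∞)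
    (U : Fin n → Fin n → ℕ∞) : Prop :=
  ∀ x y, (W x y = ⊤ ∧ U x y = 0) ∨ ∃ r ≤ m, W x y = 2 ^ (2 * n * r) ∧ U x y = g r

namespace RankWeights

variable {n m : ℕ} {g : ℕ → ℕ∞} {W : Fin n → Fin n → ℝ≥0∞} {U : Fin n → Fin n → ℕ∞}

theorem one_le (h : RankWeights m g W U) (x y : Fin n) : 1 ≤ W x y := by
  rcases h x y with ⟨h, -⟩ | ⟨r, -, h, -⟩ <;> rw [h]
  · exact le_top
  · exact one_le_pow₀ (by norm_num)

/-- Every walk between different nodes has an edge whose capacity is at least that of the walk and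
whose weight is at least the distance divided by `n`. -/
theorem exists_edge {u v : Fin n} (huv : u ≠ v) (l : List (Fin n))
    (hl : (u :: l).getLast (List.cons_ne_nil u l) = v) : ∃ x y, pathCapacity U u l ≤ U x y ∧
      W x y ≤ pathWeight W u l ∧ graphDist W u v ≤ n * W x y := by
  obtain ⟨l', h1, h2, h3, h4⟩ := exists_simple_path u l
  have hne : l' ≠ [] := by
    rintro rfl
    exact huv (h2.trans hl)
  obtain ⟨x, y, e1, e2, e3⟩ := exists_heaviest_edge W U u l' hne
  refine ⟨x, y, (h4 U).trans e1, e2.trans (h3 W), ?_⟩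
  refine (graphDist_le W (h2.trans hl)).trans (e3.trans ?_)
  gcongr

/-- Without a walk of finite weight there is no walk of positive capacity. -/
theorem bottleneck_eq_zero (h : RankWeights m g W U) {u v : Fin n} (huv : u ≠ v)
    (hd : graphDist W u v = ⊤) : bottleneck U u v = 0 := by
  rw [← nonpos_iff_eq_zero]
  refine iSup₂_le fun l hl => ?_
  obtain ⟨x, y, e1, -, e3⟩ := exists_edge (W := W) (U := U) huv l hl
  rw [hd, top_le_iff] at e3
  refine e1.trans ?_
  rcases h x y with ⟨-, h⟩ | ⟨r, -, hW, -⟩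
  · rw [h]
  · rw [hW] at e3
    exact absurd e3 (ENNReal.mul_ne_top (by simp) (by simp))

/-- Distances up to a factor `2` determine the bottlenecks. -/
theorem bottleneck_eq (h : RankWeights m g W U) (hg : ∀ r r', r ≤ r' → r' ≤ m → g r' ≤ g r)
    {u v : Fin n} (huv : u ≠ v) {d : ℝ≥0∞} {e : ℕ} (h1 : graphDist W u v ≤ d)
    (h2 : d ≤ 2 * graphDist W u v) (he : 2 ^ e ≤ d) (he' : d < 2 ^ (e + 1)) :
    e / (2 * n) ≤ m ∧ bottleneck U u v = g (e / (2 * n)) := by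
  have hn : 0 < 2 * n := by have := u.isLt; omega
  -- a finite edge weight that is not much smaller than the distance has at least the rank computed
  have hrank : ∀ r, graphDist W u v ≤ n * (2 : ℝ≥0∞) ^ (2 * n * r) → e / (2 * n) ≤ r := by
    intro r hr
    by_contra hc
    have hc' : 2 * n * (r + 1) ≤ e := by
      have : r + 1 ≤ e / (2 * n) := by omega
      rw [Nat.le_div_iff_mul_le hn] at this
      linarith
    have h3 : (2 : ℝ≥0∞) ^ (2 * n * (r + 1)) ≤ 2 * (n * (2 : ℝ≥0∞) ^ (2 * n * r)) :=
      calc (2 : ℝ≥0∞) ^ (2 * n * (r + 1)) ≤ 2 ^ e := pow_le_pow_right₀ (by norm_num) hc'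
        _ ≤ 2 * graphDist W u v := he.trans h2
        _ ≤ _ := by gcongr
    have h4 : 2 ^ (2 * n * (r + 1)) ≤ 2 * (n * 2 ^ (2 * n * r)) := by exact_mod_cast h3
    have h5 : 2 * n < 2 ^ (2 * n) := Nat.lt_two_pow_self
    have h6 : 0 < 2 ^ (2 * n * r) := by positivity
    rw [mul_add, mul_one, pow_add] at h4
    nlinarith
  have hfin : graphDist W u v < ⊤ := h1.trans_lt (he'.trans_le le_top)
  have hle : e / (2 * n) ≤ m := by
    simp only [graphDist, iInf_lt_iff] at hfin
    obtain ⟨l, hl, hlt⟩ := hfin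
    obtain ⟨x, y, -, e2, e3⟩ := exists_edge (W := W) (U := U) huv l hl
    rcases h x y with ⟨hW, -⟩ | ⟨r, hr, hW, -⟩
    · rw [hW] at e2
      exact absurd (e2.trans_lt hlt) (lt_irrefl _)
    · exact (hrank r (hW ▸ e3)).trans hr
  refine ⟨hle, le_antisymm (iSup₂_le fun l hl => ?_) ?_⟩
  · obtain ⟨x, y, e1, e2, e3⟩ := exists_edge (W := W) (U := U) huv l hl
    refine e1.trans ?_
    rcases h x y with ⟨-, hU⟩ | ⟨r, hr, hW, hU⟩
    · rw [hU]; exact bot_le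
    · rw [hU]
      exact hg _ _ (hrank r (hW ▸ e3)) hr
  · refine le_bottleneck_of_graphDist_lt (W := W) (b := 2 ^ (2 * n * (e / (2 * n) + 1)))
      (fun x y hxy => ?_) (h1.trans_lt (he'.trans_le (pow_le_pow_right₀ (by norm_num) ?_)))
    · rcases h x y with ⟨hW, -⟩ | ⟨r, hr, hW, hU⟩
      · rw [hW] at hxy
        exact absurd hxy (not_lt.2 le_top)
      · rw [hU]
        refine hg _ _ ?_ hle
        rw [hW] at hxy
        by_contra hc
        exact absurd hxy (not_lt.2 (pow_le_pow_right₀ (by norm_num)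
          (Nat.mul_le_mul_left _ (by omega))))
    · rw [mul_add, mul_one]
      have := Nat.div_add_mod e (2 * n)
      have := Nat.mod_lt e hn
      omega

end RankWeights

/-! ### Merging -/

/-- The blocks of length `L` of the first `N` entries of `a` are sorted by `key`. -/
def BlockSorted {α : Type*} (key : α → ℕ) (L N : ℕ) (a : ℕ → α) : Prop :=
  ∀ x y, x < y → y < N → x / L = y / L → key (a x) ≤ key (a y)

theorem BlockSorted.le {α : Type*} {key : α → ℕ} {L N c x y : ℕ} {a : ℕ → α}
    (h : BlockSorted key L N a) (hL : 0 < L) (hx : L * c ≤ x) (hxy : x < y) (hy : y < L * c + L)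
    (hyN : y < N) : key (a x) ≤ key (a y) := by
  have hc : ∀ z, L * c ≤ z → z < L * c + L → z / L = c := fun z h1 h2 => by
    obtain ⟨d, rfl⟩ := Nat.exists_eq_add_of_le h1
    rw [Nat.mul_add_div hL, Nat.div_eq_of_lt (by omega), add_zero]
  exact h x y hxy hyN ((hc x hx (by omega)).trans (hc y (by omega) hy).symm)

/-- The state of a merge pass over an array `a` with sorted blocks of length `L` into an array `t`, of
which the first `x` entries have been written. The blocks being merged are those with the numbers
`2 b` and `2 b + 1`, and the next candidates are at the places `i` and `j`. -/
structure MergeState {α : Type*} (key : α → ℕ) (L : ℕ) (a t : ℕ → α) (b i j x : ℕ) : Prop where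
  le_i : 2 * L * b ≤ i
  i_le : i ≤ 2 * L * b + L
  le_j : 2 * L * b + L ≤ j
  j_le : j ≤ 2 * L * b + 2 * L
  count : x + (2 * L * b + L) = i + j
  sorted : BlockSorted key (2 * L) x t
  le_left : ∀ z < x, 2 * L * b ≤ z → ∀ y, i ≤ y → y < 2 * L * b + L → key (t z) ≤ key (a y)
  le_right : ∀ z < x, 2 * L * b ≤ z → ∀ y, j ≤ y → y < 2 * L * b + 2 * L → key (t z) ≤ key (a y)
  covered : ∀ y, (y < i ∨ (2 * L * b + L ≤ y ∧ y < j)) → ∃ z < x, t z = a y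

namespace MergeState

variable {α : Type*} {key : α → ℕ} {L N : ℕ} {a t t' : ℕ → α} {b i j x : ℕ}

theorem start : MergeState key L a t 0 0 L 0 := by
  refine ⟨by omega, by omega, by omega, by omega, by omega, ?_, ?_, ?_, ?_⟩
  · intro x y h1 h2; omega
  · intro z hz; omega
  · intro z hz; omega
  · intro y hy; omega

theorem sorted_snoc (h : MergeState key L a t b i j x) (hL : 0 < L)
    (hx : x < 2 * L * b + 2 * L) (ht : ∀ z < x, t' z = t z)
    (hle : ∀ z < x, 2 * L * b ≤ z → key (t z) ≤ key (t' x)) : BlockSorted key (2 * L) (x + 1) t' := by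
  intro z y h1 h2 h3
  rcases Nat.lt_succ_iff_lt_or_eq.1 h2 with h2 | rfl
  · rw [ht z (by omega), ht y h2]
    exact h.sorted z y h1 h2 h3
  · rw [ht z h1]
    refine hle z h1 ?_
    have hb : y / (2 * L) = b := by
      obtain ⟨c, hc⟩ := Nat.exists_eq_add_of_le
        (show 2 * L * b ≤ y by have := h.count; have := h.le_i; have := h.le_j; omega)
      rw [hc, Nat.mul_add_div (by omega), Nat.div_eq_of_lt (by omega), add_zero]
    have := Nat.div_mul_le_self z (2 * L)
    rw [h3, hb, mul_comm] at this
    exact this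

theorem left (h : MergeState key L a t b i j x) (hL : 0 < L) (ha : BlockSorted key L N a)
    (hN : 2 * L * b + 2 * L ≤ N) (ht : ∀ z < x, t' z = t z) (hx : t' x = a i)
    (hi : i < 2 * L * b + L) (hj : j < 2 * L * b + 2 * L → key (a i) ≤ key (a j)) :
    MergeState key L a t' b (i + 1) j (x + 1) := by
  have e : L * (2 * b) = 2 * L * b := by ring
  have e' : L * (2 * b + 1) = 2 * L * b + L := by ring
  have l1 := h.le_i
  have l2 := h.le_j
  have hblock : ∀ y, i < y → y < 2 * L * b + L → key (a i) ≤ key (a y) := fun y h1 h2 =>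
    ha.le hL (c := 2 * b) (by omega) h1 (by omega) (by omega)
  have hblock' : ∀ y, j < y → y < 2 * L * b + 2 * L → key (a j) ≤ key (a y) := fun y h1 h2 =>
    ha.le hL (c := 2 * b + 1) (by omega) h1 (by omega) (by omega)
  refine ⟨by have := h.le_i; omega, by omega, h.le_j, h.j_le, by have := h.count; omega,
    h.sorted_snoc hL (by have := h.count; have := h.j_le; omega) ht (fun z h1 h2 => ?_),
    fun z h1 h2 y h3 h4 => ?_, fun z h1 h2 y h3 h4 => ?_, fun y hy => ?_⟩
  · rw [hx]; exact h.le_left z h1 h2 i le_rfl hi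
  · rcases Nat.lt_succ_iff_lt_or_eq.1 h1 with h1 | rfl
    · rw [ht z h1]; exact h.le_left z h1 h2 y (by omega) h4
    · rw [hx]; exact hblock y (by omega) h4
  · rcases Nat.lt_succ_iff_lt_or_eq.1 h1 with h1 | rfl
    · rw [ht z h1]; exact h.le_right z h1 h2 y h3 h4
    · rw [hx]
      rcases eq_or_lt_of_le h3 with rfl | h3
      · exact hj h4
      · exact (hj (by omega)).trans (hblock' y h3 h4)
  · by_cases hyi : y = i
    · exact ⟨x, by omega, hyi ▸ hx⟩
    · obtain ⟨z, hz, e⟩ := h.covered y (by omega)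
      exact ⟨z, by omega, (ht z hz).trans e⟩

theorem right (h : MergeState key L a t b i j x) (hL : 0 < L) (ha : BlockSorted key L N a)
    (hN : 2 * L * b + 2 * L ≤ N) (ht : ∀ z < x, t' z = t z) (hx : t' x = a j)
    (hj : j < 2 * L * b + 2 * L) (hi : i < 2 * L * b + L → key (a j) ≤ key (a i)) :
    MergeState key L a t' b i (j + 1) (x + 1) := by
  have e : L * (2 * b) = 2 * L * b := by ring
  have e' : L * (2 * b + 1) = 2 * L * b + L := by ring
  have l1 := h.le_i
  have l2 := h.le_j
  have hblock : ∀ y, i < y → y < 2 * L * b + L → key (a i) ≤ key (a y) := fun y h1 h2 =>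
    ha.le hL (c := 2 * b) (by omega) h1 (by omega) (by omega)
  have hblock' : ∀ y, j < y → y < 2 * L * b + 2 * L → key (a j) ≤ key (a y) := fun y h1 h2 =>
    ha.le hL (c := 2 * b + 1) (by omega) h1 (by omega) (by omega)
  refine ⟨h.le_i, h.i_le, by have := h.le_j; omega, by omega, by have := h.count; omega,
    h.sorted_snoc hL (by have := h.count; have := h.i_le; omega) ht (fun z h1 h2 => ?_),
    fun z h1 h2 y h3 h4 => ?_, fun z h1 h2 y h3 h4 => ?_, fun y hy => ?_⟩
  · rw [hx]; exact h.le_right z h1 h2 j le_rfl hj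
  · rcases Nat.lt_succ_iff_lt_or_eq.1 h1 with h1 | rfl
    · rw [ht z h1]; exact h.le_left z h1 h2 y h3 h4
    · rw [hx]
      rcases eq_or_lt_of_le h3 with rfl | h3
      · exact hi h4
      · exact (hi (by omega)).trans (hblock y h3 h4)
  · rcases Nat.lt_succ_iff_lt_or_eq.1 h1 with h1 | rfl
    · rw [ht z h1]; exact h.le_right z h1 h2 y (by omega) h4
    · rw [hx]; exact hblock' y (by omega) h4
  · by_cases hyj : y = j
    · exact ⟨x, by omega, hyj ▸ hx⟩
    · obtain ⟨z, hz, e⟩ := h.covered y (by omega)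
      exact ⟨z, by omega, (ht z hz).trans e⟩

/-- When both blocks are exhausted, the next two are taken up. -/
theorem next (h : MergeState key L a t b (2 * L * b + L) (2 * L * b + 2 * L) x) :
    MergeState key L a t (b + 1) (2 * L * b + 2 * L) (2 * L * b + 2 * L + L) x := by
  have e : 2 * L * (b + 1) = 2 * L * b + 2 * L := by ring
  have hc := h.count
  refine ⟨by omega, by omega, by omega, by omega, by omega, h.sorted, fun z h1 h2 => by omega,
    fun z h1 h2 => by omega, fun y hy => h.covered y (by omega)⟩

end MergeState

namespace WordRAM

/-! ### Merge sort on the machine -/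

/-- The next step of a merge pass from segment `10` to segment `11` with the keys in segment `1`, and
with the merged blocks given by the registers `20, …, 23`: the two candidates and the ends of the
blocks, in the order `i, m, j, e`. -/
def mergeStep : Prog :=
  (.load 30 10 20 ;; .load 31 1 30 ;; .load 32 10 22 ;; .load 33 1 32 ;;
    .ite (.lt 20 21)
      (.ite (.lt 22 23)
        (.ite (.lt 33 31) (.store 11 24 32 ;; .op .add 22 22 5) (.store 11 24 30 ;; .op .add 20 20 5))
        (.store 11 24 30 ;; .op .add 20 20 5))
      (.store 11 24 32 ;; .op .add 22 22 5)) ;;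
  .ite (.eq 20 21) (.ite (.eq 22 23)
    (.op .or 20 22 22 ;; .op .add 21 20 14 ;; .op .or 22 21 21 ;; .op .add 23 22 14) .skip) .skip

/-- A pass of merge sort over the array in segment `10`, whose length is in register `10`; register
`14` holds the length of the blocks that are sorted already. -/
def mergePass : Prog :=
  (.const 20 0 ;; .op .or 21 14 14 ;; .op .or 22 14 14 ;; .op .add 23 14 14) ;;
  forUp 24 10 mergeStep ;; forUp 40 10 (.load 42 11 40 ;; .store 10 40 42)

/-- A step of a merge pass appends one element to the output and moves on to the next pair of blocks when
the current one is exhausted. Since `hij` says that the current pair is not exhausted, some candidate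
is left at the beginning of each step. -/
theorem mergeStep_runs {w L N b i j x : ℕ} {σ : State w} {a : ℕ → BitVec w} {key : BitVec w → ℕ}
    (hL : 0 < L) (hN : 2 * N + 2 * L < 2 ^ w) (hx : x < N) (hbN : 2 * L * b + 2 * L ≤ N)
    (hkey : ∀ v, key v = (σ.mem 1 v).toNat)
    (hmem : ∀ y, σ.mem 10 (BitVec.ofNat w y) = a y) (ha : BlockSorted key L N a)
    (h : MergeState key L a (fun z => σ.mem 11 (BitVec.ofNat w z)) b i j x)
    (hij : i < 2 * L * b + L ∨ j < 2 * L * b + 2 * L)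
    (r5 : σ.reg 5 = BitVec.ofNat w 1) (r14 : σ.reg 14 = BitVec.ofNat w L)
    (r20 : σ.reg 20 = BitVec.ofNat w i) (r21 : σ.reg 21 = BitVec.ofNat w (2 * L * b + L))
    (r22 : σ.reg 22 = BitVec.ofNat w j) (r23 : σ.reg 23 = BitVec.ofNat w (2 * L * b + 2 * L))
    (r24 : σ.reg 24 = BitVec.ofNat w x) :
    Runs mergeStep mergeStep.size σ (fun σ' => (∀ r < 20, σ'.reg r = σ.reg r) ∧
      σ'.reg 24 = σ.reg 24 ∧ σ'.reg 25 = σ.reg 25 ∧ (∀ s, s ≠ 11 → σ'.mem s = σ.mem s) ∧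
      ∃ b i j, (i < 2 * L * b + L ∨ j < 2 * L * b + 2 * L) ∧
        σ'.reg 20 = BitVec.ofNat w i ∧ σ'.reg 21 = BitVec.ofNat w (2 * L * b + L) ∧
        σ'.reg 22 = BitVec.ofNat w j ∧ σ'.reg 23 = BitVec.ofNat w (2 * L * b + 2 * L) ∧
        MergeState key L a (fun z => σ'.mem 11 (BitVec.ofNat w z)) b i j (x + 1)) := by
  have li := h.i_le
  have lj := h.j_le
  have ti : (BitVec.ofNat w i).toNat = i := toNat_ofNat_of_lt (by omega)
  have tj : (BitVec.ofNat w j).toNat = j := toNat_ofNat_of_lt (by omega)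
  have tm : (BitVec.ofNat w (2 * L * b + L)).toNat = 2 * L * b + L := toNat_ofNat_of_lt (by omega)
  have te : (BitVec.ofNat w (2 * L * b + 2 * L)).toNat = 2 * L * b + 2 * L :=
    toNat_ofNat_of_lt (by omega)
  have hne : ∀ z < x, BitVec.ofNat w z ≠ BitVec.ofNat w x := fun z hz e => by
    have := ofNat_inj_of_lt (by omega) (by omega) e
    omega
  have mi := hmem i
  have mj := hmem j
  have ki := hkey (a i)
  have kj := hkey (a j)
  refine Runs.mono (Runs.seq (T := _) (T' := _) (Q := fun σ' =>
    (∀ r < 30, r ≠ 20 → r ≠ 22 → σ'.reg r = σ.reg r) ∧ (∀ s, s ≠ 11 → σ'.mem s = σ.mem s) ∧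
    ∃ i j, σ'.reg 20 = BitVec.ofNat w i ∧ σ'.reg 22 = BitVec.ofNat w j ∧
      MergeState key L a (fun z => σ'.mem 11 (BitVec.ofNat w z)) b i j (x + 1))
    (Runs.eval ?_ ?_) ?_) le_rfl (fun _ => id)
  · simp [Prog.LoopFree]
  · have hleft : i < 2 * L * b + L → (j < 2 * L * b + 2 * L → key (a i) ≤ key (a j)) →
        ∀ τ : State w, (∀ r < 30, r ≠ 20 → τ.reg r = σ.reg r) → (∀ s, s ≠ 11 → τ.mem s = σ.mem s) →
        τ.reg 20 = BitVec.ofNat w (i + 1) →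
        (∀ y, τ.mem 11 y = if y = BitVec.ofNat w x then a i else σ.mem 11 y) →
        (∀ r < 30, r ≠ 20 → r ≠ 22 → τ.reg r = σ.reg r) ∧ (∀ s, s ≠ 11 → τ.mem s = σ.mem s) ∧
        ∃ i j, τ.reg 20 = BitVec.ofNat w i ∧ τ.reg 22 = BitVec.ofNat w j ∧
          MergeState key L a (fun z => τ.mem 11 (BitVec.ofNat w z)) b i j (x + 1) := by
      intro h1 h2 τ e1 e2 e3 e4
      refine ⟨fun r hr h _ => e1 r hr h, e2, i + 1, j, e3,
        (e1 22 (by decide) (by decide)).trans r22, h.left hL ha hbN (fun z hz => ?_) ?_ h1 h2⟩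
      · rw [e4, if_neg (hne z hz)]
      · simp only [e4, if_true]
    have hright : j < 2 * L * b + 2 * L → (i < 2 * L * b + L → key (a j) ≤ key (a i)) →
        ∀ τ : State w, (∀ r < 30, r ≠ 22 → τ.reg r = σ.reg r) → (∀ s, s ≠ 11 → τ.mem s = σ.mem s) →
        τ.reg 22 = BitVec.ofNat w (j + 1) →
        (∀ y, τ.mem 11 y = if y = BitVec.ofNat w x then a j else σ.mem 11 y) →
        (∀ r < 30, r ≠ 20 → r ≠ 22 → τ.reg r = σ.reg r) ∧ (∀ s, s ≠ 11 → τ.mem s = σ.mem s) ∧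
        ∃ i j, τ.reg 20 = BitVec.ofNat w i ∧ τ.reg 22 = BitVec.ofNat w j ∧
          MergeState key L a (fun z => τ.mem 11 (BitVec.ofNat w z)) b i j (x + 1) := by
      intro h1 h2 τ e1 e2 e3 e4
      refine ⟨fun r hr _ h => e1 r hr h, e2, i, j + 1,
        (e1 20 (by decide) (by decide)).trans r20, e3, h.right hL ha hbN (fun z hz => ?_) ?_ h1 h2⟩
      · rw [e4, if_neg (hne z hz)]
      · simp only [e4, if_true]
    have si := BitVec.ofNat_add (n := w) i 1
    have sj := BitVec.ofNat_add (n := w) j 1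
    simp only [Prog.eval, WordOp.eval, Test.holds, State.setReg_reg, State.setReg_mem, r20, r21, r22,
      r23, r24, mi, mj, ti, tj, tm, te, Nat.reduceEqDiff, if_true, if_false, ← ki, ← kj]
    by_cases c1 : i < 2 * L * b + L
    · rw [if_pos c1]
      by_cases c2 : j < 2 * L * b + 2 * L
      · rw [if_pos c2]
        by_cases c3 : key (a j) < key (a i)
        · rw [if_pos c3]
          refine hright c2 (fun _ => c3.le) _ (fun r hr h => ?_) (fun s hs => ?_) ?_ (fun y => ?_)
          · simp [h, show r ≠ 33 by omega, show r ≠ 32 by omega, show r ≠ 31 by omega,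
              show r ≠ 30 by omega]
          · funext y; simp [hs]
          · simp [r22, r5, sj]
          · simp [r22]
        · rw [if_neg c3]
          refine hleft c1 (fun _ => not_lt.1 c3) _ (fun r hr h => ?_) (fun s hs => ?_) ?_ (fun y => ?_)
          · simp [h, show r ≠ 33 by omega, show r ≠ 32 by omega, show r ≠ 31 by omega,
              show r ≠ 30 by omega]
          · funext y; simp [hs]
          · simp [r20, r5, si]
          · simp [r20]
      · rw [if_neg c2]
        refine hleft c1 (fun h => absurd h c2) _ (fun r hr h => ?_) (fun s hs => ?_) ?_ (fun y => ?_)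
        · simp [h, show r ≠ 33 by omega, show r ≠ 32 by omega, show r ≠ 31 by omega,
            show r ≠ 30 by omega]
        · funext y; simp [hs]
        · simp [r20, r5, si]
        · simp [r20]
    · rw [if_neg c1]
      refine hright (hij.resolve_left c1) (fun h => absurd h c1) _ (fun r hr h => ?_)
        (fun s hs => ?_) ?_ (fun y => ?_)
      · simp [h, show r ≠ 33 by omega, show r ≠ 32 by omega, show r ≠ 31 by omega,
          show r ≠ 30 by omega]
      · funext y; simp [hs]
      · simp [r22, r5, sj]
      · simp [r22]
  · rintro σ₁ ⟨hr, hm, i', j', q20, q22, h'⟩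
    have q21 := (hr 21 (by decide) (by decide) (by decide)).trans r21
    have q23 := (hr 23 (by decide) (by decide) (by decide)).trans r23
    have q14 := (hr 14 (by decide) (by decide) (by decide)).trans r14
    have li' := h'.i_le
    have lj' := h'.j_le
    have c1 := ofNat_eq_iff (w := w) (a := i') (b := 2 * L * b + L) (by omega) (by omega)
    have c2 := ofNat_eq_iff (w := w) (a := j') (b := 2 * L * b + 2 * L) (by omega) (by omega)
    refine Runs.eval (by simp [Prog.LoopFree]) ?_
    simp only [Prog.eval, WordOp.eval, Test.holds, q20, q21, q22, q23, c1, c2]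
    by_cases e1 : i' = 2 * L * b + L
    · rw [if_pos e1]
      by_cases e2 : j' = 2 * L * b + 2 * L
      · rw [if_pos e2]
        subst e1 e2
        refine ⟨fun r h => ?_, ?_, ?_, hm, b + 1, _, _, Or.inl ?_, ?_, ?_, ?_, ?_, h'.next⟩
        · simp only [State.setReg_reg]
          rw [if_neg (by omega), if_neg (by omega), if_neg (by omega), if_neg (by omega),
            hr r (by omega) (by omega) (by omega)]
        · simp [hr 24]
        · simp [hr 25]
        · rw [show 2 * L * (b + 1) = 2 * L * b + 2 * L by ring]; omega
        · simp
        · simp [q14, ← BitVec.ofNat_add, show 2 * L * (b + 1) = 2 * L * b + 2 * L by ring]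
        · simp [q14, ← BitVec.ofNat_add]
        · simp only [State.setReg_reg, q22, q14, Nat.reduceEqDiff, if_true, if_false, BitVec.or_self,
            ← BitVec.ofNat_add]
          congr 1; ring
      · rw [if_neg e2]
        exact ⟨fun r h => hr r (by omega) (by omega) (by omega),
          hr 24 (by decide) (by decide) (by decide), hr 25 (by decide) (by decide) (by decide), hm, b,
          i', j', Or.inr (by omega), q20, q21, q22, q23, h'⟩
    · rw [if_neg e1]
      exact ⟨fun r h => hr r (by omega) (by omega) (by omega),
        hr 24 (by decide) (by decide) (by decide), hr 25 (by decide) (by decide) (by decide), hm, b,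
        i', j', Or.inl (by omega), q20, q21, q22, q23, h'⟩

end WordRAM

namespace WordRAM

/-- A pass doubles the length of the sorted blocks and loses no element. The converse, that no element
occurs twice, is not needed. -/
theorem mergePass_runs {w L c N : ℕ} {σ : State w} {a : ℕ → BitVec w} {key : BitVec w → ℕ}
    (hL : 0 < L) (hc : 0 < c) (hN : N = 2 * L * c) (hNw : 4 * N < 2 ^ w)
    (hkey : ∀ v, key v = (σ.mem 1 v).toNat)
    (hmem : ∀ y, σ.mem 10 (BitVec.ofNat w y) = a y) (ha : BlockSorted key L N a)
    (r5 : σ.reg 5 = BitVec.ofNat w 1) (r10 : σ.reg 10 = BitVec.ofNat w N)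
    (r14 : σ.reg 14 = BitVec.ofNat w L) :
    Runs mergePass (50 * N + 10) σ (fun σ' => (∀ r < 20, σ'.reg r = σ.reg r) ∧
      σ'.reg 25 = σ.reg 25 ∧ (∀ s, s ≠ 10 → s ≠ 11 → σ'.mem s = σ.mem s) ∧
      BlockSorted key (2 * L) N (fun y => σ'.mem 10 (BitVec.ofNat w y)) ∧
      ∀ y < N, ∃ z < N, σ'.mem 10 (BitVec.ofNat w z) = a y) := by
  have hLN : 2 * L ≤ N := hN ▸ Nat.le_mul_of_pos_right _ hc
  refine Runs.andThen (Runs.eval (Q := fun σ₁ => (∀ r < 20, σ₁.reg r = σ.reg r) ∧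
    σ₁.reg 25 = σ.reg 25 ∧ σ₁.mem = σ.mem ∧ σ₁.reg 20 = BitVec.ofNat w 0 ∧
    σ₁.reg 21 = BitVec.ofNat w L ∧ σ₁.reg 22 = BitVec.ofNat w L ∧
    σ₁.reg 23 = BitVec.ofNat w (2 * L)) (by simp [Prog.LoopFree]) ?_) ?_ ?_
  · refine ⟨fun r hr => ?_, by simp [Prog.eval], rfl, ?_⟩
    · simp only [Prog.eval, State.setReg_reg]
      iterate 4 rw [if_neg (by omega)]
    · simp [Prog.eval, WordOp.eval, r14, two_mul, BitVec.ofNat_add]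
  · simp [Prog.size]
  rintro σ₁ ⟨hr₁, e25, hm₁, r20, r21, r22, r23⟩
  refine Runs.andThen (Runs.forUp (T := mergeStep.size) (i := 24) (lim := 10) (by decide) (N := N)
    (by omega) (fun x σ' => x ≤ N ∧ σ'.reg 24 = BitVec.ofNat w x ∧
      (∀ r < 20, σ'.reg r = σ.reg r) ∧ σ'.reg 25 = σ.reg 25 ∧ (∀ s, s ≠ 11 → σ'.mem s = σ.mem s) ∧
      ∃ b i j, (i < 2 * L * b + L ∨ j < 2 * L * b + 2 * L) ∧
        σ'.reg 20 = BitVec.ofNat w i ∧ σ'.reg 21 = BitVec.ofNat w (2 * L * b + L) ∧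
        σ'.reg 22 = BitVec.ofNat w j ∧ σ'.reg 23 = BitVec.ofNat w (2 * L * b + 2 * L) ∧
        MergeState key L a (fun z => σ'.mem 11 (BitVec.ofNat w z)) b i j x)
    (fun x σ' h => ⟨h.2.1, (h.2.2.1 10 (by decide)).trans r10⟩) ?_ ?_) ?_ ?_
  · rintro x hx σ' ⟨-, h24, hr, h25, hm, b, i, j, hij, q20, q21, q22, q23, h⟩
    have hb : 2 * L * b + 2 * L ≤ N := by
      have h1 := h.count
      have h2 := h.le_i
      have h3 := h.le_j
      have h4 : 2 * L * b < 2 * L * c := by omega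
      have h5 : b + 1 ≤ c := lt_of_mul_lt_mul_left h4 (Nat.zero_le _)
      calc 2 * L * b + 2 * L = 2 * L * (b + 1) := by ring
        _ ≤ 2 * L * c := Nat.mul_le_mul_left _ h5
        _ = N := hN.symm
    refine Runs.mono (mergeStep_runs hL (by omega) hx hb
      (fun v => by rw [hm 1 (by decide)]; exact hkey v)
      (fun y => by rw [hm 10 (by decide)]; exact hmem y) ha h hij ((hr 5 (by decide)).trans r5)
      ((hr 14 (by decide)).trans r14) q20 q21 q22 q23 h24) le_rfl ?_
    rintro σ'' ⟨g1, g2, g3, g4, b', i', j', hij', p20, p21, p22, p23, h'⟩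
    refine ⟨hx, ?_, fun r h => ?_, ?_, fun s h => (g4 s h).trans (hm s h), b', i', j', hij', ?_⟩
    · simp only [State.setReg_reg, if_true, g2, h24]
      exact (BitVec.ofNat_add x 1).symm
    · simp only [State.setReg_reg]
      rw [if_neg (by omega), if_neg (by omega), g1 r h, hr r h]
    · simpa using g3.trans h25
    · simpa using ⟨p20, p21, p22, p23, h'⟩
  · refine ⟨Nat.zero_le _, by simp, fun r h => ?_, by simpa using e25, fun s h => ?_, 0, 0, L,
      Or.inl (by omega), by simp [r20], by simp [r21], by simp [r22], by simp [r23], MergeState.start⟩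
    · simp only [State.setReg_reg]
      rw [if_neg (by omega), hr₁ r h]
    · rw [State.setReg_mem, hm₁]
  · simp [Prog.size, mergeStep]; omega
  rintro σ₂ ⟨-, -, hr₂, h25, hm₂, b, i, j, hij, -, -, -, -, h⟩
  refine Runs.mono (Runs.forEach (S := [10]) rfl (by decide) (N := N) (by omega)
    ((hr₂ 10 (by decide)).trans r10)
    (fun x col => col 10 = σ₂.mem 11 (BitVec.ofNat w x)) ?_) ?_ ?_
  · intro x hx σ' hs h40 hcol
    simp [Prog.eval, h40, hcol]
  · simp [Prog.size, mergeStep]; omega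
  rintro σ₃ ⟨hs, hR⟩
  beta_reduce at hR
  refine ⟨fun r hr => (hs.reg r (by omega)).trans (hr₂ r hr), (hs.reg 25 (by decide)).trans h25,
    fun s h1 h2 => (hs.mem s (by simpa using h1)).trans (hm₂ s h2), fun x y h1 h2 h3 => ?_,
    fun y hy => ?_⟩
  · beta_reduce
    rw [hR x (by omega), hR y h2]
    exact h.sorted x y h1 h2 h3
  · -- the last pair of blocks has been completed
    have hbN : N ≤ 2 * L * b := by
      by_contra hcon
      have h4 : 2 * L * b < 2 * L * c := by omega
      have h5 : b + 1 ≤ c := lt_of_mul_lt_mul_left h4 (Nat.zero_le _)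
      have h6 : 2 * L * (b + 1) ≤ 2 * L * c := Nat.mul_le_mul_left _ h5
      rw [mul_add, mul_one] at h6
      have := h.count
      have := h.i_le
      have := h.j_le
      omega
    obtain ⟨z, hz, e⟩ := h.covered y (Or.inl (by have := h.le_i; omega))
    exact ⟨z, hz, (hR z hz).trans e⟩

/-- Sorting of the addresses `0, …, N - 1`, where `N = 2 ^ l` is in register `10` and `l` in register
`11`, by the contents of segment `1`: segment `10` receives the sorted sequence, and segment `12` the
places of the addresses in it. -/
def sortAddresses : Prog :=
  forUp 40 10 (.store 10 40 40) ;; .const 14 1 ;; forUp 25 11 (mergePass ;; .op .add 14 14 14) ;;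
  forUp 25 10 (.load 30 10 25 ;; .store 12 30 25)

/-- Correctness of the sorting. The last clause says that segment `12` inverts segment `10`. -/
theorem sortAddresses_runs {w l : ℕ} {σ : State w} (hw : 4 * 2 ^ l < 2 ^ w)
    (r5 : σ.reg 5 = BitVec.ofNat w 1) (r10 : σ.reg 10 = BitVec.ofNat w (2 ^ l))
    (r11 : σ.reg 11 = BitVec.ofNat w l) :
    Runs sortAddresses (20 + 20 * 2 ^ l + l * (50 * 2 ^ l + 11 + 3)) σ (fun σ' =>
      (∀ r < 14, σ'.reg r = σ.reg r) ∧ (∀ s < 10, σ'.mem s = σ.mem s) ∧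
      (∀ x y, x ≤ y → y < 2 ^ l → (σ.mem 1 (σ'.mem 10 (.ofNat w x))).toNat ≤
        (σ.mem 1 (σ'.mem 10 (.ofNat w y))).toNat) ∧
      ∀ y < 2 ^ l, ∃ z < 2 ^ l, σ'.mem 12 (.ofNat w y) = .ofNat w z ∧
        σ'.mem 10 (.ofNat w z) = .ofNat w y) := by
  obtain ⟨N, hN⟩ : ∃ N, N = 2 ^ l := ⟨_, rfl⟩
  have hlN : l < N := hN ▸ Nat.lt_two_pow_self
  rw [← hN] at hw r10 ⊢
  refine Runs.andThen (Runs.forEach (S := [10]) rfl (by decide) (N := N) (by omega) r10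
    (fun x col => col 10 = BitVec.ofNat w x) ?_) ?_ ?_
  · intro x hx σ' hs h40 hcol
    simp [Prog.eval, h40]
  · simp [Prog.size]; omega
  rintro σ₁ ⟨hs₁, hR₁⟩
  beta_reduce at hR₁
  refine Runs.andThen (Runs.eval (P := .const 14 1) (Q := fun σ₂ =>
    σ₂ = σ₁.setReg 14 (BitVec.ofNat w 1)) trivial rfl) ?_ ?_
  · simp [Prog.size]; omega
  rintro _ rfl
  set key : BitVec w → ℕ := fun v => (σ.mem 1 v).toNat with hkey
  refine Runs.andThen (Runs.forUp (T := 50 * N + 11) (i := 25) (lim := 11) (by decide) (N := l)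
    (by omega) (fun k σ' => k ≤ l ∧ σ'.reg 25 = BitVec.ofNat w k ∧
      (∀ r < 14, σ'.reg r = σ.reg r) ∧ σ'.reg 14 = BitVec.ofNat w (2 ^ k) ∧
      (∀ s < 10, σ'.mem s = σ.mem s) ∧
      BlockSorted key (2 ^ k) N (fun y => σ'.mem 10 (BitVec.ofNat w y)) ∧
      ∀ y < N, ∃ z < N, σ'.mem 10 (BitVec.ofNat w z) = BitVec.ofNat w y)
    (fun k σ' h => ⟨h.2.1, (h.2.2.1 11 (by decide)).trans r11⟩) ?_ ?_) ?_ ?_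
  · rintro k hk σ' ⟨-, h25, hr, h14, hm, hsort, hcov⟩
    refine Runs.andThen (mergePass_runs (L := 2 ^ k) (c := 2 ^ (l - (k + 1))) (key := key)
      (a := fun y => σ'.mem 10 (BitVec.ofNat w y)) (by positivity) (by positivity) ?_ hw
      (fun v => by rw [hm 1 (by decide)]) (fun y => rfl) hsort ((hr 5 (by decide)).trans r5)
      ((hr 10 (by decide)).trans r10) h14) ?_ ?_
    · rw [hN, ← pow_succ', ← pow_add]
      congr 1; omega
    · omega
    rintro σ'' ⟨g1, g2, g3, g4, g5⟩
    refine Runs.mono (Runs.eval (P := .op .add 14 14 14) trivial rfl) ?_ ?_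
    · simp [Prog.size]
    rintro _ rfl
    refine ⟨hk, ?_, fun r h => ?_, ?_, fun s hs => (g3 s (by omega) (by omega)).trans (hm s hs), ?_,
      fun y hy => ?_⟩
    · simp only [Prog.eval, State.setReg_reg, if_true, Nat.reduceEqDiff, if_false, g2, h25]
      exact (BitVec.ofNat_add k 1).symm
    · simp only [Prog.eval, State.setReg_reg]
      rw [if_neg (by omega), if_neg (by omega), if_neg (by omega), g1 r (by omega), hr r h]
    · simp only [Prog.eval, WordOp.eval, State.setReg_reg, if_true, Nat.reduceEqDiff, if_false,
        g1 14 (by decide), h14]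
      rw [← BitVec.ofNat_add, pow_succ, mul_two]
    · rw [pow_succ']
      exact g4
    · obtain ⟨z, hz, e⟩ := hcov y hy
      obtain ⟨z', hz', e'⟩ := g5 z hz
      exact ⟨z', hz', e'.trans e⟩
  · refine ⟨Nat.zero_le _, by simp, fun r h => ?_, by simp, fun s h => ?_, ?_, fun y hy =>
      ⟨y, hy, hR₁ y hy⟩⟩
    · simp only [State.setReg_reg]
      rw [if_neg (by omega), if_neg (by omega), hs₁.reg r (by omega)]
    · exact hs₁.mem s (by simp; omega)
    · intro x y h1 h2 h3
      simp only [pow_zero, Nat.div_one] at h3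
      omega
  · simp [Prog.size]; omega
  rintro σ₃ ⟨-, -, hr₃, -, hm₃, hsort, hcov⟩
  refine Runs.mono (Runs.forUp (T := 2) (i := 25) (lim := 10) (by decide) (N := N)
    (by omega) (fun k σ' => k ≤ N ∧ σ'.reg 25 = BitVec.ofNat w k ∧
      (∀ r < 14, σ'.reg r = σ.reg r) ∧ (∀ s, s ≠ 12 → σ'.mem s = σ₃.mem s) ∧
      ∀ y, (∃ z < k, σ₃.mem 10 (.ofNat w z) = y) → ∃ z < k, σ'.mem 12 y = .ofNat w z ∧
        σ₃.mem 10 (.ofNat w z) = y)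
    (fun k σ' h => ⟨h.2.1, (h.2.2.1 10 (by decide)).trans r10⟩) ?_ ?_) ?_ ?_
  · rintro k hk σ' ⟨-, h25, hr, hm, hpos⟩
    refine Runs.eval (by simp [Prog.LoopFree]) ?_
    refine ⟨hk, ?_, fun r h => ?_, fun s hs => ?_, fun y hy => ?_⟩
    · simp [Prog.eval, h25, BitVec.ofNat_add]
    · simp only [Prog.eval, State.setReg_reg, State.setMem_reg]
      rw [if_neg (by omega), if_neg (by omega), if_neg (by omega), hr r h]
    · funext y
      simp [Prog.eval, hs, hm s hs]
    · have e : ∀ y, (Prog.eval (.load 30 10 25 ;; .store 12 30 25) σ').mem 12 y =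
          if y = σ₃.mem 10 (.ofNat w k) then .ofNat w k else σ'.mem 12 y := fun y => by
        simp [Prog.eval, h25, hm 10]
      simp only [State.setReg_mem, e]
      by_cases hyk : y = σ₃.mem 10 (.ofNat w k)
      · exact ⟨k, by omega, by rw [if_pos hyk], hyk.symm⟩
      · obtain ⟨z, hz, hzy⟩ := hy
        have hzk : z ≠ k := by rintro rfl; exact hyk hzy.symm
        obtain ⟨z', hz', h1, h2⟩ := hpos y ⟨z, by omega, hzy⟩
        exact ⟨z', by omega, by rw [if_neg hyk, h1], h2⟩
  · refine ⟨Nat.zero_le _, by simp, fun r h => ?_, fun s _ => rfl, fun y ⟨z, hz, _⟩ =>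
      absurd hz (by omega)⟩
    simp only [State.setReg_reg]
    rw [if_neg (by omega), hr₃ r h]
  · simp [Prog.size]; omega
  rintro σ₄ ⟨-, -, hr₄, hm₄, hpos⟩
  rw [hm₄ 10 (by decide)]
  refine ⟨hr₄, fun s hs => (hm₄ s (by omega)).trans (hm₃ s hs), fun x y h1 h2 => ?_, fun y hy =>
    hpos _ (hcov y hy)⟩
  rcases eq_or_lt_of_le h1 with rfl | h1
  · exact le_rfl
  · exact hsort x y h1 h2 (by
      rw [← hN, Nat.div_eq_of_lt h2, Nat.div_eq_of_lt (h1.trans h2)])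

end WordRAM

namespace WordRAM

/-! ### Bottleneck paths on the machine -/

/-- All-Pairs Bottleneck Path by means of a program `P` for Approximate Directed APSP, called with the
precision `1 / 11` and with mantissas of `C (l + 4)` bits, where `2 ^ l` is the least power of two that
is at least `n ^ 2`. An edge whose capacity has the place `y` in the sorted sequence gets the weight
`2 ^ (2 * n * (2 ^ l - y))`, and one of infinite capacity the weight `1`; so the exponent of a distance,
divided by `2 * n`, leads back to the address of the bottleneck. -/
def bottleneckByApsp (P : Prog) (C : ℕ) : Prog :=
  (.const 5 1 ;; .const 6 2 ;; .op .mul 7 0 0 ;; .const 9 0 ;; .const 10 1 ;; .const 11 0 ;;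
    .op .add 12 0 0) ;;
  .loop (.lt 10 7) (.op .add 10 10 10 ;; .op .add 11 11 5) ;;
  sortAddresses ;;
  forUp 40 7 (.load 42 0 40 ;; .ite (.eq 42 9) (.store 100 40 6) (.store 100 40 5 ;;
    .store 102 40 9 ;; .ite (.eq 42 5) (.load 43 12 40 ;; .op .sub 43 10 43 ;; .op .mul 43 12 43 ;;
      .store 101 40 43) (.store 101 40 9))) ;;
  (.op .or 100 0 0 ;; .const 101 4 ;; .op .add 101 11 101 ;; .const 103 C ;;
    .op .mul 101 103 101 ;; .op .or 102 5 5 ;; .const 103 11) ;;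
  P.shift 100 ;;
  forUp 40 7 (.load 42 106 40 ;; .ite (.eq 42 9) (.store 4 40 6) (.ite (.eq 42 5)
    (.load 43 107 40 ;; .op .div 43 43 12 ;; .ite (.eq 43 9) (.store 4 40 6)
      (.op .sub 43 10 43 ;; .load 43 10 43 ;; .load 43 1 43 ;; .store 4 40 5 ;; .store 5 40 43))
    (.store 4 40 9)))

/-- Correctness of the reduction. The cells of segment `1` beyond the matrix are sorted along with it;
this is harmless, since only ranks of actual edges occur in the weights. -/
theorem bottleneckByApsp_runs {P : Prog} {w n l γ κ C T : ℕ} (hn : 1 ≤ n)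
    (hl : l = Nat.clog 2 (n * n)) (hγ : γ = C * (l + 4)) (hw : 8 * 2 ^ l < 2 ^ w)
    (hκ : 2 * n * 2 ^ l < 2 ^ κ) (hκw : κ < w)
    (hP : ∀ τ : State w, τ.reg 0 = BitVec.ofNat w n → τ.reg 1 = BitVec.ofNat w γ →
      τ.reg 2 = BitVec.ofNat w 1 → τ.reg 3 = BitVec.ofNat w 11 → τ.FloatInput γ κ 0 n →
      Runs P T τ (fun τ' => τ'.FloatOutput γ 6 n ∧ ∀ u v : Fin n,
        graphDist (τ.floatMat γ 0 n) u v ≤ τ'.floatMat γ 6 n u v ∧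
        τ'.floatMat γ 6 n u v ≤
          (1 + ((1 : ℕ) : ℝ≥0∞) / ((11 : ℕ) : ℝ≥0∞)) * graphDist (τ.floatMat γ 0 n) u v))
    (σ : State w) (r0 : σ.reg 0 = BitVec.ofNat w n) (hin : σ.CapacityInput 0 n) :
    Runs (bottleneckByApsp P C)
      (200 + 200 * 2 ^ l + 3 * l + l * (50 * 2 ^ l + 11 + 3) + T) σ (fun σ₁ => ∀ u v : Fin n,
        σ₁.intMat 4 n u v = bottleneck (σ.intMat 0 n) u v) := by
  have hnl : n * n ≤ 2 ^ l := hl ▸ Nat.le_pow_clog (by norm_num) _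
  obtain ⟨N, hN⟩ : ∃ N, N = 2 ^ l := ⟨_, rfl⟩
  have hnn : n ≤ n * n := Nat.le_mul_of_pos_left n hn
  have hNw : N * 8 < 2 ^ w := by omega
  have hκ' : 2 ^ κ * 2 ≤ 2 ^ w := by
    rw [← pow_succ]; exact Nat.pow_le_pow_right (by norm_num) (by omega)
  have one : (BitVec.ofNat w 1).toNat = 1 := toNat_ofNat_of_lt (by omega)
  have two : (BitVec.ofNat w 2).toNat = 2 := toNat_ofNat_of_lt (by omega)
  have zero : (BitVec.ofNat w 0).toNat = 0 := toNat_ofNat_of_lt (by omega)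
  refine Runs.andThen (Runs.eval (Q := fun σ₁ => σ₁.reg 0 = σ.reg 0 ∧
    σ₁.reg 5 = BitVec.ofNat w 1 ∧ σ₁.reg 6 = BitVec.ofNat w 2 ∧
    σ₁.reg 7 = BitVec.ofNat w (n * n) ∧ σ₁.reg 9 = BitVec.ofNat w 0 ∧
    σ₁.reg 10 = BitVec.ofNat w 1 ∧ σ₁.reg 11 = BitVec.ofNat w 0 ∧
    σ₁.reg 12 = BitVec.ofNat w (2 * n) ∧ σ₁.mem = σ.mem) (by simp [Prog.LoopFree]) ?_) ?_ ?_
  · simp [Prog.eval, WordOp.eval, r0, two_mul, ← BitVec.ofNat_mul, ← BitVec.ofNat_add]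
  · simp [Prog.size]; omega
  rintro σ₁ ⟨q0, q5, q6, q7, q9, q10, q11, q12, m1⟩
  have hl3 : Nat.clog 2 (n * n) * 3 + 1 ≤ 3 * l + 1 := by rw [← hl]; omega
  have hnn2 : 2 * (n * n) < 2 ^ w := by omega
  refine Runs.andThen (Runs.clog (N := n * n) (by decide) (by decide) (by decide) (by decide)
    (by decide) hnn2 q7 q5 q10 q11) ?_ ?_
  · simp [Prog.size]; omega
  rintro σ₂ ⟨p10, p11, hr₂, m2⟩
  rw [← hl] at p10 p11
  refine Runs.andThen (sortAddresses_runs (by omega) ((hr₂ 5 (by decide) (by decide)).trans q5)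
    p10 p11) ?_ ?_
  · simp [Prog.size, ← hl]; omega
  rintro σ₃ ⟨hr₃, hm₃, hsort, hpos⟩
  have hmem₃ : ∀ s < 10, σ₃.mem s = σ.mem s := fun s hs => by rw [hm₃ s hs, m2, m1]
  rw [m2, m1] at hsort
  have v : ∀ r < 14, r ≠ 10 → r ≠ 11 → σ₃.reg r = σ₁.reg r := fun r h a b =>
    (hr₃ r h).trans (hr₂ r a b)
  have v0 := (v 0 (by decide) (by decide) (by decide)).trans (q0.trans r0)
  have v5 := (v 5 (by decide) (by decide) (by decide)).trans q5
  have v6 := (v 6 (by decide) (by decide) (by decide)).trans q6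
  have v7 := (v 7 (by decide) (by decide) (by decide)).trans q7
  have v9 := (v 9 (by decide) (by decide) (by decide)).trans q9
  have v10 := (hr₃ 10 (by decide)).trans p10
  have v11 := (hr₃ 11 (by decide)).trans p11
  have v12 := (v 12 (by decide) (by decide) (by decide)).trans q12
  rw [← hN] at v10 hpos hsort hnl
  clear hr₂ hr₃ hm₃ v q0 q5 q6 q7 q9 q10 q11 q12 p10 p11
  refine Runs.andThen (Runs.forEach (S := [100, 101, 102]) rfl (by decide) (N := n * n) (by omega) v7
    (fun x col => ((σ.mem 0 (.ofNat w x)) = .ofNat w 0 → col 100 = .ofNat w 2) ∧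
      ((σ.mem 0 (.ofNat w x)) = .ofNat w 1 → col 100 = .ofNat w 1 ∧ col 102 = .ofNat w 0 ∧
        ∀ z ≤ N, σ₃.mem 12 (.ofNat w x) = .ofNat w z →
          col 101 = .ofNat w (2 * n * (N - z))) ∧
      ((σ.mem 0 (.ofNat w x)) = .ofNat w 2 → col 100 = .ofNat w 1 ∧ col 102 = .ofNat w 0 ∧
        col 101 = .ofNat w 0)) ?_) ?_ ?_
  · intro x hx σ' hs h40 hcol
    have e5 := (hs.reg 5 (by decide)).trans v5
    have e6 := (hs.reg 6 (by decide)).trans v6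
    have e9 := (hs.reg 9 (by decide)).trans v9
    have e10 := (hs.reg 10 (by decide)).trans v10
    have e12 := (hs.reg 12 (by decide)).trans v12
    have n0 := (hcol 0).trans (congrFun (hmem₃ 0 (by decide)) _)
    have n12 := hcol 12
    have ne1 := ofNat_eq_iff (w := w) (a := 1) (b := 0) (by omega) (by omega)
    have ne2 := ofNat_eq_iff (w := w) (a := 2) (b := 0) (by omega) (by omega)
    have ne3 := ofNat_eq_iff (w := w) (a := 2) (b := 1) (by omega) (by omega)
    generalize σ.mem 0 (.ofNat w x) = t at *
    generalize σ₃.mem 12 (.ofNat w x) = z at *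
    refine ⟨?_, ?_, ?_⟩
    · rintro rfl
      simp [Prog.eval, Test.holds, h40, e6, e9, n0]
    · rintro rfl
      refine ⟨?_, ?_, ?_⟩
      · simp [Prog.eval, Test.holds, h40, e5, e9, n0, ne1]
      · simp [Prog.eval, Test.holds, h40, e5, e9, n0, ne1]
      · rintro z' hz' rfl
        have hsub := ofNat_sub (w := w) hz'
        simp [Prog.eval, WordOp.eval, Test.holds, h40, e5, e9, e10, e12, n0, n12, ne1, hsub,
          ← BitVec.ofNat_mul]
    · rintro rfl
      simp [Prog.eval, Test.holds, h40, e5, e9, n0, ne2, ne3]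
  · simp [Prog.size, ← hl]; omega
  rintro σ₄ ⟨hs₄, hR₄⟩
  beta_reduce at hR₄
  have c0 := (hs₄.reg 0 (by decide)).trans v0
  have c5 := (hs₄.reg 5 (by decide)).trans v5
  have c11 := (hs₄.reg 11 (by decide)).trans v11
  refine Runs.andThen (Runs.eval (Q := fun σ₅ => σ₅.mem = σ₄.mem ∧
    (∀ r < 40, σ₅.reg r = σ₃.reg r) ∧ σ₅.reg 100 = BitVec.ofNat w n ∧
    σ₅.reg 101 = BitVec.ofNat w γ ∧ σ₅.reg 102 = BitVec.ofNat w 1 ∧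
    σ₅.reg 103 = BitVec.ofNat w 11) (by simp [Prog.LoopFree]) ?_) ?_ ?_
  · refine ⟨rfl, fun r hr => ?_, ?_⟩
    · simp only [Prog.eval, State.setReg_reg]
      iterate 7 rw [if_neg (by omega)]
      exact hs₄.reg r hr
    · simp [Prog.eval, WordOp.eval, c0, c5, c11, hγ, ← BitVec.ofNat_mul, ← BitVec.ofNat_add]
  · simp [Prog.size, ← hl]; omega
  rintro σ₅ ⟨m5, hr₅, a0, a1, a2, a3⟩
  -- the ranks of the capacities, and the capacities of given rank
  set g : ℕ → ℕ∞ := fun r => if r = 0 then ⊤ else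
    ((σ.mem 1 (σ₃.mem 10 (.ofNat w (N - r)))).toNat : ℕ∞) with hg
  have hanti : ∀ r r', r ≤ r' → r' ≤ N → g r' ≤ g r := by
    intro r r' h1 h2
    by_cases hr : r = 0
    · simp [hg, hr]
    · simp only [hg, hr, show r' ≠ 0 by omega, if_false, Nat.cast_le]
      exact hsort _ _ (by omega) (by omega)
  have hexp : ∀ r ≤ N, 2 * n * r < 2 ^ κ := fun r hr =>
    (Nat.mul_le_mul_left _ hr).trans_lt (hN ▸ hκ)
  have hint : ∀ r ≤ N, (BitVec.ofNat w (2 * n * r)).toInt = (2 * n * r : ℕ) := fun r hr => by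
    have h1 := hexp r hr
    rw [BitVec.toInt_eq_toNat_of_lt] <;> rw [toNat_ofNat_of_lt (by omega)]
    omega
  have hfval : ∀ r ≤ N, ENNReal.ofReal (fval γ (BitVec.ofNat w (2 * n * r)).toInt
      (BitVec.ofNat w 0).toNat) = 2 ^ (2 * n * r) := fun r hr => by
    rw [hint r hr, zero, fval, zpow_natCast]
    simp [ENNReal.ofReal_pow]
  have hcell : ∀ u v : Fin n, (((σ₅.view 100).cell 0 n u v = .ofNat w 2 ∧
      σ.intMat 0 n u v = 0) ∨ ∃ r ≤ N, (σ₅.view 100).cell 0 n u v = .ofNat w 1 ∧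
      (σ₅.view 100).cell 1 n u v = .ofNat w (2 * n * r) ∧
      (σ₅.view 100).cell 2 n u v = .ofNat w 0 ∧ σ.intMat 0 n u v = g r) := by
    intro u v
    obtain ⟨h1, h2, h3⟩ := hR₄ _ (index_lt u v)
    have hi := hin u v
    simp only [State.cell, State.view, m5, zero_add, Nat.reduceAdd, State.intMat_eq, intCell] at hi ⊢
    rcases hi with hi | ⟨hi, -⟩ | hi
    · exact Or.inl ⟨h1 ((eq_ofNat_iff _ (by omega)).2 hi), if_pos hi⟩
    · obtain ⟨k1, k2, k3⟩ := h2 ((eq_ofNat_iff _ (by omega)).2 hi)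
      obtain ⟨z, hz, e1, e2⟩ := hpos (u * n + v) ((index_lt u v).trans_le hnl)
      refine Or.inr ⟨N - z, by omega, k1, k3 z hz.le e1, k2, ?_⟩
      simp only [hi, hg, one_ne_zero, if_false, if_true, show N - z ≠ 0 by omega,
        show N - (N - z) = z by omega, e2]
    · obtain ⟨k1, k2, k3⟩ := h3 ((eq_ofNat_iff _ (by omega)).2 hi)
      exact Or.inr ⟨0, Nat.zero_le _, k1, by simpa using k3, k2, by simp [hi, hg]⟩
  have hrank : RankWeights N g ((σ₅.view 100).floatMat γ 0 n) (σ.intMat 0 n) := by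
    intro u v
    rcases hcell u v with ⟨h1, h2⟩ | ⟨r, hr, h1, h2, h3, h4⟩
    · exact Or.inl ⟨by simp [State.floatMat, h1, two, -BitVec.toNat_ofNat], h2⟩
    · refine Or.inr ⟨r, hr, ?_, h4⟩
      simp only [State.floatMat, h1, h2, h3, zero_add, one, one_ne_zero, if_false, if_true]
      exact hfval r hr
  refine Runs.andThen (Runs.shift (hP (σ₅.view 100) a0 a1 a2 a3 fun u v => ?_)) ?_ ?_
  · rcases hcell u v with ⟨h1, -⟩ | ⟨r, hr, h1, h2, h3, -⟩
    · exact Or.inr (h1 ▸ two)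
    · refine Or.inl ⟨h1 ▸ one, ?_, ?_, ?_⟩
      · rw [zero_add, h2, hint r hr]; positivity
      · rw [zero_add, h2, hint r hr]; exact_mod_cast hexp r hr
      · rw [zero_add, h3, zero]; positivity
  · simp [Prog.size, ← hl]; omega
  set W := (σ₅.view 100).floatMat γ 0 n
  set U := σ.intMat 0 n
  rintro σ₆ ⟨⟨hout, hd⟩, hr₆, hm₆⟩
  have hreg : ∀ r < 40, σ₆.reg r = σ₃.reg r := fun r hr => (hr₆ r (by omega)).trans (hr₅ r hr)
  have hm1 : σ₆.mem 1 = σ.mem 1 := by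
    rw [hm₆ 1 (by decide), m5, hs₄.mem 1 (by decide), hmem₃ 1 (by decide)]
  have hm10 : σ₆.mem 10 = σ₃.mem 10 := by
    rw [hm₆ 10 (by decide), m5, hs₄.mem 10 (by decide)]
  refine Runs.mono (Runs.forEach (S := [4, 5]) rfl (by decide) (N := n * n) (by omega)
    ((hreg 7 (by decide)).trans v7)
    (fun x col => ((σ₆.mem 106 (.ofNat w x)) = .ofNat w 0 → col 4 = .ofNat w 2) ∧
      (∀ r ≤ N, (σ₆.mem 106 (.ofNat w x)) = .ofNat w 1 →
        σ₆.mem 107 (.ofNat w x) / .ofNat w (2 * n) = .ofNat w r →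
        (r = 0 → col 4 = .ofNat w 2) ∧ (r ≠ 0 → col 4 = .ofNat w 1 ∧
          col 5 = σ.mem 1 (σ₃.mem 10 (.ofNat w (N - r))))) ∧
      ((σ₆.mem 106 (.ofNat w x)) ≠ .ofNat w 0 → (σ₆.mem 106 (.ofNat w x)) ≠ .ofNat w 1 →
        col 4 = .ofNat w 0)) ?_) ?_ ?_
  · intro x hx σ' hs h40 hcol
    have e5 := (hs.reg 5 (by decide)).trans ((hreg 5 (by decide)).trans v5)
    have e6 := (hs.reg 6 (by decide)).trans ((hreg 6 (by decide)).trans v6)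
    have e9 := (hs.reg 9 (by decide)).trans ((hreg 9 (by decide)).trans v9)
    have e10 := (hs.reg 10 (by decide)).trans ((hreg 10 (by decide)).trans v10)
    have e12 := (hs.reg 12 (by decide)).trans ((hreg 12 (by decide)).trans v12)
    have s1 : σ'.mem 1 = σ.mem 1 := (hs.mem 1 (by decide)).trans hm1
    have s10 : σ'.mem 10 = σ₃.mem 10 := (hs.mem 10 (by decide)).trans hm10
    have n106 := hcol 106
    have n107 := hcol 107
    have ne1 := ofNat_eq_iff (w := w) (a := 1) (b := 0) (by omega) (by omega)
    generalize σ₆.mem 106 (.ofNat w x) = t at *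
    generalize σ₆.mem 107 (.ofNat w x) = e at *
    generalize BitVec.ofNat w (2 * n) = M at *
    refine ⟨?_, ?_, ?_⟩
    · rintro rfl
      simp [Prog.eval, Test.holds, h40, e6, e9, n106]
    · rintro r hr rfl he
      have ne2 := ofNat_eq_iff (w := w) (a := r) (b := 0) (by omega) (by omega)
      refine ⟨?_, fun hr0 => ?_⟩
      · rintro rfl
        simp [Prog.eval, WordOp.eval, Test.holds, h40, e5, e6, e9, e12, n106, n107, ne1, he]
      · have hsub := ofNat_sub (w := w) hr
        simp [Prog.eval, WordOp.eval, Test.holds, h40, e5, e9, e10, e12, n106, n107, ne1, ne2, he,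
          hr0, hsub, s1, s10]
    · intro t1 t2
      simp [Prog.eval, Test.holds, h40, e5, e9, n106, t1, t2]
  · simp [Prog.size, ← hl]; omega
  rintro σ₇ ⟨-, hR₇⟩
  beta_reduce at hR₇
  intro u v
  obtain ⟨h1, h2, h3⟩ := hR₇ _ (index_lt u v)
  obtain ⟨d1, d2⟩ := hd u v
  have hfO : (σ₆.mem 106 (.ofNat w (u * n + v))).toNat = 1 →
      (σ₆.mem 108 (.ofNat w (u * n + v))).toNat < 2 ^ γ := hout u v
  have hc6 : (σ₆.view 100).floatMat γ 6 n u v = floatCell γ (σ₆.mem 106 (.ofNat w (u * n + v)))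
    (σ₆.mem 107 (.ofNat w (u * n + v))) (σ₆.mem 108 (.ofNat w (u * n + v))) := rfl
  rw [hc6, floatCell] at d1 d2
  have hd2 : (1 + ((1 : ℕ) : ℝ≥0∞) / ((11 : ℕ) : ℝ≥0∞)) * graphDist W u v ≤ 2 * graphDist W u v := by
    gcongr
    rw [← one_add_one_eq_two]
    gcongr
    exact ENNReal.div_le_of_le_mul (by norm_num)
  have hself : u = v → σ₆.mem 106 (.ofNat w (u * n + v)) = .ofNat w 0 := by
    rintro rfl
    rw [graphDist_self, mul_zero, nonpos_iff_eq_zero] at d2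
    rw [eq_ofNat_iff _ (by omega)]
    by_contra hne
    rw [if_neg hne] at d2
    split_ifs at d2
    · rw [ENNReal.ofReal_eq_zero] at d2
      exact absurd (fval_pos _ _ _) (not_lt.2 d2)
    · exact absurd d2 ENNReal.top_ne_zero
  rw [State.intMat_eq]
  change intCell (σ₇.mem 4 (.ofNat w (u * n + v))) (σ₇.mem 5 (.ofNat w (u * n + v))) = _
  by_cases t0 : σ₆.mem 106 (.ofNat w (u * n + v)) = .ofNat w 0
  · have huv : u = v := by
      by_contra hne
      have := one_le_graphDist hrank.one_le hne
      rw [t0, if_pos zero] at d1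
      exact absurd (this.trans d1) (by norm_num)
    subst huv
    rw [h1 t0]
    have : bottleneck U u u = ⊤ := top_le_iff.1 (le_bottleneck U (l := []) rfl)
    simp [intCell, two, this, -BitVec.toNat_ofNat]
  have huv : u ≠ v := fun h => t0 (hself h)
  by_cases t1 : σ₆.mem 106 (.ofNat w (u * n + v)) = .ofNat w 1
  · rw [t1, one, if_neg one_ne_zero, if_pos rfl] at d1 d2
    replace hfO := hfO (t1 ▸ one)
    generalize σ₆.mem 107 (.ofNat w (u * n + v)) = e at *
    generalize (σ₆.mem 108 (.ofNat w (u * n + v))).toNat = f at *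
    have hone := (one_le_graphDist hrank.one_le huv).trans d1
    rw [ENNReal.one_le_ofReal] at hone
    have he0 := exp_nonneg_of_one_le_fval hfO hone
    have heN : e.toInt = e.toNat := by
      rw [BitVec.toInt_eq_toNat_cond] at he0 ⊢
      split_ifs at he0 ⊢ with hc
      · rfl
      · have := e.isLt; omega
    rw [heN] at d1 d2
    have hpow : ∀ k : ℕ, ENNReal.ofReal ((2 : ℝ) ^ (k : ℤ)) = 2 ^ k := fun k => by
      rw [zpow_natCast, ENNReal.ofReal_pow (by norm_num), ENNReal.ofReal_ofNat]
    have hlow : (2 : ℝ≥0∞) ^ e.toNat ≤ ENNReal.ofReal (fval γ e.toNat f) := by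
      rw [← hpow]; exact ENNReal.ofReal_le_ofReal (zpow_le_fval _ _ _)
    have hup : ENNReal.ofReal (fval γ e.toNat f) < (2 : ℝ≥0∞) ^ (e.toNat + 1) := by
      rw [← hpow, ENNReal.ofReal_lt_ofReal_iff (by positivity)]
      rw [Nat.cast_add_one]
      exact fval_lt_zpow _ hfO
    obtain ⟨hle, hb⟩ := hrank.bottleneck_eq hanti huv d1 (d2.trans hd2) hlow hup
    have hdiv : e / BitVec.ofNat w (2 * n) = BitVec.ofNat w (e.toNat / (2 * n)) := by
      have := ofNat_div (w := w) (a := e.toNat) (b := 2 * n) e.isLt (by omega)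
      rwa [BitVec.ofNat_toNat, BitVec.setWidth_eq] at this
    obtain ⟨k1, k2⟩ := h2 _ hle t1 hdiv
    rw [hb]
    by_cases hr : e.toNat / (2 * n) = 0
    · rw [k1 hr, hr]
      simp [intCell, two, hg, -BitVec.toNat_ofNat]
    · rw [(k2 hr).1, (k2 hr).2]
      simp only [intCell, one, one_ne_zero, if_false, if_true, hg, hr]
  · rw [h3 t0 t1]
    rw [eq_ofNat_iff _ (by omega)] at t0 t1
    rw [if_neg t0, if_neg t1, top_le_iff] at d2
    have htop : graphDist W u v = ⊤ := by
      by_contra hne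
      exact absurd (d2 ▸ hd2) (not_le.2 (ENNReal.mul_lt_top (by simp) (lt_top_iff_ne_top.2 hne)))
    rw [hrank.bottleneck_eq_zero huv htop]
    simp [intCell, zero, -BitVec.toNat_ofNat]

end WordRAM

/-- The parameters of the call are functions of `l = ⌈log₂ (n ^ 2)⌉`: mantissas of `C (l + 4)` bits, as
`11 n ≤ 2 ^ (l + 4)`, and exponents of `2 l + 2` bits. A word of `O(log n)` bits has room for them. -/
theorem bottleneckSolvable_of_approxDirectedAPSPSolvable {c : ℝ} (hc : 2 ≤ c)
    (h : ApproxDirectedAPSPSolvable c) : BottleneckSolvable c := by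
  obtain ⟨P, C, hP⟩ := h
  refine ⟨bottleneckByApsp P C, 3 * (C * (C + 2) + 3) + C * (C * 4 + 2) + 10 +
    ⌈6000 + C * (11 : ℝ) ^ C * 4 ^ C⌉₊, ?_⟩
  set C' := 3 * (C * (C + 2) + 3) + C * (C * 4 + 2) + 10 + ⌈6000 + C * (11 : ℝ) ^ C * 4 ^ C⌉₊ with hC'
  intro n w hn hw σ h0 hin
  obtain ⟨l, hl⟩ : ∃ l, l = Nat.clog 2 (n * n) := ⟨_, rfl⟩
  have hpow : ∀ a b : ℕ, 3 * a + b ≤ C' → l * a + b ≤ w := by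
    intro a b hab
    have h2l : 2 ^ l ≤ (n + 1) ^ 3 := by
      rcases Nat.eq_zero_or_pos l with h | h
      · rw [h]; exact Nat.one_le_pow _ _ (by omega)
      · have h1 : 2 ^ (l - 1) < n * n := (Nat.lt_clog_iff_pow_lt (by norm_num)).1 (by omega)
        have h2 : 2 ^ l = 2 * 2 ^ (l - 1) := by rw [← pow_succ']; congr 1; omega
        rw [h2]
        nlinarith [Nat.zero_le (n ^ 3)]
    have h1 : 2 ^ (l * a + b) ≤ 2 ^ w :=
      calc 2 ^ (l * a + b) = (2 ^ l) ^ a * 2 ^ b := by rw [pow_add, pow_mul]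
        _ ≤ ((n + 1) ^ 3) ^ a * (n + 1) ^ b := by gcongr; omega
        _ = (n + 1) ^ (3 * a + b) := by rw [pow_add, pow_mul]
        _ ≤ (n + 1) ^ C' := Nat.pow_le_pow_right (by omega) hab
        _ ≤ 2 ^ w := hw
    exact (Nat.pow_le_pow_iff_right (by norm_num)).1 h1
  have hnl : n * n ≤ 2 ^ l := hl ▸ Nat.le_pow_clog (by norm_num) _
  have hnn : n ≤ n * n := Nat.le_mul_of_pos_left n hn
  have hn' : (1 : ℝ) ≤ n := by exact_mod_cast hn
  have hw4 : l + 4 ≤ w := by simpa using hpow 1 4 (by omega)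
  have hw16 : 2 ^ l * 16 ≤ 2 ^ w := by
    have : 2 ^ (l + 4) ≤ 2 ^ w := Nat.pow_le_pow_right (by norm_num) hw4
    rwa [pow_add] at this
  have hl0 : 0 < 2 ^ l := by positivity
  have hε : ((1 : ℕ) : ℝ) / ((11 : ℕ) : ℝ) = 1 / 11 := by norm_num
  have hnε : (n : ℝ) / (((1 : ℕ) : ℝ) / ((11 : ℕ) : ℝ)) = 11 * n := by rw [hε]; ring
  have hcall := fun τ a b d e => hP n 1 11 (C * (l + 4)) (2 * l + 2) w hn one_pos (by norm_num)
    (by omega) ?_ ?_ τ a b d e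
  rotate_left
  · rw [hnε]
    have h1 : 11 * n ≤ 2 ^ (l + 4) := by rw [pow_add]; omega
    have h2 : (11 : ℝ) * n ≤ 2 ^ (l + 4) := by exact_mod_cast h1
    calc (11 * (n : ℝ)) ^ C ≤ (2 ^ (l + 4)) ^ C := by gcongr
      _ = 2 ^ (C * (l + 4)) := by rw [← pow_mul, mul_comm]
  · have := hpow (C * (C + 2)) (C * (C * 4 + 2)) (by omega)
    exact le_trans (le_of_eq (by ring)) this
  obtain ⟨T, hT⟩ : ∃ T, T = ⌊C * (n : ℝ) ^ c / (((1 : ℕ) : ℝ) / ((11 : ℕ) : ℝ)) ^ C *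
    Real.log (n / (((1 : ℕ) : ℝ) / ((11 : ℕ) : ℝ))) ^ C⌋₊ := ⟨_, rfl⟩
  have hκ : 2 * n * 2 ^ l < 2 ^ (2 * l + 2) := by
    rw [show 2 * l + 2 = l + l + 2 by ring, pow_add, pow_add]
    nlinarith
  obtain ⟨t, σ₁, he, ht, hpost⟩ := bottleneckByApsp_runs (T := T) hn hl rfl (by omega) hκ
    (by have := hpow 2 3 (by omega); omega) (fun τ a b d e f => by
      obtain ⟨t, τ', he, ht, hpost⟩ := hcall τ a b d e f
      exact ⟨t, τ', he, hT ▸ Nat.le_floor ht, hpost⟩) σ h0 hin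
  refine ⟨t, σ₁, he, ?_, hpost⟩
  have hlog := one_le_log_add_two hn
  set ℓ := Real.log (n + 2) with hℓ
  have h2ℓ : Real.log ((n * n : ℕ) : ℝ) ≤ 2 * ℓ := by
    rw [hℓ, ← Real.log_rpow (by positivity)]
    refine Real.log_le_log (by positivity) ?_
    rw [Real.rpow_two]; push_cast
    nlinarith
  have hlℓ : ((l + 1 : ℕ) : ℝ) ≤ 6 * ℓ := by
    have := clog_add_one_le (n := n * n) (ℓ := 2 * ℓ) (by linarith) h2ℓ
    rw [hl]; linarith
  refine exact_time_le (K := 6000 + C * (11 : ℝ) ^ C * 4 ^ C) (a := C + 1) hn ?_ ?_ (by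
    have : C ≤ C * (C * 4 + 2) := Nat.le_mul_of_pos_right C (by positivity)
    omega)
  · have h2l : 2 ^ l ≤ 2 * n ^ 2 := by
      rcases Nat.eq_zero_or_pos l with h | h
      · rw [h]; nlinarith
      · have h1 : 2 ^ (l - 1) < n * n := (Nat.lt_clog_iff_pow_lt (by norm_num)).1 (by omega)
        have h2 : 2 ^ l = 2 * 2 ^ (l - 1) := by rw [← pow_succ']; congr 1; omega
        rw [h2, pow_two]
        omega
    have ht' : t ≤ 500 * ((l + 1) * (2 * n ^ 2)) + T := by
      have a1 : (l + 1) * 2 ^ l ≤ (l + 1) * (2 * n ^ 2) := Nat.mul_le_mul_left _ h2l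
      have a2 : l ≤ l * 2 ^ l := Nat.le_mul_of_pos_right l hl0
      rw [add_mul, one_mul] at a1
      have a3 : l * (50 * 2 ^ l + 11 + 3) = 50 * (l * 2 ^ l) + 14 * l := by ring
      omega
    have hlog11 : 0 ≤ Real.log (11 * n) := Real.log_nonneg (by linarith)
    have hlog4 : Real.log (11 * n) ≤ 4 * ℓ := by
      rw [hℓ, ← Real.log_rpow (by positivity)]
      refine Real.log_le_log (by positivity) ?_
      have : ((n : ℝ) + 2) ^ (4 : ℝ) = ((n : ℝ) + 2) ^ 4 := Real.rpow_ofNat _ 4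
      rw [this]
      have h3 : (3 : ℝ) ^ 3 ≤ ((n : ℝ) + 2) ^ 3 := by gcongr; linarith
      calc (11 : ℝ) * n ≤ 3 ^ 3 * (n + 2) := by linarith
        _ ≤ (n + 2) ^ 3 * (n + 2) := by gcongr
        _ = (n + 2) ^ 4 := by ring
    set N := (n : ℝ) ^ c with hN
    have hN0 : 0 ≤ N := by positivity
    have hsq : ((n ^ 2 : ℕ) : ℝ) ≤ N := sq_le_rpow hn hc
    have hℓC : 1 ≤ ℓ ^ C := one_le_pow₀ hlog
    have hTN : (T : ℝ) ≤ C * 11 ^ C * 4 ^ C * (N * ℓ ^ (C + 1)) := by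
      rw [hT]
      refine (Nat.floor_le (by rw [hnε]; positivity)).trans ?_
      rw [hnε, hε]
      calc C * N / (1 / 11) ^ C * Real.log (11 * n) ^ C ≤ C * N / (1 / 11) ^ C * (4 * ℓ) ^ C := by
            gcongr
        _ = C * 11 ^ C * 4 ^ C * (N * ℓ ^ C) := by
            rw [one_div, inv_pow, div_inv_eq_mul, mul_pow]; ring
        _ ≤ C * 11 ^ C * 4 ^ C * (N * ℓ ^ (C + 1)) := by
            gcongr
            exact Nat.le_succ C
    calc (t : ℝ) ≤ 500 * (((l + 1 : ℕ) : ℝ) * (2 * ((n ^ 2 : ℕ) : ℝ))) + T := by exact_mod_cast ht'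
      _ ≤ 500 * ((6 * ℓ) * (2 * N)) * ℓ ^ C + C * 11 ^ C * 4 ^ C * (N * ℓ ^ (C + 1)) := by
        refine add_le_add (le_trans ?_ (le_mul_of_one_le_right (by positivity) hℓC)) hTN
        gcongr
      _ = (6000 + C * (11 : ℝ) ^ C * 4 ^ C) * N * ℓ ^ (C + 1) := by rw [pow_succ]; ring
  · rw [hC']
    push_cast
    have := Nat.le_ceil (6000 + C * (11 : ℝ) ^ C * 4 ^ C)
    have h1 : (0 : ℝ) ≤ C := Nat.cast_nonneg C
    nlinarith [mul_nonneg h1 h1]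

/-! ### The equivalence -/

theorem theorem1p4 (c : ℝ) (hc : 2 ≤ c) :
    List.TFAE
      [ApproxDirectedAPSPSolvable c,
       ApproxMinPlusSolvable c,
       MinMaxSolvable c,
       BottleneckSolvable c] := by
  tfae_have 1 → 4 := bottleneckSolvable_of_approxDirectedAPSPSolvable hc
  tfae_have 4 → 3 := minMaxSolvable_of_bottleneckSolvable hc
  tfae_have 3 → 2 := approxMinPlusSolvable_of_minMaxSolvable hc
  tfae_have 2 → 1 := approxDirectedAPSPSolvable_of_approxMinPlusSolvable hc
  tfae_finish
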